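/- Conventions. A distance graph $\Gamma=\Gamma(V,E)$ in $\mathbb R^m$ is a connected finite (simple) graph whose vertex set $V$ is a set of points of $\mathbb R^m$. It is $k$-degenerate if each of its nonempty subgraphs contains a vertex of degree at most $k$ in that subgraph. It is a proper $k$-degenerate distance graph if, moreover, its vertices can be ordered $v_0,v_1,\dots,v_n$ in such a way that for every $j$ the set $V_j=\{v_i : i<j,\ (v_i,v_j)\in E\}$ has at most $k$ elements and $\{v_j\}\cup V_j$ is in general position, i.e. affinely independent. For $\lambda>0$, a set $A\subseteq\mathbb R^d$ contains an isometric copy of $\lambda\cdot\Gamma$ if there are a distance graph $\Gamma'=\Gamma'(V',E')$ with $V'\subseteq A$ and a bijection $\phi:V\to V'$ such that $(v,w)\in E$ if and only if $(\phi(v),\phi(w))\in E'$, and $|\phi(v)-\phi(w)|=\lambda|v-w|$ for all $(v,w)\in E$. The upper Banach density of a Lebesgue measurable set $A\subseteq\mathbb R^d$ is $$\delta^*(A)=\lim_{N\to\infty}\sup_{t\in\mathbb R^d}\frac{|A\cap(t+Q_N)|}{|Q_N|},\qquad Q_N=[-N/2,N/2]^d,$$ where $|\cdot|$ is Lebesgue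 measure. Theorem. Let $\Gamma=\Gamma(V,E)$ be a proper $k$-degenerate distance graph in $\mathbb R^m$ with $m\le d$, and let $d\ge k+1$. (i) If $A\subseteq\mathbb R^d$ is measurable and has positive upper Banach density, then there is $\lambda_0=\lambda_0(A,\Gamma)>0$ such that $A$ contains an isometric copy of $\lambda\cdot\Gamma$ for every $\lambda\ge\lambda_0$. (ii) There are an absolute constant $C>0$ and a constant $C_\Gamma>0$ depending only on $\Gamma$ (with its degeneracy parameter $k$ and the dimension $d$) such that, for every measurable $A\subseteq[0,1]^d$ with $|A|>0$, the set $A$ contains an isometric copy of $\lambda\cdot\Gamma$ for all $\lambda$ in some closed interval $[a,b]\subseteq(0,\infty)$ of length $b-a\ge\exp\left(-C_\Gamma|A|^{-C|V|}\right)$. The condition $d\ge k+1$ is sharp: for every $k\ge1$ there are a proper $k$-degenerate distance graph $\Gamma$ in $\mathbb R^k$ and a measurable set $A\subseteq\mathbb R^k$ of positive upper Banach density such that for arbitrarily large $\lambda$ the set $A$ contains no isometric copy of $\lambda\cdot\Gamma$. -/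

import Mathlib

open MeasureTheory Filter

/-- Euclidean space `ℝᵈ`, with the Euclidean norm and Lebesgue measure. -/
abbrev E (d : ℕ) : Type := EuclideanSpace ℝ (Fin d)

/-- The closed cube `t + Q_N` with `Q_N = [-N/2, N/2]ᵈ`. -/
def cube {d : ℕ} (t : E d) (N : ℝ) : Set (E d) :=
  {x | ∀ i, |x i - t i| ≤ N / 2}

/-- The unit cube `[0,1]ᵈ`. -/
def unitCube (d : ℕ) : Set (E d) :=
  {x | ∀ i, 0 ≤ x i ∧ x i ≤ 1}

/-- The upper Banach density: the limit, as the real number `N` tends to infinity, of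
`sup_t |A ∩ (t + Q_N)| / |Q_N|`.  The limit exists, so it is the upper limit written here. -/
noncomputable def upperBanachDensity {d : ℕ} (A : Set (E d)) : ENNReal :=
  limsup (fun N : ℝ => ⨆ t : E d, volume (A ∩ cube t N) / volume (cube (0 : E d) N)) atTop

/-- A distance graph: a connected finite graph whose vertices are points of `ℝᵈ`. -/
structure DistanceGraph (d : ℕ) where
  /-- the vertex set, a finite set of points -/
  verts : Finset (E d)
  /-- the edges -/
  graph : SimpleGraph verts
  connected : graph.Connected

namespace DistanceGraph

variable {d m : ℕ}

/-- `Γ` is `k`-degenerate: each (nonempty) subgraph has a vertex whose degree, in that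
subgraph, is at most `k`. -/
def IsDegenerate (Γ : DistanceGraph d) (k : ℕ) : Prop :=
  ∀ H : Γ.graph.Subgraph, H.verts.Nonempty →
    ∃ v ∈ H.verts, (H.neighborSet v).ncard ≤ k

/-- For an ordering `v` of the vertices, the set of predecessors of the vertex `v j`: its
neighbours `v i` with `i < j`. -/
def predecessors (Γ : DistanceGraph d) (v : Fin Γ.verts.card ≃ Γ.verts)
    (j : Fin Γ.verts.card) : Set (E d) :=
  {x | ∃ i, i < j ∧ Γ.graph.Adj (v i) (v j) ∧ x = (v i : E d)}

/-- `Γ` is proper (as a `k`-degenerate graph): its vertices can be ordered so that every vertex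
has at most `k` predecessors and, together with its predecessors, is in general position
(that is, affinely independent). -/
def IsProper (Γ : DistanceGraph d) (k : ℕ) : Prop :=
  ∃ v : Fin Γ.verts.card ≃ Γ.verts, ∀ j,
    (Γ.predecessors v j).ncard ≤ k ∧
    AffineIndependent ℝ
      (fun x : (insert (v j : E d) (Γ.predecessors v j) : Set (E d)) => (x : E d))

/-- `Γ'` is isometric to `r · Γ`: there is a bijection of the vertex sets that preserves adjacency
in both directions and multiplies the length of every edge by `r`. -/
def IsIsometricTo (Γ' : DistanceGraph d) (r : ℝ) (Γ : DistanceGraph m) : Prop :=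
  ∃ φ : Γ.graph ≃g Γ'.graph, ∀ v w, Γ.graph.Adj v w →
    ‖(φ v : E d) - (φ w : E d)‖ = r * ‖(v : E m) - (w : E m)‖

/-- The set `A` contains an isometric copy of `r · Γ`. -/
def HasCopyIn (Γ : DistanceGraph m) (r : ℝ) (A : Set (E d)) : Prop :=
  ∃ Γ' : DistanceGraph d, Γ'.IsIsometricTo r Γ ∧ (Γ'.verts : Set (E d)) ⊆ A

end DistanceGraph

/-!
## Dilates of distance graphs in sets of positive measure

*Flexible configurations.* A proper `k`-degenerate graph in `ℝᵈ`, `k < d`, can be drawn by placing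
its vertices in order. The earlier neighbours of a vertex are at most `k` affinely independent
points, so the positions at the prescribed distances from them contain a circle, and the vertex can
be moved along a small arc of it, continuously in the positions of the earlier vertices. This gives
a `FlexibleConfig`: every vertex but the first has its own parameter in `[0,1]` and moves along a
circular arc when that parameter varies (`DistanceGraph.exists_flexibleConfig`). Small arcs keep the
vertices distinct, so every moved configuration is an isometric copy of the graph.

*Counting.* For `f` with values in `[0,1]`, supported in the unit cube and of mean at least `δ`, let
`f_l = cellAvg l f` be its average over the dyadic cells of side `2⁻ˡ`. One averages
`∏ j, f (x + r • U (w j θ))` over the base point `x`, the parameters `θ` and the rotation `U`, and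
replaces the factors, the last one first, by `f_a x`, where `2⁻ᵃ` is much larger than `r`. Finally
`∫ f * f_a ^ (N - 1) = ∫ f_a ^ N ≥ δ ^ N`. Each replacement makes three errors, with
`f = f_a + (f_b - f_a) + (f - f_b)` and `2⁻ᵇ` much smaller than `r`:

* `f_a (x + y) - f_a x` vanishes unless `x + y` lies in another cell than `x`
  (`IsCubeWeight.abs_integral_mul_translate_sub_le`);
* the middle term is small in `L²` on one of many disjoint windows of scales `[a, b]`, because the
  energies `∫ f_l ^ 2` increase and are bounded (`IsCubeDensity.exists_integral_sq_cellAvg_sub_le`);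
* for `h = f - f_b`, Cauchy–Schwarz (in the form `abs_mul_le_add_sq`) in the parameter of the vertex
  at hand, of which the other factors are independent, leaves the correlations of `h` at the two
  ends of a chord of the arc, averaged over rotations and hence over spheres, and over the length
  of the chord. That length has a bounded density away from zero, and `h` has mean zero on the cells
  of side `2⁻ᵇ`, so its integral over a ball is bounded by the cells which meet the boundary; an
  integration by parts transfers this to the average over the lengths
  (`IsCubeDensity.integral_sq_arc_le`, `IsCubeWeight.abs_integral_mul_highFrequency_le`).

*Conclusion.* Among about `δ ^ (-2 * N)` scales separated by a power of `δ`, one thus admits a copy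
(`FlexibleConfig.exists_scale_forall_ne_zero`). If arbitrarily large dilates were missing, a
lacunary sequence of such dilates, rescaled into one large cube of positive density, would
contradict this. For a subset of the unit cube one takes disjoint dyadic intervals of scales: if
each contained a bad scale, those would form a contradictory sequence.

*Sharpness.* In `ℝᵏ` two regular `k`-simplices with a common facet have no freedom: the second apex
is the reflection of the first. This gives an identity
`k * ‖p‖ ^ 2 + k * ‖q‖ ^ 2 - 2 * ∑ i, ‖y i‖ ^ 2 = 4 * r ^ 2` between the squared norms of the points
of a copy, which cannot hold with `4 * r ^ 2` in `ℤ + 1/2` when all squared norms agree modulo `1`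
up to `1 / (8 * k)`.
-/

/-! ### Random rotations -/

/-- The orthogonal group of `ℝᵈ`, realised as the unitary elements of the continuous
endomorphisms. -/
abbrev Rot (d : ℕ) : Type := unitary (E d →L[ℝ] E d)

namespace Rot

variable {d : ℕ}

instance : ContinuousStar (E d →L[ℝ] E d) :=
  ⟨(ContinuousLinearMap.adjoint (𝕜 := ℝ) (E := E d) (F := E d)).continuous⟩

instance : CompactSpace (Rot d) := by
  have : ProperSpace (E d →L[ℝ] E d) := FiniteDimensional.proper ℝ _
  refine isCompact_iff_compactSpace.mp
    (Metric.isCompact_of_isClosed_isBounded (isClosed_unitary) ?_)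
  refine (Metric.isBounded_iff_subset_closedBall 0).mpr ⟨1, fun u hu => ?_⟩
  rw [mem_closedBall_zero_iff]
  refine ContinuousLinearMap.opNorm_le_bound _ zero_le_one fun x => ?_
  have := Unitary.norm_map (⟨u, hu⟩ : Rot d) x
  rw [one_mul]
  exact this.le

noncomputable instance : MeasurableSpace (Rot d) := borel _

instance : BorelSpace (Rot d) := ⟨rfl⟩

/-- The Haar probability measure on the orthogonal group. -/
noncomputable instance : MeasureSpace (Rot d) := ⟨Measure.haarMeasure ⊤⟩

instance : IsProbabilityMeasure (volume : Measure (Rot d)) :=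
  ⟨Measure.haarMeasure_self (K₀ := (⊤ : TopologicalSpace.PositiveCompacts (Rot d)))⟩

instance : (volume : Measure (Rot d)).IsMulLeftInvariant :=
  inferInstanceAs (Measure.haarMeasure ⊤).IsMulLeftInvariant

/-- The action of the inverse of `g` on `ℝᵈ`.  With the inverse, left invariance of Haar measure
is what makes the law of `act g z` depend only on `‖z‖`. -/
noncomputable def act (g : Rot d) : E d ≃ₗᵢ[ℝ] E d := Unitary.linearIsometryEquiv g⁻¹

theorem continuous_act : Continuous fun p : Rot d × E d => act p.1 p.2 := by
  have : (fun p : Rot d × E d => act p.1 p.2) =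
      fun p => ((p.1⁻¹ : Rot d) : E d →L[ℝ] E d) p.2 := rfl
  rw [this]
  exact (continuous_subtype_val.comp (continuous_inv.comp continuous_fst)).clm_apply continuous_snd

/-- The orthogonal group acts transitively on spheres, by reflections. -/
theorem integral_act_eq {z z' : E d} (h : ‖z‖ = ‖z'‖) (F : E d → ℝ) :
    ∫ g : Rot d, F (act g z) = ∫ g : Rot d, F (act g z') := by
  obtain ⟨V, hV⟩ : ∃ V : E d ≃ₗᵢ[ℝ] E d, V z = z' :=
    ⟨(ℝ ∙ (z - z'))ᗮ.reflection, Submodule.reflection_sub h⟩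
  set v : Rot d := Unitary.linearIsometryEquiv.symm V with hv
  have key : ∀ g : Rot d, act (v⁻¹ * g) z = act g z' := by
    intro g
    simp only [act, mul_inv_rev, inv_inv, map_mul, hv, MulEquiv.apply_symm_apply]
    rw [← hV]
    rfl
  rw [← integral_mul_left_eq_self (fun g => F (act g z)) v⁻¹]
  simp_rw [key]

end Rot

/-! ### Averages over dyadic cells -/

/-- The integer vector naming the dyadic cell of side `2⁻ˡ` that contains `x`. -/
noncomputable def gridIdx {d : ℕ} (l : ℕ) (x : E d) : Fin d → ℤ := fun i => ⌊(2 : ℝ) ^ l * x i⌋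

/-- The half-open unit cube. -/
def halfOpenCube (d : ℕ) : Set (E d) := {x | ∀ i, 0 ≤ x i ∧ x i < 1}

/-- The integral kernel of the averaging operator over the dyadic cells of side `2⁻ˡ`. -/
noncomputable def cellKernel {d : ℕ} (l : ℕ) (x y : E d) : ℝ :=
  open Classical in if gridIdx l x = gridIdx l y then ((2 : ℝ) ^ l) ^ d else 0

/-- The average of `f` over the dyadic cell of side `2⁻ˡ` that contains `x`. -/
noncomputable def cellAvg {d : ℕ} (l : ℕ) (f : E d → ℝ) (x : E d) : ℝ :=
  ∫ y, cellKernel l x y * f y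

section Cells

variable {d : ℕ} {l : ℕ}

theorem measurable_coord (i : Fin d) : Measurable fun x : E d => x i := by fun_prop

theorem measurable_gridIdx : Measurable (gridIdx (d := d) l) :=
  measurable_pi_iff.mpr fun i =>
    Int.measurable_floor.comp ((measurable_coord i).const_mul _)

theorem volume_gridCell (z : Fin d → ℤ) :
    volume {y : E d | gridIdx l y = z} = ENNReal.ofReal ((((2 : ℝ) ^ l) ^ d)⁻¹) := by
  have h2 : (0 : ℝ) < 2 ^ l := by positivity
  have : {y : E d | gridIdx l y = z} = WithLp.ofLp ⁻¹'
      (Set.univ.pi fun i => Set.Ico ((z i : ℝ) / 2 ^ l) (((z i : ℝ) + 1) / 2 ^ l)) := by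
    ext y
    simp only [gridIdx, Set.mem_ofPred_eq, funext_iff, Int.floor_eq_iff, Set.mem_preimage,
      Set.mem_univ_pi, Set.mem_Ico]
    refine forall_congr' fun i => ?_
    rw [div_le_iff₀ h2, lt_div_iff₀ h2, mul_comm]
  rw [this, (PiLp.volume_preserving_ofLp (Fin d)).measure_preimage
    (MeasurableSet.univ_pi fun i => measurableSet_Ico).nullMeasurableSet, volume_pi_pi]
  have : ∀ i : Fin d, volume (Set.Ico ((z i : ℝ) / 2 ^ l) (((z i : ℝ) + 1) / 2 ^ l)) =
      ENNReal.ofReal ((2 ^ l)⁻¹) := by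
    intro i
    rw [Real.volume_Ico]
    congr 1
    field_simp
    ring
  simp only [this, Finset.prod_const, Finset.card_univ, Fintype.card_fin]
  rw [← ENNReal.ofReal_pow (by positivity), inv_pow]

theorem measurable_cellKernel :
    Measurable fun p : E d × E d => cellKernel l p.1 p.2 := by
  classical
  unfold cellKernel
  refine Measurable.ite ?_ measurable_const measurable_const
  exact measurableSet_eq_fun (measurable_gridIdx.comp measurable_fst)
    (measurable_gridIdx.comp measurable_snd)

theorem cellKernel_nonneg (x y : E d) : 0 ≤ cellKernel l x y := by
  unfold cellKernel; split_ifs <;> positivity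

theorem cellKernel_comm (x y : E d) : cellKernel l x y = cellKernel l y x := by
  unfold cellKernel; simp only [eq_comm]

theorem cellKernel_eq_indicator (x : E d) :
    cellKernel l x = {y | gridIdx l y = gridIdx l x}.indicator fun _ => ((2 : ℝ) ^ l) ^ d := by
  classical
  ext y
  simp only [cellKernel, Set.indicator, Set.mem_ofPred_eq, eq_comm]

theorem measurableSet_gridCell (z : Fin d → ℤ) : MeasurableSet {y : E d | gridIdx l y = z} :=
  measurable_gridIdx (measurableSet_singleton z)

theorem integrable_cellKernel (x : E d) : Integrable (cellKernel l x) := by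
  rw [cellKernel_eq_indicator, integrable_indicator_iff (measurableSet_gridCell _)]
  refine integrableOn_const ?_
  rw [volume_gridCell]
  exact ENNReal.ofReal_ne_top

theorem integral_cellKernel (x : E d) : ∫ y, cellKernel l x y = 1 := by
  rw [cellKernel_eq_indicator, integral_indicator (measurableSet_gridCell _), setIntegral_const,
    Measure.real, volume_gridCell, ENNReal.toReal_ofReal (by positivity), smul_eq_mul,
    inv_mul_cancel₀ (by positivity)]

theorem integral_cellKernel_left (y : E d) : ∫ x, cellKernel l x y = 1 := by
  simp_rw [fun x => cellKernel_comm (l := l) x y, integral_cellKernel]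

theorem cellKernel_congr {x x' : E d} (h : gridIdx l x = gridIdx l x') (y : E d) :
    cellKernel l x y = cellKernel l x' y := by
  unfold cellKernel; rw [h]

theorem cellAvg_congr {f : E d → ℝ} {x x' : E d} (h : gridIdx l x = gridIdx l x') :
    cellAvg l f x = cellAvg l f x' := by
  unfold cellAvg; simp_rw [cellKernel_congr h]

theorem measurable_cellAvg {f : E d → ℝ} (hf : Measurable f) : Measurable (cellAvg l f) := by
  have : StronglyMeasurable fun p : E d × E d => cellKernel l p.1 p.2 * f p.2 :=
    (measurable_cellKernel.mul (hf.comp measurable_snd)).stronglyMeasurable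
  exact this.integral_prod_right.measurable

theorem cellAvg_eq_of_forall {f : E d → ℝ} {x : E d} {c : ℝ}
    (h : ∀ y, gridIdx l x = gridIdx l y → f y = c) : cellAvg l f x = c := by
  have : ∀ y, cellKernel l x y * f y = cellKernel l x y * c := by
    intro y
    by_cases hxy : gridIdx l x = gridIdx l y
    · rw [h y hxy]
    · simp [cellKernel, hxy]
  unfold cellAvg
  simp_rw [this]
  rw [integral_mul_const, integral_cellKernel, one_mul]

/-- A function that is constant on cells is its own cell average. -/
theorem cellAvg_eq_self {f : E d → ℝ}
    (h : ∀ x x', gridIdx l x = gridIdx l x' → f x = f x') (x : E d) : cellAvg l f x = f x :=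
  cellAvg_eq_of_forall fun y hy => (h x y hy).symm

theorem integrable_cellKernel_mul {f : E d → ℝ} {C : ℝ} (hf : Measurable f)
    (hC : ∀ x, |f x| ≤ C) (x : E d) : Integrable fun y => cellKernel l x y * f y :=
  (integrable_cellKernel x).mul_bdd hf.aestronglyMeasurable
    (Eventually.of_forall fun y => by simpa using hC y)

theorem abs_cellAvg_le {f : E d → ℝ} {C : ℝ} (hf : Measurable f) (hC : ∀ x, |f x| ≤ C)
    (x : E d) : |cellAvg l f x| ≤ C := by
  unfold cellAvg
  refine abs_integral_le_integral_abs.trans ?_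
  refine (integral_mono (integrable_cellKernel_mul hf hC x).abs
    ((integrable_cellKernel (l := l) x).mul_const C) fun y => ?_).trans ?_
  · simp only [abs_mul, abs_of_nonneg (cellKernel_nonneg x y)]
    exact mul_le_mul_of_nonneg_left (hC y) (cellKernel_nonneg x y)
  · rw [integral_mul_const, integral_cellKernel, one_mul]

theorem cellAvg_nonneg {f : E d → ℝ} (h0 : ∀ x, 0 ≤ f x) (x : E d) : 0 ≤ cellAvg l f x :=
  integral_nonneg fun y => mul_nonneg (cellKernel_nonneg x y) (h0 y)

theorem integrable_cellKernel_mul_prod {f : E d → ℝ} (hf : Measurable f) (hfi : Integrable f) :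
    Integrable (fun p : E d × E d => cellKernel l p.1 p.2 * f p.2) (volume.prod volume) := by
  refine (integrable_prod_iff' (measurable_cellKernel.mul
    (hf.comp measurable_snd)).aestronglyMeasurable).mpr ⟨Eventually.of_forall fun y => ?_, ?_⟩
  · change Integrable fun x => cellKernel l x y * f y
    simp_rw [fun x => cellKernel_comm (l := l) x y]
    exact (integrable_cellKernel y).mul_const _
  · have : ∀ y, ∫ x, ‖cellKernel l x y * f y‖ = |f y| := by
      intro y
      simp_rw [norm_mul, Real.norm_eq_abs, abs_of_nonneg (cellKernel_nonneg _ _)]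
      rw [integral_mul_const, integral_cellKernel_left, one_mul]
    change Integrable fun y => ∫ x, ‖cellKernel l x y * f y‖
    simp_rw [this]
    exact hfi.abs

/-- The averaging operator is symmetric. -/
theorem integral_cellAvg_mul {f g : E d → ℝ} (hf : Measurable f) (hfi : Integrable f)
    (hg : Measurable g) {C : ℝ} (hC : ∀ x, |g x| ≤ C) :
    ∫ x, cellAvg l f x * g x = ∫ x, f x * cellAvg l g x := by
  have hint : Integrable (fun p : E d × E d => cellKernel l p.1 p.2 * f p.2 * g p.1)
      (volume.prod volume) := by
    have hb := integrable_cellKernel_mul_prod (l := l) hf hfi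
    exact hb.mul_bdd (hg.comp measurable_fst).aestronglyMeasurable
      (Eventually.of_forall fun p => by simpa using hC p.1)
  calc ∫ x, cellAvg l f x * g x
      = ∫ x, ∫ y, cellKernel l x y * f y * g x := by
        simp only [cellAvg, integral_mul_const]
    _ = ∫ y, ∫ x, cellKernel l x y * f y * g x := integral_integral_swap hint
    _ = ∫ y, f y * cellAvg l g y := by
        refine integral_congr_ae (Eventually.of_forall fun y => ?_)
        simp only [cellAvg]
        rw [← integral_const_mul]
        refine integral_congr_ae (Eventually.of_forall fun x => ?_)
        simp only
        rw [cellKernel_comm x y]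
        ring

theorem gridIdx_coarsen {a b : ℕ} (hab : a ≤ b) {x y : E d} (h : gridIdx b x = gridIdx b y) :
    gridIdx a x = gridIdx a y := by
  have key : ∀ t : ℝ, ⌊(2 : ℝ) ^ a * t⌋ = ⌊(2 : ℝ) ^ b * t⌋ / (2 ^ (b - a) : ℕ) := by
    intro t
    rw [← Int.floor_div_natCast]
    congr 1
    rw [eq_div_iff (by positivity)]
    push_cast
    rw [mul_right_comm, ← pow_add, Nat.add_sub_cancel' hab]
  ext i
  have hi := congrFun h i
  simp only [gridIdx] at hi ⊢
  rw [key, key, hi]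

theorem sub_lt_of_gridIdx_eq {x y : E d} (h : gridIdx l x = gridIdx l y) (i : Fin d) :
    |x i - y i| < (2 ^ l : ℝ)⁻¹ := by
  have hi := congrFun h i
  simp only [gridIdx] at hi
  have := Int.abs_sub_lt_one_of_floor_eq_floor hi
  rw [← mul_sub, abs_mul, abs_of_pos (by positivity : (0 : ℝ) < 2 ^ l)] at this
  rw [← one_div, lt_div_iff₀' (by positivity)]
  exact this

theorem norm_le_sum_abs (v : E d) : ‖v‖ ≤ ∑ i, |v i| := by
  rw [EuclideanSpace.norm_eq]
  refine Real.sqrt_le_iff.mpr ⟨by positivity, ?_⟩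
  simpa using Finset.sum_sq_le_sq_sum_of_nonneg (s := Finset.univ) (f := fun i => |v i|)
    (fun i _ => abs_nonneg _)

theorem dist_le_of_gridIdx_eq {x y : E d} (h : gridIdx l x = gridIdx l y) :
    dist x y ≤ d * (2 ^ l : ℝ)⁻¹ := by
  rw [dist_eq_norm]
  refine (norm_le_sum_abs _).trans ?_
  refine (Finset.sum_le_sum fun i _ => (sub_lt_of_gridIdx_eq h i).le).trans ?_
  simp

theorem mem_halfOpenCube_iff {x : E d} : x ∈ halfOpenCube d ↔ gridIdx 0 x = 0 := by
  simp only [halfOpenCube, Set.mem_ofPred_eq, gridIdx, funext_iff, pow_zero, one_mul,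
    Pi.zero_apply, Int.floor_eq_zero_iff, Set.mem_Ico]

theorem measurableSet_halfOpenCube : MeasurableSet (halfOpenCube d) := by
  have : halfOpenCube d = {x | gridIdx 0 x = 0} := by ext x; exact mem_halfOpenCube_iff
  rw [this]
  exact measurableSet_gridCell _

theorem volume_halfOpenCube : volume (halfOpenCube d) = 1 := by
  have : halfOpenCube d = {x | gridIdx 0 x = 0} := by ext x; exact mem_halfOpenCube_iff
  rw [this, volume_gridCell]
  simp

theorem cellAvg_eq_zero_of_notMem {f : E d → ℝ} (hf : ∀ x ∉ halfOpenCube d, f x = 0) {x : E d}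
    (hx : x ∉ halfOpenCube d) : cellAvg l f x = 0 := by
  unfold cellAvg
  refine integral_eq_zero_of_ae (Eventually.of_forall fun y => ?_)
  by_cases hxy : gridIdx l x = gridIdx l y
  · have : y ∉ halfOpenCube d := by
      rw [mem_halfOpenCube_iff] at hx ⊢
      rwa [← gridIdx_coarsen (Nat.zero_le l) hxy]
    simp [hf y this]
  · simp [cellKernel, hxy]

end Cells

/-- A measurable function with values in `[0,1]` that vanishes off the half-open unit cube. -/
structure IsCubeDensity {d : ℕ} (f : E d → ℝ) : Prop where
  measurable : Measurable f
  nonneg : ∀ x, 0 ≤ f x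
  le_one : ∀ x, f x ≤ 1
  eq_zero : ∀ x ∉ halfOpenCube d, f x = 0

namespace IsCubeDensity

variable {d l : ℕ} {f : E d → ℝ}

theorem abs_le_one (hf : IsCubeDensity f) (x : E d) : |f x| ≤ 1 := by
  rw [abs_of_nonneg (hf.nonneg x)]; exact hf.le_one x

theorem le_indicator (hf : IsCubeDensity f) (x : E d) :
    f x ≤ (halfOpenCube d).indicator (fun _ => 1) x := by
  by_cases hx : x ∈ halfOpenCube d
  · simpa [hx] using hf.le_one x
  · simp [hx, hf.eq_zero x hx]

theorem integrable (hf : IsCubeDensity f) : Integrable f := by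
  have : Integrable ((halfOpenCube d).indicator fun _ => (1 : ℝ)) := by
    rw [integrable_indicator_iff measurableSet_halfOpenCube]
    exact integrableOn_const (by simp [volume_halfOpenCube])
  refine this.mono' hf.measurable.aestronglyMeasurable (Eventually.of_forall fun x => ?_)
  rw [Real.norm_eq_abs, abs_of_nonneg (hf.nonneg x)]
  exact hf.le_indicator x

theorem integral_le_one (hf : IsCubeDensity f) : ∫ x, f x ≤ 1 := by
  have : Integrable ((halfOpenCube d).indicator fun _ => (1 : ℝ)) := by
    rw [integrable_indicator_iff measurableSet_halfOpenCube]
    exact integrableOn_const (by simp [volume_halfOpenCube])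
  refine (integral_mono hf.integrable this hf.le_indicator).trans ?_
  rw [integral_indicator measurableSet_halfOpenCube, setIntegral_const, Measure.real,
    volume_halfOpenCube]
  simp

theorem average (hf : IsCubeDensity f) (l : ℕ) : IsCubeDensity (cellAvg l f) where
  measurable := measurable_cellAvg hf.measurable
  nonneg := cellAvg_nonneg hf.nonneg
  le_one x := (le_abs_self _).trans (abs_cellAvg_le hf.measurable hf.abs_le_one x)
  eq_zero _ hx := cellAvg_eq_zero_of_notMem hf.eq_zero hx

theorem abs_sub_cellAvg_le_one (hf : IsCubeDensity f) (b : ℕ) (y : E d) :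
    |f y - cellAvg b f y| ≤ 1 := by
  have := hf.nonneg y
  have := hf.le_one y
  have := (hf.average b).nonneg y
  have := (hf.average b).le_one y
  rw [abs_le]
  constructor <;> linarith

theorem mul {g : E d → ℝ} (hf : IsCubeDensity f) (hg : IsCubeDensity g) :
    IsCubeDensity fun x => f x * g x where
  measurable := hf.measurable.mul hg.measurable
  nonneg x := mul_nonneg (hf.nonneg x) (hg.nonneg x)
  le_one x := mul_le_one₀ (hf.le_one x) (hg.nonneg x) (hg.le_one x)
  eq_zero x hx := by simp [hf.eq_zero x hx]

/-- Averages over nested cells are orthogonal projections onto nested spaces. -/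
theorem integral_cellAvg_mul_cellAvg (hf : IsCubeDensity f) {a b : ℕ} (hab : a ≤ b) :
    ∫ x, cellAvg b f x * cellAvg a f x = ∫ x, f x * cellAvg a f x := by
  rw [integral_cellAvg_mul hf.measurable hf.integrable (hf.average a).measurable
    (hf.average a).abs_le_one]
  refine integral_congr_ae (Eventually.of_forall fun x => ?_)
  simp only
  rw [cellAvg_eq_self fun x x' h => cellAvg_congr (gridIdx_coarsen hab h)]

theorem integral_sq_cellAvg_sub (hf : IsCubeDensity f) {a b : ℕ} (hab : a ≤ b) :
    ∫ x, (cellAvg b f x - cellAvg a f x) ^ 2 =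
      (∫ x, f x * cellAvg b f x) - ∫ x, f x * cellAvg a f x := by
  have h1 := ((hf.average b).mul (hf.average b)).integrable
  have h2 := ((hf.average b).mul (hf.average a)).integrable
  have h3 := ((hf.average a).mul (hf.average a)).integrable
  have : ∀ x, (cellAvg b f x - cellAvg a f x) ^ 2 =
      (cellAvg b f x * cellAvg b f x - cellAvg b f x * cellAvg a f x) -
      (cellAvg b f x * cellAvg a f x -
        cellAvg a f x * cellAvg a f x) := fun x => by ring
  simp_rw [this]
  have h12 : Integrable fun x => cellAvg b f x * cellAvg b f x - cellAvg b f x * cellAvg a f x :=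
    h1.sub h2
  have h23 : Integrable fun x => cellAvg b f x * cellAvg a f x - cellAvg a f x * cellAvg a f x :=
    h2.sub h3
  rw [integral_sub h12 h23, integral_sub h1 h2, integral_sub h2 h3,
    hf.integral_cellAvg_mul_cellAvg hab, hf.integral_cellAvg_mul_cellAvg le_rfl,
    hf.integral_cellAvg_mul_cellAvg le_rfl]
  ring

theorem integral_mul_cellAvg_mono (hf : IsCubeDensity f) {a b : ℕ} (hab : a ≤ b) :
    ∫ x, f x * cellAvg a f x ≤ ∫ x, f x * cellAvg b f x := by
  rw [← sub_nonneg, ← hf.integral_sq_cellAvg_sub hab]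
  exact integral_nonneg fun x => sq_nonneg _

/-- Energy pigeonhole: on one of `J` disjoint windows of scales `[a j, b j]`, the cell averages
of `f` change by at most `1 / J` in mean square. -/
theorem exists_integral_sq_cellAvg_sub_le (hf : IsCubeDensity f) {J : ℕ} (hJ : 0 < J)
    (a b : ℕ → ℕ) (hab : ∀ j < J, a j ≤ b j) (hba : ∀ j, j + 1 < J → b j ≤ a (j + 1)) :
    ∃ j < J, ∫ x, (cellAvg (b j) f x - cellAvg (a j) f x) ^ 2 ≤ 1 / J := by
  by_contra! hcon
  have hJ' : (0 : ℝ) < J := by exact_mod_cast hJ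
  have key : ∀ j < J, ((j : ℝ) + 1) / J < ∫ x, f x * cellAvg (b j) f x := by
    intro j
    induction j with
    | zero =>
      intro h0
      have := hcon 0 h0
      rw [hf.integral_sq_cellAvg_sub (hab 0 h0)] at this
      have h0' : 0 ≤ ∫ x, f x * cellAvg (a 0) f x :=
        integral_nonneg fun x => (hf.mul (hf.average _)).nonneg x
      simp only [Nat.cast_zero, zero_add]
      linarith
    | succ j ih =>
      intro hj
      have h1 := ih (by omega)
      have h2 := hcon (j + 1) hj
      rw [hf.integral_sq_cellAvg_sub (hab _ hj)] at h2
      have h3 := hf.integral_mul_cellAvg_mono (hba j hj)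
      push_cast
      rw [add_div _ (1 : ℝ)]
      linarith
  have h1 := key (J - 1) (by omega)
  have h2 := (hf.mul (hf.average (b (J - 1)))).integral_le_one
  rw [Nat.cast_sub (by omega), Nat.cast_one, sub_add_cancel, div_self hJ'.ne'] at h1
  linarith

/-- The averaging operator can be moved to the power, which it leaves unchanged. -/
theorem integral_mul_cellAvg_pow (hf : IsCubeDensity f) (n : ℕ) :
    ∫ x, f x * cellAvg l f x ^ n = ∫ x, cellAvg l f x ^ (n + 1) := by
  have := integral_cellAvg_mul (l := l) hf.measurable hf.integrable
    (g := fun x => cellAvg l f x ^ n)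
    ((hf.average l).measurable.pow_const n) (C := 1) (fun x => by
      rw [abs_pow]; exact pow_le_one₀ (abs_nonneg _) ((hf.average l).abs_le_one x))
  rw [show (fun x => f x * cellAvg l f x ^ n) = fun x => f x * cellAvg l
      (fun x => cellAvg l f x ^ n) x from ?_, ← this]
  · simp only [pow_succ']
  · ext x
    rw [cellAvg_eq_self (f := fun x => cellAvg l f x ^ n) fun x x' h => by
      rw [cellAvg_congr h]]

theorem integral_cellAvg (hf : IsCubeDensity f) : ∫ x, cellAvg l f x = ∫ x, f x := by
  have := integral_cellAvg_mul (l := l) hf.measurable hf.integrable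
    (g := fun _ => 1) measurable_const (C := 1) (by simp)
  simpa [cellAvg_eq_self] using this

/-- The main term of the count: Jensen's inequality for the cell averages. -/
theorem pow_integral_le (hf : IsCubeDensity f) (n : ℕ) :
    (∫ x, f x) ^ (n + 1) ≤ ∫ x, f x * cellAvg l f x ^ n := by
  rw [hf.integral_mul_cellAvg_pow, ← hf.integral_cellAvg (l := l)]
  set g := cellAvg l f
  have hg : IsCubeDensity g := hf.average l
  have : IsProbabilityMeasure (volume.restrict (halfOpenCube d)) :=
    ⟨by rw [Measure.restrict_apply_univ, volume_halfOpenCube]⟩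
  have hgn : ∀ n : ℕ, ∫ x in halfOpenCube d, g x ^ (n + 1) = ∫ x, g x ^ (n + 1) := fun n =>
    setIntegral_eq_integral_of_forall_compl_eq_zero fun x hx => by simp [hg.eq_zero x hx]
  have hgi : ∀ n : ℕ, Integrable (fun x => g x ^ n) (volume.restrict (halfOpenCube d)) := fun n =>
    Integrable.mono' (integrable_const (1 : ℝ)) (hg.measurable.pow_const n).aestronglyMeasurable
      (Eventually.of_forall fun x => by
        rw [norm_pow]; exact pow_le_one₀ (norm_nonneg _) (hg.abs_le_one x))
  have := (convexOn_pow (𝕜 := ℝ) (n + 1)).map_integral_le (μ := volume.restrict (halfOpenCube d))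
    (f := g) (continuous_pow _).continuousOn isClosed_Ici
    (Eventually.of_forall hg.nonneg) (by simpa using hgi 1) (hgi (n + 1))
  rw [hgn n] at this
  have h0 := hgn 0
  simp only [zero_add, pow_one] at h0
  rwa [h0] at this

end IsCubeDensity

/-- Translation by `v` moves a point of `[0,1)` into another cell of side `1 / n` only near the
endpoints of cells. -/
theorem volume_floor_ne_le (n : ℕ) (v : ℝ) :
    volume {t : ℝ | t ∈ Set.Ico (0 : ℝ) 1 ∧ ⌊(n : ℝ) * (t + v)⌋ ≠ ⌊(n : ℝ) * t⌋} ≤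
      ENNReal.ofReal (n * |v|) := by
  rcases Nat.eq_zero_or_pos n with rfl | hn
  · simp
  have hn' : (0 : ℝ) < n := by exact_mod_cast hn
  have main : ∀ c : ℤ → ℝ, {t : ℝ | t ∈ Set.Ico (0 : ℝ) 1 ∧
      ⌊(n : ℝ) * (t + v)⌋ ≠ ⌊(n : ℝ) * t⌋} ⊆
      ⋃ m ∈ Finset.Ico (0 : ℤ) n, Set.Ico (c m) (c m + |v|) →
      volume {t : ℝ | t ∈ Set.Ico (0 : ℝ) 1 ∧ ⌊(n : ℝ) * (t + v)⌋ ≠ ⌊(n : ℝ) * t⌋} ≤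
      ENNReal.ofReal (n * |v|) := by
    intro c hc
    refine (measure_mono hc).trans ((measure_biUnion_finset_le _ _).trans ?_)
    simp only [Real.volume_Ico, add_sub_cancel_left, Finset.sum_const, Int.card_Ico, sub_zero,
      Int.toNat_natCast, nsmul_eq_mul]
    rw [ENNReal.ofReal_mul hn'.le, ENNReal.ofReal_natCast]
  rcases le_total 0 v with hv | hv
  · refine main (fun m => (m + 1) / n - v) ?_
    rintro t ⟨⟨ht0, ht1⟩, hne⟩
    have hle : ⌊(n : ℝ) * t⌋ ≤ ⌊(n : ℝ) * (t + v)⌋ := Int.floor_mono (by nlinarith)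
    have hlt : ⌊(n : ℝ) * t⌋ + 1 ≤ ⌊(n : ℝ) * (t + v)⌋ := by omega
    simp only [Set.mem_iUnion, Finset.mem_Ico, Set.mem_Ico, abs_of_nonneg hv]
    refine ⟨⌊(n : ℝ) * t⌋, ⟨Int.floor_nonneg.mpr (by positivity), ?_⟩, ?_, ?_⟩
    · rw [Int.floor_lt]; push_cast; nlinarith
    · have := Int.floor_le ((n : ℝ) * (t + v))
      have h2 : ((⌊(n : ℝ) * t⌋ : ℝ) + 1) ≤ n * (t + v) :=
        le_trans (by exact_mod_cast hlt) this
      rw [sub_le_iff_le_add, div_le_iff₀ hn']; linarith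
    · rw [sub_add_cancel, lt_div_iff₀ hn', mul_comm]
      exact Int.lt_floor_add_one _
  · refine main (fun m => m / n) ?_
    rintro t ⟨⟨ht0, ht1⟩, hne⟩
    have hle : ⌊(n : ℝ) * (t + v)⌋ ≤ ⌊(n : ℝ) * t⌋ := Int.floor_mono (by nlinarith)
    have hlt : ⌊(n : ℝ) * (t + v)⌋ < ⌊(n : ℝ) * t⌋ := by omega
    simp only [Set.mem_iUnion, Finset.mem_Ico, Set.mem_Ico, abs_of_nonpos hv]
    refine ⟨⌊(n : ℝ) * t⌋, ⟨Int.floor_nonneg.mpr (by positivity), ?_⟩, ?_, ?_⟩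
    · rw [Int.floor_lt]; push_cast; nlinarith
    · rw [div_le_iff₀ hn', mul_comm]; exact Int.floor_le _
    · rw [Int.floor_lt] at hlt
      rw [← sub_eq_add_neg, lt_sub_iff_add_lt, ← sub_pos, ← sub_sub]
      have : (t + v) < ⌊(n : ℝ) * t⌋ / n := by rw [lt_div_iff₀ hn']; linarith
      linarith

/-- Translation by a short vector changes the cell of few points of the unit cube. -/
theorem volume_gridIdx_ne_le {d : ℕ} (l : ℕ) (v : E d) :
    volume {x : E d | x ∈ halfOpenCube d ∧ gridIdx l (x + v) ≠ gridIdx l x} ≤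
      ENNReal.ofReal (d * 2 ^ l * ‖v‖) := by
  have hsub : {x : E d | x ∈ halfOpenCube d ∧ gridIdx l (x + v) ≠ gridIdx l x} ⊆
      ⋃ i : Fin d, WithLp.ofLp ⁻¹' (Set.univ.pi (Function.update (fun _ => Set.Ico (0 : ℝ) 1) i
        {t : ℝ | t ∈ Set.Ico (0 : ℝ) 1 ∧
          ⌊((2 ^ l : ℕ) : ℝ) * (t + v i)⌋ ≠ ⌊((2 ^ l : ℕ) : ℝ) * t⌋})) := by
    rintro x ⟨hx, hne⟩
    obtain ⟨i, hi⟩ := Function.ne_iff.mp hne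
    simp only [Set.mem_iUnion, Set.mem_preimage, Set.mem_univ_pi]
    refine ⟨i, fun j => ?_⟩
    by_cases hj : j = i
    · subst hj
      simp only [Function.update_self]
      exact ⟨hx j, by simpa [gridIdx] using hi⟩
    · simp only [Function.update_of_ne hj]
      exact hx j
  have hmeas : ∀ i : Fin d, MeasurableSet {t : ℝ | t ∈ Set.Ico (0 : ℝ) 1 ∧
      ⌊((2 ^ l : ℕ) : ℝ) * (t + v i)⌋ ≠ ⌊((2 ^ l : ℕ) : ℝ) * t⌋} := by
    intro i
    refine measurableSet_Ico.inter (MeasurableSet.compl (measurableSet_eq_fun ?_ ?_))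
    · exact Int.measurable_floor.comp (by fun_prop)
    · exact Int.measurable_floor.comp (by fun_prop)
  refine (measure_mono hsub).trans ((measure_iUnion_fintype_le _ _).trans ?_)
  have : ∀ i : Fin d, volume ((WithLp.ofLp : E d → _) ⁻¹' (Set.univ.pi
      (Function.update (fun _ => Set.Ico (0 : ℝ) 1) i
        {t : ℝ | t ∈ Set.Ico (0 : ℝ) 1 ∧
          ⌊((2 ^ l : ℕ) : ℝ) * (t + v i)⌋ ≠ ⌊((2 ^ l : ℕ) : ℝ) * t⌋}))) ≤
      ENNReal.ofReal (2 ^ l * ‖v‖) := by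
    intro i
    rw [(PiLp.volume_preserving_ofLp (Fin d)).measure_preimage
      (MeasurableSet.univ_pi fun j => ?_).nullMeasurableSet, volume_pi_pi,
      ← Finset.mul_prod_erase _ _ (Finset.mem_univ i)]
    · rw [Finset.prod_eq_one fun j hj => ?_, mul_one, Function.update_self]
      · refine (volume_floor_ne_le _ _).trans (ENNReal.ofReal_le_ofReal ?_)
        push_cast
        gcongr
        exact PiLp.norm_apply_le v i
      · rw [Function.update_of_ne (Finset.ne_of_mem_erase hj)]; simp
    · by_cases hj : j = i
      · subst hj; simpa using hmeas j
      · rw [Function.update_of_ne hj]; exact measurableSet_Ico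
  refine (Finset.sum_le_sum fun i _ => this i).trans ?_
  rw [Finset.sum_const, Finset.card_univ, Fintype.card_fin, nsmul_eq_mul, mul_assoc (d : ℝ),
    ENNReal.ofReal_mul (Nat.cast_nonneg d), ENNReal.ofReal_natCast]

/-! ### Spherical means of functions with small averages -/

section OneDim

/-- Integration by parts: a function with small primitives pairs weakly with a smooth weight. -/
theorem abs_integral_mul_le_of_primitive {m φ φ' : ℝ → ℝ} {α β B P P' : ℝ} (hαβ : α ≤ β)
    (hm : IntervalIntegrable m volume α β) (hB : ∀ v ∈ Set.Icc α β, |∫ u in α..v, m u| ≤ B)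
    (hφ : ∀ v ∈ Set.Icc α β, HasDerivAt φ (φ' v) v) (hP : |φ β| ≤ P)
    (hP' : ∀ v ∈ Set.Icc α β, |φ' v| ≤ P') :
    |∫ u in α..β, φ u * m u| ≤ B * (P + P' * (β - α)) := by
  have hα : α ∈ Set.Icc α β := Set.left_mem_Icc.mpr hαβ
  have hβ : β ∈ Set.Icc α β := Set.right_mem_Icc.mpr hαβ
  have hB0 : 0 ≤ B := (abs_nonneg _).trans (hB α hα)
  have hP0 : 0 ≤ P' := (abs_nonneg _).trans (hP' α hα)
  have hu : Set.uIcc α β = Set.Icc α β := Set.uIcc_of_le hαβ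
  set G : ℝ → ℝ := fun v => ∫ u in α..v, m u with hG
  have hGac : AbsolutelyContinuousOnInterval G α β :=
    hm.absolutelyContinuousOnInterval_intervalIntegral (by simp)
  have hφac : AbsolutelyContinuousOnInterval φ α β := by
    refine LipschitzOnWith.absolutelyContinuousOnInterval (K := ⟨P', hP0⟩) ?_
    rw [hu]
    refine (convex_Icc α β).lipschitzOnWith_of_nnnorm_hasDerivWithin_le
      (fun x hx => (hφ x hx).hasDerivWithinAt) fun x hx => ?_
    exact hP' x hx
  have hderiv : ∫ u in α..β, φ u * m u = ∫ u in α..β, φ u * deriv G u := by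
    refine intervalIntegral.integral_congr_ae ?_
    filter_upwards [hm.ae_hasDerivAt_integral] with x hx hxm
    rw [(hx (Set.uIoc_subset_uIcc hxm) α (by simp)).deriv]
  rw [hderiv, hφac.integral_mul_deriv_eq_deriv_mul hGac]
  have hGα : G α = 0 := by simp [hG]
  rw [hGα, mul_zero, sub_zero]
  have h1 : |φ β * G β| ≤ P * B := by
    rw [abs_mul]
    exact mul_le_mul hP (hB β hβ) (abs_nonneg _) ((abs_nonneg _).trans hP)
  have h2 : |∫ u in α..β, deriv φ u * G u| ≤ P' * B * |β - α| := by
    refine intervalIntegral.norm_integral_le_of_norm_le_const (f := fun u => deriv φ u * G u)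
      fun x hx => ?_
    have hx' : x ∈ Set.Icc α β := hu ▸ Set.uIoc_subset_uIcc hx
    rw [norm_mul, (hφ x hx').deriv]
    exact mul_le_mul (hP' x hx') (hB x hx') (norm_nonneg _) hP0
  rw [abs_of_nonneg (sub_nonneg.mpr hαβ)] at h2
  calc |φ β * G β - ∫ u in α..β, deriv φ u * G u|
      ≤ |φ β * G β| + |∫ u in α..β, deriv φ u * G u| := abs_sub _ _
    _ ≤ B * (P + P' * (β - α)) := by linarith

theorem integral_comp_mul_deriv_of_strictMonoOn {F r r' : ℝ → ℝ} {α β : ℝ} (hαβ : α ≤ β)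
    (hr : ∀ u ∈ Set.Icc α β, HasDerivAt r (r' u) u) (hr' : ∀ u ∈ Set.Icc α β, 0 ≤ r' u)
    (hmono : StrictMonoOn r (Set.Icc α β)) :
    ∫ u in α..β, F (r u) * r' u = ∫ t in r α..r β, F t := by
  have hcont : ContinuousOn r (Set.Icc α β) := fun u hu => (hr u hu).continuousAt.continuousWithinAt
  have himg : r '' Set.Icc α β = Set.Icc (r α) (r β) := by
    refine Set.Subset.antisymm ?_ (intermediate_value_Icc hαβ hcont)
    rintro _ ⟨u, hu, rfl⟩
    exact ⟨hmono.monotoneOn (Set.left_mem_Icc.mpr hαβ) hu hu.1,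
      hmono.monotoneOn hu (Set.right_mem_Icc.mpr hαβ) hu.2⟩
  have hle : r α ≤ r β := hmono.monotoneOn (Set.left_mem_Icc.mpr hαβ)
    (Set.right_mem_Icc.mpr hαβ) hαβ
  rw [intervalIntegral.integral_of_le hαβ, intervalIntegral.integral_of_le hle,
    ← integral_Icc_eq_integral_Ioc, ← integral_Icc_eq_integral_Ioc, ← himg,
    integral_image_eq_integral_abs_deriv_smul measurableSet_Icc
      (fun u hu => (hr u hu).hasDerivWithinAt) hmono.injOn F]
  refine setIntegral_congr_fun measurableSet_Icc fun u hu => ?_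
  simp only [smul_eq_mul]
  rw [abs_of_nonneg (hr' u hu), mul_comm]

/-- If the weighted primitives of `M` are small, so is the average of `M` over the chords from a
point of a circular arc of radius `a` to the other points of the arc. -/
theorem abs_integral_chord_le {n : ℕ} {M : ℝ → ℝ} (hM : Measurable M) (hM1 : ∀ t, |M t| ≤ 1)
    {a γ τ q L : ℝ} (ha : 0 < a) (hγ0 : 0 < γ) (hγ1 : γ ≤ 1) (hτ : 0 < τ) (hτ1 : τ ≤ 1)
    (hL1 : L ≤ 1) (hq : 0 ≤ q)
    (hprim : ∀ t ∈ Set.Icc 0 (2 * a), |∫ y in 0..t, y ^ n * M y| ≤ q * a ^ (n + 1)) (hL0 : 0 ≤ L) :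
    |∫ u in 0..L, M (2 * a * Real.sin (γ * u / 2))| ≤
      τ + q * ((n + 2) * 2 ^ (n + 1) / ((γ * τ / 2) ^ (n + 1)) ^ 2) := by
  set c₀ : ℝ := (γ * τ / 2) ^ (n + 1) with hc₀
  have hc₀pos : 0 < c₀ := by positivity
  have hc₀1 : c₀ ≤ 1 := pow_le_one₀ (by positivity) (by nlinarith)
  have hRHS : 0 ≤ q * ((n + 2) * 2 ^ (n + 1) / c₀ ^ 2) := by positivity
  have hmeas : Measurable fun u => M (2 * a * Real.sin (γ * u / 2)) :=
    hM.comp (by fun_prop)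
  have hint : ∀ α β, IntervalIntegrable (fun u => M (2 * a * Real.sin (γ * u / 2))) volume α β := by
    intro α β
    refine (intervalIntegrable_const (c := (1 : ℝ))).mono_fun hmeas.aestronglyMeasurable
      (Eventually.of_forall fun u => ?_)
    simpa using hM1 _
  have hbd : ∀ α β, |∫ u in α..β, M (2 * a * Real.sin (γ * u / 2))| ≤ |β - α| := by
    intro α β
    have := intervalIntegral.norm_integral_le_of_norm_le_const (a := α) (b := β)
      (f := fun u => M (2 * a * Real.sin (γ * u / 2))) (C := 1) fun u _ => hM1 _
    simpa using this
  rcases le_total L τ with hLτ | hLτ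
  · have := hbd 0 L
    rw [sub_zero, abs_of_nonneg hL0] at this
    linarith
  have hsplit : ∫ u in 0..L, M (2 * a * Real.sin (γ * u / 2)) =
      (∫ u in 0..τ, M (2 * a * Real.sin (γ * u / 2))) +
      ∫ u in τ..L, M (2 * a * Real.sin (γ * u / 2)) :=
    (intervalIntegral.integral_add_adjacent_intervals (hint _ _) (hint _ _)).symm
  rw [hsplit]
  refine (abs_add_le _ _).trans (add_le_add ?_ ?_)
  · -- near the base point the Jacobian degenerates, so short chords are bounded trivially
    simpa [abs_of_pos hτ] using hbd 0 τ
  -- the normalised Jacobian of `u ↦ 2 a sin (γ u / 2)`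
  set D : ℝ → ℝ := fun u => (2 * Real.sin (γ * u / 2)) ^ n * (γ * Real.cos (γ * u / 2)) with hD
  set D' : ℝ → ℝ := fun u => n * (2 * Real.sin (γ * u / 2)) ^ (n - 1) *
    (γ * Real.cos (γ * u / 2)) * (γ * Real.cos (γ * u / 2)) +
    (2 * Real.sin (γ * u / 2)) ^ n * (γ * (-Real.sin (γ * u / 2) * (γ / 2))) with hD'
  have hpi := Real.pi_gt_three
  have hrange : ∀ u ∈ Set.Icc τ L, 0 < γ * u / 2 ∧ γ * u / 2 ≤ 1 / 2 := by
    intro u hu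
    have hu0 : 0 < u := hτ.trans_le hu.1
    have hu1 : u ≤ 1 := hu.2.trans hL1
    exact ⟨by positivity, by nlinarith⟩
  have hcos : ∀ u ∈ Set.Icc τ L, 1 / 2 ≤ Real.cos (γ * u / 2) := by
    intro u hu
    obtain ⟨h0, h1⟩ := hrange u hu
    have := Real.one_sub_sq_div_two_le_cos (x := γ * u / 2)
    nlinarith
  have hsin : ∀ u ∈ Set.Icc τ L, γ * τ / 2 ≤ 2 * Real.sin (γ * u / 2) := by
    intro u hu
    obtain ⟨h0, h1⟩ := hrange u hu
    have := Real.mul_le_sin h0.le (by linarith)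
    have h2 : 1 / 2 ≤ 2 / Real.pi := by
      rw [div_le_div_iff₀ (by norm_num) Real.pi_pos]
      linarith [Real.pi_lt_four]
    have h3 : γ * τ ≤ γ * u := by nlinarith [hu.1]
    nlinarith
  have hDlow : ∀ u ∈ Set.Icc τ L, c₀ ≤ D u := by
    intro u hu
    change c₀ ≤ (2 * Real.sin (γ * u / 2)) ^ n * (γ * Real.cos (γ * u / 2))
    rw [hc₀, pow_succ]
    have := hcos u hu
    have h1 := hsin u hu
    have : γ * τ / 2 ≤ γ * Real.cos (γ * u / 2) := by nlinarith
    have h0 : 0 ≤ 2 * Real.sin (γ * u / 2) := le_trans (by positivity) h1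
    gcongr
  have hderD : ∀ u, HasDerivAt D (D' u) u := by
    intro u
    have h1 : HasDerivAt (fun u : ℝ => γ * u / 2) (γ / 2) u := by
      simpa using ((hasDerivAt_id u).const_mul γ).div_const 2
    have h2 := (h1.sin.const_mul 2).pow n
    have h3 := h1.cos.const_mul γ
    convert! h2.mul h3 using 1
    simp only [hD', Pi.pow_apply]
    ring
  have hD'bd : ∀ u, |D' u| ≤ (n + 1) * 2 ^ n := by
    intro u
    have hs : |2 * Real.sin (γ * u / 2)| ≤ 2 := by
      rw [abs_mul, abs_two]
      linarith [Real.abs_sin_le_one (γ * u / 2)]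
    have hc : |γ * Real.cos (γ * u / 2)| ≤ 1 := by
      rw [abs_mul, abs_of_pos hγ0]
      exact mul_le_one₀ hγ1 (abs_nonneg _) (Real.abs_cos_le_one _)
    have hs2 : |γ * (-Real.sin (γ * u / 2) * (γ / 2))| ≤ 1 := by
      rw [abs_mul, abs_mul, abs_neg, abs_of_pos hγ0, abs_of_pos (half_pos hγ0)]
      have := Real.abs_sin_le_one (γ * u / 2)
      have h0 := abs_nonneg (Real.sin (γ * u / 2))
      have : |Real.sin (γ * u / 2)| * (γ / 2) ≤ 1 := by nlinarith
      exact mul_le_one₀ hγ1 (by positivity) this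
    have e1 : |(n : ℝ) * (2 * Real.sin (γ * u / 2)) ^ (n - 1) *
        (γ * Real.cos (γ * u / 2)) * (γ * Real.cos (γ * u / 2))| ≤ n * 2 ^ n * 1 * 1 := by
      rw [abs_mul, abs_mul, abs_mul, Nat.abs_cast, abs_pow]
      gcongr
      exact (pow_le_pow_left₀ (abs_nonneg _) hs _).trans
        (pow_le_pow_right₀ (by norm_num) (Nat.sub_le n 1))
    have e2 : |(2 * Real.sin (γ * u / 2)) ^ n * (γ * (-Real.sin (γ * u / 2) * (γ / 2)))| ≤
        2 ^ n * 1 := by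
      rw [abs_mul, abs_pow]
      gcongr
    refine (abs_add_le _ _).trans ((add_le_add e1 e2).trans (le_of_eq (by ring)))
  have hfac : ∫ u in τ..L, M (2 * a * Real.sin (γ * u / 2)) =
      ∫ u in τ..L, (D u)⁻¹ * (D u * M (2 * a * Real.sin (γ * u / 2))) := by
    refine intervalIntegral.integral_congr fun u hu => ?_
    rw [Set.uIcc_of_le hLτ] at hu
    rw [inv_mul_cancel_left₀ (hc₀pos.trans_le (hDlow u hu)).ne']
  have hDcont : Continuous D := by
    rw [hD]; fun_prop
  have hderr : ∀ u, HasDerivAt (fun u => 2 * a * Real.sin (γ * u / 2))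
      (a * (γ * Real.cos (γ * u / 2))) u := by
    intro u
    have h1 : HasDerivAt (fun u : ℝ => γ * u / 2) (γ / 2) u := by
      simpa using ((hasDerivAt_id u).const_mul γ).div_const 2
    convert! h1.sin.const_mul (2 * a) using 1
    ring
  have hMint : ∀ α β, IntervalIntegrable (fun y => y ^ n * M y) volume α β := by
    intro α β
    refine IntervalIntegrable.continuousOn_mul ?_ (by fun_prop)
    refine (intervalIntegrable_const (c := (1 : ℝ))).mono_fun hM.aestronglyMeasurable
      (Eventually.of_forall fun u => ?_)
    simpa using hM1 _
  have hprimD : ∀ v ∈ Set.Icc τ L,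
      |∫ u in τ..v, D u * M (2 * a * Real.sin (γ * u / 2))| ≤ 2 * q := by
    intro v hv
    have hsub : Set.Icc τ v ⊆ Set.Icc τ L := Set.Icc_subset_Icc_right hv.2
    have hcv := integral_comp_mul_deriv_of_strictMonoOn (F := fun y => y ^ n * M y) hv.1
      (fun u _ => hderr u)
      (fun u hu => by have := hcos u (hsub hu); positivity)
      (fun u hu w hw huw => by
        obtain ⟨hu0, hu1⟩ := hrange u (hsub hu)
        obtain ⟨hw0, hw1⟩ := hrange w (hsub hw)
        have : Real.sin (γ * u / 2) < Real.sin (γ * w / 2) :=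
          Real.sin_lt_sin_of_lt_of_le_pi_div_two (by linarith) (by linarith) (by nlinarith)
        nlinarith)
    have hscale : ∫ u in τ..v, D u * M (2 * a * Real.sin (γ * u / 2)) =
        (a ^ (n + 1))⁻¹ * ∫ u in τ..v, ((2 * a * Real.sin (γ * u / 2)) ^ n *
          M (2 * a * Real.sin (γ * u / 2))) * (a * (γ * Real.cos (γ * u / 2))) := by
      rw [← intervalIntegral.integral_const_mul]
      refine intervalIntegral.integral_congr fun u _ => ?_
      simp only [hD]
      rw [eq_inv_mul_iff_mul_eq₀ (by positivity), mul_right_comm 2 a, mul_pow _ a]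
      ring
    rw [hscale, hcv]
    have hmem : ∀ w ∈ Set.Icc τ L, 2 * a * Real.sin (γ * w / 2) ∈ Set.Icc 0 (2 * a) := by
      intro w hw
      have h1 := hsin w hw
      have h2 := Real.sin_le_one (γ * w / 2)
      have h3 : 0 ≤ γ * τ / 2 := by positivity
      exact ⟨by have : 0 ≤ Real.sin (γ * w / 2) := by linarith
                positivity, by nlinarith⟩
    have e1 := hprim _ (hmem τ (Set.left_mem_Icc.mpr hLτ))
    have e2 := hprim _ (hmem v hv)
    rw [← intervalIntegral.integral_interval_sub_left (hMint 0 _) (hMint 0 _), abs_mul,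
      abs_of_pos (by positivity : 0 < (a ^ (n + 1))⁻¹), inv_mul_le_iff₀ (by positivity)]
    refine (abs_sub _ _).trans ?_
    linarith
  rw [hfac]
  have hfin := abs_integral_mul_le_of_primitive
    (m := fun u => D u * M (2 * a * Real.sin (γ * u / 2)))
    (φ := fun u => (D u)⁻¹) (φ' := fun u => -D' u / D u ^ 2) (B := 2 * q) (P := 1 / c₀ ^ 2)
    (P' := (n + 1) * 2 ^ n / c₀ ^ 2) hLτ
    ((hint τ L).continuousOn_mul hDcont.continuousOn) hprimD
    (fun v hv => (hderD v).inv (hc₀pos.trans_le (hDlow v hv)).ne') ?_ ?_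
  · refine hfin.trans ?_
    have h2n : (1 : ℝ) ≤ 2 ^ n := one_le_pow₀ (by norm_num)
    have hLL : L - τ ≤ 1 := by linarith
    calc 2 * q * (1 / c₀ ^ 2 + (n + 1) * 2 ^ n / c₀ ^ 2 * (L - τ))
        ≤ 2 * q * (2 ^ n / c₀ ^ 2 + (n + 1) * 2 ^ n / c₀ ^ 2 * 1) := by gcongr
      _ = q * ((n + 2) * 2 ^ (n + 1) / c₀ ^ 2) := by ring
  · have h := hDlow L (Set.right_mem_Icc.mpr hLτ)
    rw [abs_of_pos (inv_pos.mpr (hc₀pos.trans_le h)), ← one_div]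
    refine one_div_le_one_div_of_le (by positivity) (le_trans ?_ h)
    nlinarith
  · intro v hv
    have h := hDlow v hv
    rw [abs_div, abs_neg, abs_of_pos (pow_pos (hc₀pos.trans_le h) 2)]
    gcongr
    exact hD'bd v

end OneDim

section SphericalMean

variable {d : ℕ}

/-- The mean of `h` over the sphere of centre `x` and radius `t`; the unit vector `e` only serves
to write it as an average over rotations. -/
noncomputable def sphericalMean (h : E d → ℝ) (e x : E d) (t : ℝ) : ℝ :=
  ∫ g : Rot d, h (x + Rot.act g (t • e))

theorem integral_act_eq_sphericalMean (h : E d → ℝ) {e : E d} (he : ‖e‖ = 1) (x z : E d) :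
    ∫ g : Rot d, h (x + Rot.act g z) = sphericalMean h e x ‖z‖ := by
  have hz : ‖z‖ = ‖‖z‖ • e‖ := by rw [norm_smul, he, mul_one, norm_norm]
  have := Rot.integral_act_eq hz fun y => h (x + y)
  rw [sphericalMean, this]

theorem measurable_sphericalMean {h : E d → ℝ} (hh : Measurable h) (e x : E d) :
    Measurable (sphericalMean h e x) := by
  have h0 : Continuous fun p : ℝ × Rot d => (p.2, p.1 • e) := by fun_prop
  have h2 : Continuous fun p : ℝ × Rot d => Rot.act p.2 (p.1 • e) := by
    have := Rot.continuous_act.comp h0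
    exact this
  have h1 : Continuous fun p : ℝ × Rot d => x + Rot.act p.2 (p.1 • e) :=
    continuous_const.add h2
  have : StronglyMeasurable fun p : ℝ × Rot d => h (x + Rot.act p.2 (p.1 • e)) :=
    (hh.comp h1.measurable).stronglyMeasurable
  exact this.integral_prod_right.measurable

theorem abs_sphericalMean_le {h : E d → ℝ} (h1 : ∀ y, |h y| ≤ 1) (e x : E d) (t : ℝ) :
    |sphericalMean h e x t| ≤ 1 := by
  have := norm_integral_le_of_norm_le_const (μ := (volume : Measure (Rot d)))
    (f := fun g => h (x + Rot.act g (t • e))) (C := 1) (Eventually.of_forall fun g => h1 _)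
  simpa [sphericalMean] using this

/-- Polar coordinates: the integral over a ball in terms of spherical means. -/
theorem setIntegral_ball_eq_sphericalMean {h : E d → ℝ} (hh : Measurable h)
    (h1 : ∀ y, |h y| ≤ 1) {e : E d} (he : ‖e‖ = 1) (x : E d) {R : ℝ} (hR : 0 ≤ R) :
    ∫ y in Metric.ball x R, h y =
      d * volume.real (Metric.ball (0 : E d) 1) *
        ∫ t in 0..R, t ^ (d - 1) * sphericalMean h e x t := by
  set B : Set (E d) := Metric.ball 0 R with hB
  have hBm : MeasurableSet B := measurableSet_ball
  have hcont : Continuous fun p : Rot d × E d => x + Rot.act p.1 p.2 :=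
    continuous_const.add Rot.continuous_act
  have step1 : ∀ g : Rot d, ∫ y in Metric.ball x R, h y = ∫ z in B, h (x + Rot.act g z) := by
    intro g
    rw [← integral_indicator measurableSet_ball, ← integral_indicator hBm,
      ← integral_add_left_eq_self _ x,
      ← ((Rot.act g).measurePreserving).integral_comp (Rot.act g).toHomeomorph.measurableEmbedding]
    refine integral_congr_ae (Eventually.of_forall fun z => ?_)
    simp only [Set.indicator, hB, Metric.mem_ball, dist_self_add_left, dist_zero_right,
      LinearIsometryEquiv.norm_map]
  have step2 : ∫ y in Metric.ball x R, h y = ∫ g : Rot d, ∫ z in B, h (x + Rot.act g z) := by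
    simp_rw [← step1]; simp
  have hBfin : volume B ≠ ⊤ := measure_ball_lt_top.ne
  have : IsFiniteMeasure (volume.restrict B) := ⟨by simpa using measure_ball_lt_top⟩
  have hint : Integrable (Function.uncurry fun (g : Rot d) (z : E d) => h (x + Rot.act g z))
      (volume.prod (volume.restrict B)) :=
    Integrable.mono' (integrable_const (1 : ℝ)) (hh.comp hcont.measurable).aestronglyMeasurable
      (Eventually.of_forall fun p => h1 _)
  rw [step2, integral_integral_swap hint]
  simp_rw [integral_act_eq_sphericalMean h he]
  rw [← integral_indicator hBm]
  have : (B.indicator fun z => sphericalMean h e x ‖z‖) =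
      fun z => (fun t => (Set.Iio R).indicator (sphericalMean h e x) t) ‖z‖ := by
    ext z
    simp [Set.indicator, hB]
  rw [this]
  have hd : Nontrivial (E d) := ⟨⟨e, 0, by rintro rfl; simp at he⟩⟩
  rw [integral_fun_norm_addHaar volume fun t => (Set.Iio R).indicator (sphericalMean h e x) t,
    finrank_euclideanSpace_fin, nsmul_eq_mul, smul_eq_mul, mul_assoc]
  congr 2
  have : (fun y : ℝ => y ^ (d - 1) • (Set.Iio R).indicator (sphericalMean h e x) y) =
      (Set.Iio R).indicator fun y => y ^ (d - 1) * sphericalMean h e x y := by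
    ext y
    simp [Set.indicator]
  rw [this, setIntegral_indicator measurableSet_Iio, intervalIntegral.integral_of_le hR,
    integral_Ioc_eq_integral_Ioo, Set.Ioi_inter_Iio]

/-- The difference between `f` and its cell averages has a small integral over balls: only the
cells that meet the boundary sphere contribute. -/
theorem IsCubeDensity.abs_setIntegral_ball_sub_cellAvg_le {f : E d → ℝ} (hf : IsCubeDensity f)
    (b : ℕ) (x : E d) (R : ℝ) :
    |∫ y in Metric.ball x R, (f y - cellAvg b f y)| ≤
      volume.real (Metric.ball x (R + d * (2 ^ b : ℝ)⁻¹)) -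
        volume.real (Metric.ball x (R - d * (2 ^ b : ℝ)⁻¹)) := by
  set δ : ℝ := d * (2 ^ b : ℝ)⁻¹ with hδ
  have hδ0 : 0 ≤ δ := by positivity
  set χ : E d → ℝ := (Metric.ball x R).indicator fun _ => 1 with hχ
  have hχm : Measurable χ := measurable_const.indicator measurableSet_ball
  have hχ1 : ∀ y, |χ y| ≤ 1 := by
    intro y; simp only [hχ, Set.indicator]; split_ifs <;> simp
  have hballint : ∀ r, Integrable ((Metric.ball x r).indicator fun _ => (1 : ℝ)) := fun r =>
    (integrable_indicator_iff measurableSet_ball).mpr (integrableOn_const measure_ball_lt_top.ne)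
  have hχi : Integrable χ := hballint R
  have e1 : ∫ y in Metric.ball x R, (f y - cellAvg b f y) =
      ∫ y, f y * (χ y - cellAvg b χ y) := by
    have h1 : Integrable fun y => f y * χ y := hf.integrable.mul_bdd hχm.aestronglyMeasurable
      (Eventually.of_forall hχ1)
    have h2 : Integrable fun y => cellAvg b f y * χ y :=
      (hf.average b).integrable.mul_bdd hχm.aestronglyMeasurable (Eventually.of_forall hχ1)
    have h3 : Integrable fun y => f y * cellAvg b χ y :=
      hf.integrable.mul_bdd (measurable_cellAvg hχm).aestronglyMeasurable
        (Eventually.of_forall (abs_cellAvg_le hχm hχ1))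
    rw [← integral_indicator measurableSet_ball]
    simp_rw [mul_sub]
    rw [integral_sub h1 h3, ← integral_cellAvg_mul hf.measurable hf.integrable hχm hχ1,
      ← integral_sub h1 h2]
    refine integral_congr_ae (Eventually.of_forall fun y => ?_)
    simp only [hχ, Set.indicator]
    split_ifs <;> ring
  have hpt : ∀ y, |f y * (χ y - cellAvg b χ y)| ≤
      (Metric.ball x (R + δ)).indicator (fun _ => (1 : ℝ)) y -
        (Metric.ball x (R - δ)).indicator (fun _ => (1 : ℝ)) y := by
    intro y
    have hdist : ∀ z, gridIdx b y = gridIdx b z → dist y z ≤ δ := fun z hz =>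
      dist_le_of_gridIdx_eq hz
    by_cases hin : y ∈ Metric.ball x (R - δ)
    · have hz : ∀ z, gridIdx b y = gridIdx b z → χ z = 1 := by
        intro z hz
        have h1 := hdist z hz
        have h2 := dist_triangle z y x
        rw [dist_comm z y] at h2
        rw [Metric.mem_ball] at hin
        exact Set.indicator_of_mem (Metric.mem_ball.mpr (by linarith)) _
      have hout : y ∈ Metric.ball x (R + δ) :=
        Metric.ball_subset_ball (by linarith) hin
      rw [cellAvg_eq_of_forall hz, hz y rfl, Set.indicator_of_mem hin, Set.indicator_of_mem hout]
      simp
    rw [Set.indicator_of_notMem hin, sub_zero]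
    by_cases hout : y ∈ Metric.ball x (R + δ)
    · rw [Set.indicator_of_mem hout, abs_mul]
      refine mul_le_one₀ (hf.abs_le_one y) (abs_nonneg _) ?_
      have h0 : 0 ≤ χ y := Set.indicator_nonneg (fun _ _ => zero_le_one) y
      have h0' : 0 ≤ cellAvg b χ y :=
        cellAvg_nonneg (fun z => Set.indicator_nonneg (fun _ _ => zero_le_one) z) y
      have h2 := (abs_le.mp (hχ1 y)).2
      have h3 := (abs_le.mp (abs_cellAvg_le (l := b) hχm hχ1 y)).2
      rw [abs_le]
      constructor <;> linarith
    · have hz : ∀ z, gridIdx b y = gridIdx b z → χ z = 0 := by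
        intro z hz
        have h1 := hdist z hz
        have h2 := dist_triangle y z x
        rw [Metric.mem_ball, not_lt] at hout
        refine Set.indicator_of_notMem (fun hmem => ?_) _
        rw [Metric.mem_ball] at hmem
        linarith
      rw [cellAvg_eq_of_forall hz, hz y rfl, Set.indicator_of_notMem hout]
      simp
  rw [e1]
  have hI : ∀ r, ∫ y, (Metric.ball x r).indicator (fun _ => (1 : ℝ)) y =
      volume.real (Metric.ball x r) := fun r => by
    rw [integral_indicator measurableSet_ball, setIntegral_const]; simp
  rw [← hI, ← hI, ← integral_sub (hballint _) (hballint _)]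
  exact norm_integral_le_of_norm_le (f := fun y => f y * (χ y - cellAvg b χ y))
    ((hballint (R + δ)).sub (hballint (R - δ))) (Eventually.of_forall hpt)

theorem pow_sub_pow_le {A P : ℝ} (hP : 0 ≤ P) (hPA : P ≤ A) (n : ℕ) :
    A ^ n - P ^ n ≤ n * (A - P) * A ^ (n - 1) := by
  rw [← geom_sum₂_mul, mul_comm, mul_right_comm, mul_comm _ (A - P)]
  refine mul_le_mul_of_nonneg_left ?_ (sub_nonneg.mpr hPA)
  have : ∀ i ∈ Finset.range n, A ^ i * P ^ (n - 1 - i) ≤ A ^ (n - 1) := by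
    intro i hi
    rw [Finset.mem_range] at hi
    have hA : 0 ≤ A := hP.trans hPA
    calc A ^ i * P ^ (n - 1 - i) ≤ A ^ i * A ^ (n - 1 - i) := by gcongr
      _ = A ^ (n - 1) := by rw [← pow_add]; congr 1; omega
  refine (Finset.sum_le_sum this).trans ?_
  simp

/-- The weighted primitives of the spherical means of `f - cellAvg b f` are small at scales above
the side of the cells. -/
theorem IsCubeDensity.abs_integral_pow_mul_sphericalMean_le {f : E d → ℝ} (hf : IsCubeDensity f)
    (b : ℕ) {e : E d} (he : ‖e‖ = 1) (x : E d) {a q t : ℝ} (hd : 0 < d) (ha : 0 < a) (hq1 : q ≤ 1)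
    (hbq : d * (2 ^ b : ℝ)⁻¹ ≤ q * a) (ht : t ∈ Set.Icc 0 (2 * a)) :
    |∫ y in 0..t, y ^ (d - 1) * sphericalMean (fun z => f z - cellAvg b f z) e x y| ≤
      2 * 3 ^ (d - 1) * q * a ^ d := by
  set δ : ℝ := d * (2 ^ b : ℝ)⁻¹ with hδ
  have hδ0 : 0 ≤ δ := by positivity
  set h : E d → ℝ := fun z => f z - cellAvg b f z with hh
  have hm : Measurable h := hf.measurable.sub (hf.average b).measurable
  have h1 : ∀ y, |h y| ≤ 1 := hf.abs_sub_cellAvg_le_one b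
  set V := volume.real (Metric.ball (0 : E d) 1) with hV
  have hVpos : 0 < V :=
    ENNReal.toReal_pos (Metric.measure_ball_pos _ _ one_pos).ne' measure_ball_lt_top.ne
  have hvol : ∀ r, 0 ≤ r → volume.real (Metric.ball x r) = r ^ d * V := by
    intro r hr
    have : Nontrivial (E d) := ⟨⟨e, 0, by rintro rfl; simp at he⟩⟩
    rw [Measure.real, Measure.addHaar_ball volume x hr, finrank_euclideanSpace_fin,
      ENNReal.toReal_mul, ENNReal.toReal_ofReal (by positivity), hV, Measure.real]
  have hball := hf.abs_setIntegral_ball_sub_cellAvg_le b x t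
  rw [setIntegral_ball_eq_sphericalMean hm h1 he x ht.1, abs_mul,
    abs_of_pos (by positivity : 0 < (d : ℝ) * V)] at hball
  have hlow : (max (t - δ) 0) ^ d * V ≤ volume.real (Metric.ball x (t - δ)) := by
    rcases le_total 0 (t - δ) with h0 | h0
    · rw [max_eq_left h0, hvol _ h0]
    · rw [max_eq_right h0, zero_pow hd.ne', zero_mul]
      exact measureReal_nonneg
  rw [hvol _ (add_nonneg ht.1 hδ0)] at hball
  have hpow := pow_sub_pow_le (A := t + δ) (P := max (t - δ) 0) (le_max_right _ _)
    (max_le (by linarith) (add_nonneg ht.1 hδ0)) d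
  have hdiff : t + δ - max (t - δ) 0 ≤ 2 * δ := by
    have := le_max_left (t - δ) 0
    linarith
  have hA : t + δ ≤ 3 * a := by
    have : q * a ≤ a := by nlinarith
    linarith [ht.2]
  have hA0 : 0 ≤ t + δ := add_nonneg ht.1 hδ0
  have hfin : (t + δ) ^ d - (max (t - δ) 0) ^ d ≤ d * (2 * 3 ^ (d - 1) * q * a ^ d) := by
    refine hpow.trans ?_
    calc (d : ℝ) * (t + δ - max (t - δ) 0) * (t + δ) ^ (d - 1)
        ≤ d * (2 * (q * a)) * (3 * a) ^ (d - 1) := by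
          have : t + δ - max (t - δ) 0 ≤ 2 * (q * a) := by linarith
          have hqa : 0 ≤ q * a := hδ0.trans hbq
          gcongr
      _ = d * (2 * 3 ^ (d - 1) * q * a ^ d) := by
          obtain ⟨n, rfl⟩ : ∃ n, d = n + 1 := ⟨d - 1, by omega⟩
          simp only [Nat.add_sub_cancel]
          ring
  have hdV : 0 < (d : ℝ) * V := by positivity
  refine le_of_mul_le_mul_left (hball.trans ?_) hdV
  calc (t + δ) ^ d * V - volume.real (Metric.ball x (t - δ))
      ≤ (t + δ) ^ d * V - (max (t - δ) 0) ^ d * V := by linarith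
    _ = ((t + δ) ^ d - (max (t - δ) 0) ^ d) * V := by ring
    _ ≤ (d * (2 * 3 ^ (d - 1) * q * a ^ d)) * V := by gcongr
    _ = d * V * (2 * 3 ^ (d - 1) * q * a ^ d) := by ring

end SphericalMean

/-! ### High frequencies are invisible to a vertex that moves on a circle -/

section Resample

/-- Drawing one coordinate afresh preserves the product measure. -/
theorem measurePreserving_update {N : ℕ} (t : Fin N) :
    MeasurePreserving (fun p : (Fin N → unitInterval) × unitInterval => Function.update p.1 t p.2)
      (volume.prod volume) volume := by
  have hm : Measurable (fun p : (Fin N → unitInterval) × unitInterval =>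
      Function.update p.1 t p.2) := by
    refine measurable_pi_iff.mpr fun i => ?_
    by_cases hi : i = t
    · subst hi; simpa using measurable_snd
    · simp only [Function.update_of_ne hi]
      exact (measurable_pi_apply i).comp measurable_fst
  refine ⟨hm, ?_⟩
  refine (Measure.pi_eq fun S hS => ?_).symm
  rw [Measure.map_apply hm (MeasurableSet.univ_pi hS)]
  have : (fun p : (Fin N → unitInterval) × unitInterval => Function.update p.1 t p.2) ⁻¹'
      (Set.univ.pi S) = (Set.univ.pi (Function.update S t Set.univ)) ×ˢ (S t) := by
    ext p
    simp only [Set.mem_preimage, Set.mem_univ_pi, Set.mem_prod]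
    constructor
    · intro h
      refine ⟨fun i => ?_, by simpa using h t⟩
      by_cases hi : i = t
      · subst hi; simp
      · simpa [Function.update_of_ne hi] using h i
    · rintro ⟨h1, h2⟩ i
      by_cases hi : i = t
      · subst hi; simpa using h2
      · simpa [Function.update_of_ne hi] using h1 i
  rw [this, Measure.prod_prod, volume_pi_pi, ← Finset.mul_prod_erase _ _ (Finset.mem_univ t),
    ← Finset.mul_prod_erase _ _ (Finset.mem_univ t), Function.update_self, measure_univ, one_mul,
    mul_comm]
  congr 1
  refine Finset.prod_congr rfl fun i hi => ?_
  rw [Function.update_of_ne (Finset.ne_of_mem_erase hi)]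

theorem integral_resample {N : ℕ} (t : Fin N) {F : (Fin N → unitInterval) → ℝ}
    (hF : Integrable F) : ∫ θ, F θ = ∫ θ, ∫ s, F (Function.update θ t s) := by
  have hmp := measurePreserving_update t
  have h1 : ∫ θ, F θ = ∫ p : (Fin N → unitInterval) × unitInterval,
      F (Function.update p.1 t p.2) ∂(volume.prod volume) := by
    have := integral_map (f := F) hmp.measurable.aemeasurable
      (by rw [hmp.map_eq]; exact hF.aestronglyMeasurable)
    rwa [hmp.map_eq] at this
  rw [h1]
  exact integral_prod _ (hmp.integrable_comp_of_integrable hF)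

end Resample

section HighFrequency

variable {d : ℕ}

theorem integrable_comp_add {Z : Type*} [MeasurableSpace Z] {ν : Measure Z} [IsFiniteMeasure ν]
    {h : E d → ℝ} (hh : Measurable h) (hi : Integrable h) {c : Z → E d} (hc : Measurable c) :
    Integrable (fun p : E d × Z => h (p.1 + c p.2)) (volume.prod ν) := by
  refine (integrable_prod_iff' (hh.comp
    (measurable_fst.add (hc.comp measurable_snd))).aestronglyMeasurable).mpr
    ⟨Eventually.of_forall fun z => hi.comp_add_right (c z), ?_⟩
  have : ∀ z, ∫ x, ‖h (x + c z)‖ = ∫ x, ‖h x‖ := fun z =>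
    integral_add_right_eq_self (fun x => ‖h x‖) (c z)
  change Integrable (fun z => ∫ x, ‖h (x + c z)‖) ν
  simp_rw [this]
  exact integrable_const _

theorem integrable_comp_add_assoc {Y Z : Type*} [MeasurableSpace Y] [MeasurableSpace Z]
    {μ : Measure Y} [IsFiniteMeasure μ] {ν : Measure Z} [IsFiniteMeasure ν]
    {h : E d → ℝ} (hh : Measurable h) (hi : Integrable h) {c : Y × Z → E d} (hc : Measurable c) :
    Integrable (fun p : (E d × Y) × Z => h (p.1.1 + c (p.1.2, p.2)))
      (((volume : Measure (E d)).prod μ).prod ν) := by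
  have := integrable_comp_add (ν := μ.prod ν) hh hi hc
  exact (measurePreserving_prodAssoc (volume : Measure (E d)) μ ν).integrable_comp_of_integrable
    this

/-- The bound for the correlations of `f - cellAvg b f` along the chords of a circular arc;
`q` bounds the ratio of the cell side to the radius, and chords of angle below `τ` are dropped. -/
noncomputable def chordError (d : ℕ) (γ τ q : ℝ) : ℝ :=
  τ + 2 * 3 ^ (d - 1) * q * ((d + 1) * 2 ^ d / ((γ * τ / 2) ^ d) ^ 2)

/-- `u` runs over an arc of a circle of radius `ρ`, with constant angular speed `γ`. -/
def IsArc (γ ρ : ℝ) (u : unitInterval → E d) : Prop :=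
  ∀ s s' : unitInterval, ‖u s - u s'‖ = 2 * ρ * |Real.sin (γ * ((s : ℝ) - s') / 2)|

theorem integral_unitInterval (F : ℝ → ℝ) :
    ∫ s : unitInterval, F s = ∫ s in (0 : ℝ)..1, F s := by
  rw [unitInterval.measurePreserving_coe.integral_comp unitInterval.measurableEmbedding_coe F,
    intervalIntegral.integral_of_le zero_le_one, ← integral_Icc_eq_integral_Ioc]

variable {f : E d → ℝ} {b : ℕ} {γ ρ r q τ : ℝ} {u : unitInterval → E d}

/-- Averages of `f - cellAvg b f` over rotated chords from a point of an arc are small. -/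
theorem IsCubeDensity.abs_integral_sphericalMean_arc_le (hf : IsCubeDensity f) {e : E d}
    (he : ‖e‖ = 1) (hd : 0 < d) (hγ0 : 0 < γ) (hγ1 : γ ≤ 1) (hρ : 0 < ρ) (hr : 0 < r) (hτ : 0 < τ)
    (hτ1 : τ ≤ 1) (hq0 : 0 ≤ q) (hq1 : q ≤ 1) (hbq : d * (2 ^ b : ℝ)⁻¹ ≤ q * (r * ρ))
    (hu : IsArc γ ρ u) (x : E d) (s : unitInterval) :
    |∫ s' : unitInterval, sphericalMean (fun z => f z - cellAvg b f z) e x ‖r • u s' - r • u s‖| ≤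
      2 * chordError d γ τ q := by
  set M : ℝ → ℝ := sphericalMean (fun z => f z - cellAvg b f z) e x with hM
  set a := r * ρ with ha
  have ha0 : 0 < a := mul_pos hr hρ
  have hMm : Measurable M :=
    measurable_sphericalMean (hf.measurable.sub (hf.average b).measurable) e x
  have hM1 : ∀ t, |M t| ≤ 1 := abs_sphericalMean_le (hf.abs_sub_cellAvg_le_one b) e x
  have hd' : d - 1 + 1 = d := by omega
  have hd'' : ((d - 1 : ℕ) : ℝ) + 2 = d + 1 := by
    have : (((d - 1 + 1 : ℕ)) : ℝ) = d := by rw [hd']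
    push_cast at this
    linarith
  have main : ∀ L : ℝ, 0 ≤ L → L ≤ 1 →
      |∫ v in 0..L, M (2 * a * Real.sin (γ * v / 2))| ≤ chordError d γ τ q := by
    intro L hL0 hL1
    have := abs_integral_chord_le (n := d - 1) (q := 2 * 3 ^ (d - 1) * q) hMm hM1 ha0 hγ0 hγ1 hτ
      hτ1 hL1 (by positivity) (fun t ht => by
        rw [hd']
        exact hf.abs_integral_pow_mul_sphericalMean_le b he x hd ha0 hq1 hbq ht) hL0
    rwa [hd', hd''] at this
  have hcongr : ∀ s' : unitInterval, M ‖r • u s' - r • u s‖ =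
      (fun v : ℝ => M (2 * a * |Real.sin (γ * (v - s) / 2)|)) s' := by
    intro s'
    rw [← smul_sub, norm_smul, hu s' s, Real.norm_of_nonneg hr.le, ha]
    simp only
    congr 1
    ring
  simp_rw [hcongr]
  rw [integral_unitInterval fun v : ℝ => M (2 * a * |Real.sin (γ * (v - s) / 2)|)]
  have hint : ∀ α β, IntervalIntegrable (fun v : ℝ => M (2 * a * |Real.sin (γ * (v - s) / 2)|))
      volume α β := by
    intro α β
    have hmeas : Measurable fun v : ℝ => M (2 * a * |Real.sin (γ * (v - s) / 2)|) := by
      refine hMm.comp (Continuous.measurable ?_)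
      fun_prop
    refine (intervalIntegrable_const (c := (1 : ℝ))).mono_fun hmeas.aestronglyMeasurable
      (Eventually.of_forall fun u => ?_)
    simpa using hM1 _
  have hs0 := s.2.1
  have hs1 := s.2.2
  have hpi := Real.pi_gt_three
  rw [← intervalIntegral.integral_add_adjacent_intervals (hint 0 s) (hint s 1),
    two_mul (chordError d γ τ q)]
  refine (abs_add_le _ _).trans (add_le_add ?_ ?_)
  · have : ∫ v in (0 : ℝ)..s, M (2 * a * |Real.sin (γ * (v - s) / 2)|) =
        ∫ v in (0 : ℝ)..s, M (2 * a * Real.sin (γ * (s - v) / 2)) := by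
      refine intervalIntegral.integral_congr fun v hv => ?_
      rw [Set.uIcc_of_le hs0] at hv
      rw [← neg_sub (s : ℝ) v, mul_neg, neg_div, Real.sin_neg, abs_neg, abs_of_nonneg]
      exact Real.sin_nonneg_of_nonneg_of_le_pi
        (by have := sub_nonneg.mpr hv.2; positivity) (by nlinarith [hv.1, hv.2])
    rw [this, intervalIntegral.integral_comp_sub_left
      (fun v => M (2 * a * Real.sin (γ * v / 2))) (s : ℝ), sub_self, sub_zero]
    exact main s hs0 hs1
  · have : ∫ v in (s : ℝ)..1, M (2 * a * |Real.sin (γ * (v - s) / 2)|) =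
        ∫ v in (s : ℝ)..1, M (2 * a * Real.sin (γ * (v - s) / 2)) := by
      refine intervalIntegral.integral_congr fun v hv => ?_
      rw [Set.uIcc_of_le hs1] at hv
      rw [abs_of_nonneg]
      exact Real.sin_nonneg_of_nonneg_of_le_pi
        (by have := sub_nonneg.mpr hv.1; positivity) (by nlinarith [hv.1, hv.2])
    rw [this, intervalIntegral.integral_comp_sub_right
      (fun v => M (2 * a * Real.sin (γ * v / 2))) (s : ℝ), sub_self]
    exact main (1 - s) (by linarith) (by linarith)

/-- Square-mean estimate for the average of `f - cellAvg b f` over a rotated arc.  Expanding the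
square turns it into an autocorrelation along the chords of the arc. -/
theorem IsCubeDensity.integral_sq_arc_le (hf : IsCubeDensity f)
    (hd : 0 < d) (hγ0 : 0 < γ) (hγ1 : γ ≤ 1) (hρ : 0 < ρ) (hr : 0 < r) (hτ : 0 < τ)
    (hτ1 : τ ≤ 1) (hq0 : 0 ≤ q) (hq1 : q ≤ 1) (hbq : d * (2 ^ b : ℝ)⁻¹ ≤ q * (r * ρ))
    (hu : IsArc γ ρ u) (huc : Continuous u) :
    ∫ p : E d × Rot d, (∫ s : unitInterval,
      (fun z => f z - cellAvg b f z) (p.1 + Rot.act p.2 (r • u s))) ^ 2 ≤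
      2 * (2 * chordError d γ τ q) := by
  set h : E d → ℝ := fun z => f z - cellAvg b f z with hh
  have hm : Measurable h := hf.measurable.sub (hf.average b).measurable
  have hi : Integrable h := hf.integrable.sub (hf.average b).integrable
  have h1 : ∀ y, |h y| ≤ 1 := hf.abs_sub_cellAvg_le_one b
  obtain ⟨e, he⟩ : ∃ e : E d, ‖e‖ = 1 := ⟨EuclideanSpace.single ⟨0, hd⟩ 1, by simp⟩
  have hc1 : Continuous fun p : Rot d × (unitInterval × unitInterval) =>
      Rot.act p.1 (r • u p.2.1) := by
    have h0 : Continuous fun p : Rot d × (unitInterval × unitInterval) =>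
      (p.1, r • u p.2.1) := by fun_prop
    have := Rot.continuous_act.comp h0
    exact this
  have hc2 : Continuous fun p : Rot d × (unitInterval × unitInterval) =>
      Rot.act p.1 (r • u p.2.2) := by
    have h0 : Continuous fun p : Rot d × (unitInterval × unitInterval) =>
      (p.1, r • u p.2.2) := by fun_prop
    have := Rot.continuous_act.comp h0
    exact this
  have hc3 : Continuous fun p : Rot d × (unitInterval × unitInterval) =>
      Rot.act p.1 (r • u p.2.2 - r • u p.2.1) := by
    have h0 : Continuous fun p : Rot d × (unitInterval × unitInterval) =>
      (p.1, r • u p.2.2 - r • u p.2.1) := by fun_prop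
    have := Rot.continuous_act.comp h0
    exact this
  have hF : Integrable (fun p : (E d × Rot d) × (unitInterval × unitInterval) =>
      h (p.1.1 + Rot.act p.1.2 (r • u p.2.1)) * h (p.1.1 + Rot.act p.1.2 (r • u p.2.2)))
      ((volume.prod volume).prod volume) := by
    have e1 := integrable_comp_add_assoc (μ := (volume : Measure (Rot d)))
      (ν := (volume : Measure (unitInterval × unitInterval))) hm hi hc1.measurable
    have e2 := integrable_comp_add_assoc (μ := (volume : Measure (Rot d)))
      (ν := (volume : Measure (unitInterval × unitInterval))) hm hi hc2.measurable
    exact e1.mul_bdd e2.aestronglyMeasurable (Eventually.of_forall fun p => h1 _)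
  have hG : Integrable (fun p : (E d × Rot d) × (unitInterval × unitInterval) =>
      h p.1.1 * h (p.1.1 + Rot.act p.1.2 (r • u p.2.2 - r • u p.2.1)))
      ((volume.prod volume).prod volume) := by
    have e1 := integrable_comp_add_assoc (μ := (volume : Measure (Rot d)))
      (ν := (volume : Measure (unitInterval × unitInterval))) hm hi
      (c := fun _ => 0) measurable_const
    have e2 := integrable_comp_add_assoc (μ := (volume : Measure (Rot d)))
      (ν := (volume : Measure (unitInterval × unitInterval))) hm hi hc3.measurable
    simp only [add_zero] at e1
    exact e1.mul_bdd e2.aestronglyMeasurable (Eventually.of_forall fun p => h1 _)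
  have expand : ∀ p : E d × Rot d, (∫ s : unitInterval, h (p.1 + Rot.act p.2 (r • u s))) ^ 2 =
      ∫ ss : unitInterval × unitInterval,
        h (p.1 + Rot.act p.2 (r • u ss.1)) * h (p.1 + Rot.act p.2 (r • u ss.2)) := by
    intro p
    rw [sq]
    exact (integral_prod_mul (μ := (volume : Measure unitInterval))
      (ν := (volume : Measure unitInterval)) (fun s => h (p.1 + Rot.act p.2 (r • u s)))
      (fun s => h (p.1 + Rot.act p.2 (r • u s)))).symm
  have shift : ∀ ss : unitInterval × unitInterval,
      ∫ p : E d × Rot d, h (p.1 + Rot.act p.2 (r • u ss.1)) * h (p.1 + Rot.act p.2 (r • u ss.2)) =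
      ∫ p : E d × Rot d, h p.1 * h (p.1 + Rot.act p.2 (r • u ss.2 - r • u ss.1)) := by
    intro ss
    have c1 : Continuous fun g : Rot d => Rot.act g (r • u ss.1) := by
      have := Rot.continuous_act.comp (Continuous.prodMk_left (X := Rot d) (r • u ss.1))
      exact this
    have c2 : Continuous fun g : Rot d => Rot.act g (r • u ss.2) := by
      have := Rot.continuous_act.comp (Continuous.prodMk_left (X := Rot d) (r • u ss.2))
      exact this
    have c3 : Continuous fun g : Rot d => Rot.act g (r • u ss.2 - r • u ss.1) := by
      have := Rot.continuous_act.comp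
        (Continuous.prodMk_left (X := Rot d) (r • u ss.2 - r • u ss.1))
      exact this
    have i1 := integrable_comp_add (ν := (volume : Measure (Rot d))) hm hi c1.measurable
    have i2 := integrable_comp_add (ν := (volume : Measure (Rot d))) hm hi c2.measurable
    have i3 := integrable_comp_add (ν := (volume : Measure (Rot d))) hm hi c3.measurable
    have i0 := integrable_comp_add (ν := (volume : Measure (Rot d))) hm hi
      (c := fun _ => 0) measurable_const
    simp only [add_zero] at i0
    rw [Measure.volume_eq_prod,
      integral_prod_symm _ (i1.mul_bdd i2.aestronglyMeasurable
        (Eventually.of_forall fun p => h1 _)),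
      integral_prod_symm _ (i0.mul_bdd i3.aestronglyMeasurable
        (Eventually.of_forall fun p => h1 _))]
    refine integral_congr_ae (Eventually.of_forall fun g => ?_)
    simp only
    rw [← integral_add_right_eq_self
      (fun x => h x * h (x + Rot.act g (r • u ss.2 - r • u ss.1))) (Rot.act g (r • u ss.1))]
    simp only [map_sub, add_assoc, add_sub_cancel]
  calc ∫ p : E d × Rot d, (∫ s : unitInterval, h (p.1 + Rot.act p.2 (r • u s))) ^ 2
      = ∫ p : E d × Rot d, ∫ ss : unitInterval × unitInterval,
        h (p.1 + Rot.act p.2 (r • u ss.1)) * h (p.1 + Rot.act p.2 (r • u ss.2)) := by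
        simp_rw [expand]
    _ = ∫ ss : unitInterval × unitInterval, ∫ p : E d × Rot d,
        h (p.1 + Rot.act p.2 (r • u ss.1)) * h (p.1 + Rot.act p.2 (r • u ss.2)) :=
        integral_integral_swap hF
    _ = ∫ ss : unitInterval × unitInterval, ∫ p : E d × Rot d,
        h p.1 * h (p.1 + Rot.act p.2 (r • u ss.2 - r • u ss.1)) := by
        simp_rw [shift]
    _ = ∫ p : E d × Rot d, ∫ ss : unitInterval × unitInterval,
        h p.1 * h (p.1 + Rot.act p.2 (r • u ss.2 - r • u ss.1)) :=
        (integral_integral_swap hG).symm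
    _ = ∫ x : E d, h x * ∫ s : unitInterval, ∫ s' : unitInterval,
        sphericalMean h e x ‖r • u s' - r • u s‖ := by
        rw [Measure.volume_eq_prod, integral_prod _ hG.integral_prod_left]
        refine integral_congr_ae (Eventually.of_forall fun x => ?_)
        have hx : Measurable fun p : Rot d × (unitInterval × unitInterval) =>
            h (x + Rot.act p.1 (r • u p.2.2 - r • u p.2.1)) :=
          hm.comp (continuous_const.add hc3).measurable
        simp only [integral_const_mul]
        rw [integral_integral_swap (f := fun (g : Rot d) (ss : unitInterval × unitInterval) =>
          h (x + Rot.act g (r • u ss.2 - r • u ss.1)))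
          (Integrable.mono' (integrable_const (1 : ℝ)) hx.aestronglyMeasurable
            (Eventually.of_forall fun p => h1 _))]
        simp_rw [integral_act_eq_sphericalMean h he x]
        congr 1
        have hs : Measurable fun ss : unitInterval × unitInterval =>
            sphericalMean h e x ‖r • u ss.2 - r • u ss.1‖ :=
          (measurable_sphericalMean hm e x).comp (Continuous.measurable (by fun_prop))
        rw [Measure.volume_eq_prod]
        exact integral_prod _ (Integrable.mono' (integrable_const (1 : ℝ))
          hs.aestronglyMeasurable (Eventually.of_forall fun p => abs_sphericalMean_le h1 e x _))
    _ ≤ 2 * (2 * chordError d γ τ q) := by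
        have hA : ∀ x, |∫ s : unitInterval, ∫ s' : unitInterval,
            sphericalMean h e x ‖r • u s' - r • u s‖| ≤ 2 * chordError d γ τ q := by
          intro x
          have := norm_integral_le_of_norm_le_const (μ := (volume : Measure unitInterval))
            (f := fun s => ∫ s' : unitInterval, sphericalMean h e x ‖r • u s' - r • u s‖)
            (Eventually.of_forall fun s => hf.abs_integral_sphericalMean_arc_le (b := b) he hd
              hγ0 hγ1 hρ hr hτ hτ1 hq0 hq1 hbq hu x s)
          simpa using this
        have hce : 0 ≤ 2 * chordError d γ τ q := (abs_nonneg _).trans (hA 0)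
        have hb : ∀ x, ‖h x * ∫ s : unitInterval, ∫ s' : unitInterval,
            sphericalMean h e x ‖r • u s' - r • u s‖‖ ≤
            (f x + cellAvg b f x) * (2 * chordError d γ τ q) := by
          intro x
          rw [Real.norm_eq_abs, abs_mul]
          refine mul_le_mul ?_ (hA x) (abs_nonneg _) (add_nonneg (hf.nonneg x)
            ((hf.average b).nonneg x))
          refine (abs_sub _ _).trans ?_
          rw [abs_of_nonneg (hf.nonneg x), abs_of_nonneg ((hf.average b).nonneg x)]
        have hbi : Integrable fun x => (f x + cellAvg b f x) * (2 * chordError d γ τ q) :=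
          (hf.integrable.add (hf.average b).integrable).mul_const _
        refine (le_abs_self _).trans
          ((norm_integral_le_of_norm_le hbi (Eventually.of_forall hb)).trans ?_)
        rw [integral_mul_const, integral_add hf.integrable (hf.average b).integrable]
        refine mul_le_mul_of_nonneg_right ?_ hce
        linarith [hf.integral_le_one, (hf.average b).integral_le_one]

end HighFrequency

/-! ### Replacing one factor of the count by its coarse average -/

section Errors

variable {d : ℕ} {Z : Type*} [MeasurableSpace Z] {ν : Measure Z} [IsProbabilityMeasure ν]

/-- A bounded weight on `ℝᵈ × Z` supported over the unit cube. -/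
structure IsCubeWeight (H : E d × Z → ℝ) : Prop where
  measurable : Measurable H
  abs_le : ∀ p, |H p| ≤ (halfOpenCube d).indicator (fun _ => 1) p.1

theorem integrable_cube_indicator :
    Integrable (fun p : E d × Z => (halfOpenCube d).indicator (fun _ => (1 : ℝ)) p.1)
      (volume.prod ν) := by
  have : Integrable ((halfOpenCube d).indicator fun _ => (1 : ℝ)) := by
    rw [integrable_indicator_iff measurableSet_halfOpenCube]
    exact integrableOn_const (by simp [volume_halfOpenCube])
  exact this.comp_fst ν

theorem integral_cube_indicator :
    ∫ p : E d × Z, (halfOpenCube d).indicator (fun _ => (1 : ℝ)) p.1 ∂(volume.prod ν) = 1 := by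
  rw [integral_fun_fst, integral_indicator measurableSet_halfOpenCube, setIntegral_const]
  simp [Measure.real, volume_halfOpenCube]

theorem IsCubeWeight.abs_le_one {H : E d × Z → ℝ} (hH : IsCubeWeight H) (p : E d × Z) :
    |H p| ≤ 1 :=
  (hH.abs_le p).trans (Set.indicator_le_self' (fun _ _ => zero_le_one) _)

theorem IsCubeWeight.integrable_mul {H : E d × Z → ℝ} (hH : IsCubeWeight H) {G : E d × Z → ℝ}
    (hG : Measurable G) {C : ℝ} (hG1 : ∀ p, |G p| ≤ C) :
    Integrable (fun p => H p * G p) (volume.prod ν) := by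
  have : Integrable H (volume.prod ν) :=
    integrable_cube_indicator.mono' hH.measurable.aestronglyMeasurable
      (Eventually.of_forall hH.abs_le)
  exact this.mul_bdd hG.aestronglyMeasurable (Eventually.of_forall hG1)

/-- The pointwise form of the Cauchy–Schwarz inequality, weighted so that an error of mean square
`η ^ 2` contributes `η`. -/
theorem abs_mul_le_add_sq {H A η : ℝ} (hη : 0 < η) {B : ℝ} (hH : |H| ≤ B) (hB : B ≤ 1) :
    |H * A| ≤ η / 2 * B + (2 * η)⁻¹ * A ^ 2 := by
  have hB0 : 0 ≤ B := (abs_nonneg _).trans hH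
  rw [abs_mul]
  have h1 : |H| * |A| ≤ B * |A| := by gcongr
  have h2 : B * |A| ≤ η / 2 * B ^ 2 + (2 * η)⁻¹ * |A| ^ 2 := by
    have : η / 2 * B ^ 2 + (2 * η)⁻¹ * |A| ^ 2 - B * |A| = (2 * η)⁻¹ * (η * B - |A|) ^ 2 := by
      field_simp
      ring
    have h3 : 0 ≤ (2 * η)⁻¹ * (η * B - |A|) ^ 2 := by positivity
    linarith
  rw [sq_abs] at h2
  have h3 : η / 2 * B ^ 2 ≤ η / 2 * B := by
    have : B ^ 2 ≤ B := by nlinarith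
    gcongr
  linarith

/-- A function of small mean square contributes little. -/
theorem IsCubeWeight.abs_integral_mul_le_of_sq {H : E d × Z → ℝ} (hH : IsCubeWeight H)
    {m : E d → ℝ} (hm : Measurable m) (hmi : Integrable fun x => m x ^ 2)
    {c : Z → E d} (hc : Measurable c)
    {η : ℝ} (hη : 0 < η) (hmη : ∫ x, m x ^ 2 ≤ η ^ 2) :
    |∫ p, H p * m (p.1 + c p.2) ∂(volume.prod ν)| ≤ η := by
  have i1 := integrable_comp_add (ν := ν) (h := fun x => m x ^ 2) (hm.pow_const 2) hmi hc
  have i2 := (integrable_cube_indicator (d := d) (ν := ν)).const_mul (η / 2)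
  have i3 := i2.add (i1.const_mul (2 * η)⁻¹)
  have hval : ∫ p : E d × Z, m (p.1 + c p.2) ^ 2 ∂(volume.prod ν) = ∫ x, m x ^ 2 := by
    rw [integral_prod_symm _ i1]
    have : ∀ z, ∫ x, m (x + c z) ^ 2 = ∫ x, m x ^ 2 := fun z =>
      integral_add_right_eq_self (fun x => m x ^ 2) (c z)
    simp [this]
  refine (norm_integral_le_of_norm_le (f := fun p => H p * m (p.1 + c p.2)) i3
    (Eventually.of_forall fun p => abs_mul_le_add_sq hη (hH.abs_le p)
      (Set.indicator_le_self' (fun _ _ => zero_le_one) _))).trans ?_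
  rw [integral_add' i2 (i1.const_mul _), integral_const_mul, integral_const_mul, hval,
    integral_cube_indicator]
  calc η / 2 * 1 + (2 * η)⁻¹ * ∫ x, m x ^ 2 ≤ η / 2 * 1 + (2 * η)⁻¹ * η ^ 2 := by gcongr
    _ = η := by field_simp; ring

/-- A function that is constant on large cells hardly changes under short translations. -/
theorem IsCubeWeight.abs_integral_mul_translate_sub_le {H : E d × Z → ℝ} (hH : IsCubeWeight H)
    {g : E d → ℝ} (hg : IsCubeDensity g) {a : ℕ}
    (hga : ∀ x x', gridIdx a x = gridIdx a x' → g x = g x')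
    {c : Z → E d} (hc : Measurable c) {R : ℝ} (hR : ∀ z, ‖c z‖ ≤ R) :
    |∫ p, H p * (g (p.1 + c p.2) - g p.1) ∂(volume.prod ν)| ≤ d * 2 ^ a * R := by
  set S : Set (E d × Z) :=
    {p | p.1 ∈ halfOpenCube d ∧ gridIdx a (p.1 + c p.2) ≠ gridIdx a p.1} with hS
  have hSm : MeasurableSet S := by
    refine (measurable_fst measurableSet_halfOpenCube).inter (MeasurableSet.compl ?_)
    exact measurableSet_eq_fun
      (measurable_gridIdx.comp (measurable_fst.add (hc.comp measurable_snd)))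
      (measurable_gridIdx.comp measurable_fst)
  have hSvol : (volume.prod ν) S ≤ ENNReal.ofReal (d * 2 ^ a * R) := by
    rw [Measure.prod_apply_symm hSm]
    refine (lintegral_mono fun z => ?_).trans (b := ∫⁻ _, ENNReal.ofReal (d * 2 ^ a * R) ∂ν) ?_
    · refine (volume_gridIdx_ne_le a (c z)).trans (ENNReal.ofReal_le_ofReal ?_)
      have := hR z
      gcongr
    · simp
  have hR0 : 0 ≤ R := by
    obtain ⟨z⟩ : Nonempty Z := ν.nonempty_of_neZero
    exact (norm_nonneg _).trans (hR z)
  have hSi : Integrable (S.indicator fun _ => (1 : ℝ)) (volume.prod ν) :=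
    (integrable_indicator_iff hSm).mpr
      (integrableOn_const (hSvol.trans_lt ENNReal.ofReal_lt_top).ne)
  refine (norm_integral_le_of_norm_le (f := fun p => H p * (g (p.1 + c p.2) - g p.1)) hSi
    (Eventually.of_forall fun p => ?_)).trans ?_
  · rw [Real.norm_eq_abs, abs_mul]
    by_cases hp : p ∈ S
    · rw [Set.indicator_of_mem hp]
      refine mul_le_one₀ (hH.abs_le_one p) (abs_nonneg _) ?_
      have := hg.nonneg (p.1 + c p.2)
      have := hg.le_one (p.1 + c p.2)
      have := hg.nonneg p.1
      have := hg.le_one p.1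
      rw [_root_.abs_le]
      constructor <;> linarith
    · rw [Set.indicator_of_notMem hp]
      by_cases hq : p.1 ∈ halfOpenCube d
      · have : gridIdx a (p.1 + c p.2) = gridIdx a p.1 := by
          by_contra hne
          exact hp ⟨hq, hne⟩
        rw [hga _ _ this]
        simp
      · have := hH.abs_le p
        rw [Set.indicator_of_notMem hq] at this
        rw [le_antisymm this (abs_nonneg _), zero_mul]
  · rw [integral_indicator hSm, setIntegral_const, smul_eq_mul, mul_one, Measure.real]
    exact ENNReal.toReal_le_of_le_ofReal (by positivity) hSvol

end Errors

section HighFrequencyError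

variable {d N : ℕ}

/-- The high-frequency part `f - cellAvg b f` contributes little at a vertex whose own parameter
moves it along an arc, when the other factors do not depend on that parameter. -/
theorem IsCubeWeight.abs_integral_mul_highFrequency_le
    {H : E d × (Rot d × (Fin N → unitInterval)) → ℝ} (hH : IsCubeWeight H) {t : Fin N}
    (hHt : ∀ x g θ s, H (x, g, Function.update θ t s) = H (x, g, θ))
    {f : E d → ℝ} (hf : IsCubeDensity f) {b : ℕ} {γ ρ₀ r q τ η : ℝ}
    {w : (Fin N → unitInterval) → E d} (hw : Continuous w)
    (hd : 0 < d) (hγ0 : 0 < γ) (hγ1 : γ ≤ 1) (hρ₀ : 0 < ρ₀) (hr : 0 < r) (hτ : 0 < τ)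
    (hτ1 : τ ≤ 1) (hq0 : 0 ≤ q) (hq1 : q ≤ 1) (hbq : d * (2 ^ b : ℝ)⁻¹ ≤ q * (r * ρ₀))
    (harc : ∀ θ, ∃ ρ, ρ₀ ≤ ρ ∧ IsArc γ ρ fun s => w (Function.update θ t s))
    (hη : 0 < η) (hce : 4 * chordError d γ τ q ≤ η ^ 2) :
    |∫ p, H p * (fun z => f z - cellAvg b f z) (p.1 + Rot.act p.2.1 (r • w p.2.2))| ≤ η := by
  set h : E d → ℝ := fun z => f z - cellAvg b f z with hh
  have hm : Measurable h := hf.measurable.sub (hf.average b).measurable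
  have hi : Integrable h := hf.integrable.sub (hf.average b).integrable
  have h1 : ∀ y, |h y| ≤ 1 := hf.abs_sub_cellAvg_le_one b
  have hcY : Continuous fun p : E d × (Rot d × (Fin N → unitInterval)) =>
      p.1 + Rot.act p.2.1 (r • w p.2.2) := by
    have h0 : Continuous fun p : E d × (Rot d × (Fin N → unitInterval)) =>
      (p.2.1, r • w p.2.2) := by fun_prop
    have := Rot.continuous_act.comp h0
    exact continuous_fst.add this
  have hFi : Integrable (fun p => H p * h (p.1 + Rot.act p.2.1 (r • w p.2.2)))
      (volume.prod volume) := hH.integrable_mul (hm.comp hcY.measurable) fun p => h1 _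
  -- the average over the parameter of the moving vertex
  set A : (E d × Rot d) × (Fin N → unitInterval) → ℝ := fun p =>
    ∫ s, h (p.1.1 + Rot.act p.1.2 (r • w (Function.update p.2 t s))) with hA
  have hcA : Continuous fun p : ((E d × Rot d) × (Fin N → unitInterval)) × unitInterval =>
      Rot.act p.1.1.2 (r • w (Function.update p.1.2 t p.2)) := by
    have hup : Continuous fun p : ((E d × Rot d) × (Fin N → unitInterval)) × unitInterval =>
      Function.update p.1.2 t p.2 := (continuous_snd.comp continuous_fst).update t continuous_snd
    have h0 : Continuous fun p : ((E d × Rot d) × (Fin N → unitInterval)) × unitInterval =>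
      (p.1.1.2, r • w (Function.update p.1.2 t p.2)) :=
      Continuous.prodMk (by fun_prop) ((hw.comp hup).const_smul r)
    have := Rot.continuous_act.comp h0
    exact this
  have hAm : Measurable A := by
    have : StronglyMeasurable fun p : ((E d × Rot d) × (Fin N → unitInterval)) × unitInterval =>
      h (p.1.1.1 + Rot.act p.1.1.2 (r • w (Function.update p.1.2 t p.2))) := by
      refine (hm.comp (Continuous.measurable ?_)).stronglyMeasurable
      exact Continuous.add (by fun_prop) hcA
    exact this.integral_prod_right.measurable
  have hA1 : ∀ p, |A p| ≤ 1 := by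
    intro p
    have := norm_integral_le_of_norm_le_const (μ := (volume : Measure unitInterval))
      (f := fun s => h (p.1.1 + Rot.act p.1.2 (r • w (Function.update p.2 t s)))) (C := 1)
      (Eventually.of_forall fun s => h1 _)
    rw [probReal_univ, mul_one] at this
    exact this
  have hA2i : Integrable (fun p => A p ^ 2) ((volume.prod volume).prod volume) := by
    have hc' : Continuous fun p : Rot d × ((Fin N → unitInterval) × unitInterval) =>
        Rot.act p.1 (r • w (Function.update p.2.1 t p.2.2)) := by
      have hup : Continuous fun p : Rot d × ((Fin N → unitInterval) × unitInterval) =>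
        Function.update p.2.1 t p.2.2 :=
          (continuous_fst.comp continuous_snd).update t (continuous_snd.comp continuous_snd)
      have h0 : Continuous fun p : Rot d × ((Fin N → unitInterval) × unitInterval) =>
        (p.1, r • w (Function.update p.2.1 t p.2.2)) :=
        continuous_fst.prodMk ((hw.comp hup).const_smul r)
      have := Rot.continuous_act.comp h0
      exact this
    have e1 := integrable_comp_add_assoc (μ := (volume : Measure (Rot d)))
      (ν := (volume : Measure (Fin N → unitInterval)).prod (volume : Measure unitInterval))
      hm.abs hi.abs hc'.measurable
    have e2 := (measurePreserving_prodAssoc ((volume : Measure (E d)).prod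
      (volume : Measure (Rot d))) (volume : Measure (Fin N → unitInterval))
      (volume : Measure unitInterval)).integrable_comp_of_integrable e1
    refine e2.integral_prod_left.mono' (hAm.pow_const 2).aestronglyMeasurable
      (Eventually.of_forall fun p => ?_)
    rw [Real.norm_eq_abs, abs_pow, sq]
    calc |A p| * |A p| ≤ |A p| * 1 := by gcongr; exact hA1 p
      _ = |A p| := mul_one _
      _ ≤ _ := abs_integral_le_integral_abs
  have hA2 : ∫ p, A p ^ 2 ∂((volume.prod volume).prod volume) ≤ 4 * chordError d γ τ q := by
    rw [integral_prod_symm _ hA2i]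
    have hθ : ∀ θ, ∫ x, A (x, θ) ^ 2 ∂(volume.prod volume) ≤ 4 * chordError d γ τ q := by
      intro θ
      obtain ⟨ρ, hρ, hρarc⟩ := harc θ
      have := hf.integral_sq_arc_le (b := b) (r := r) (q := q) (τ := τ) hd hγ0 hγ1
        (hρ₀.trans_le hρ) hr hτ hτ1 hq0 hq1
        (hbq.trans (by gcongr)) hρarc
        (hw.comp (continuous_const.update t continuous_id))
      refine this.trans (le_of_eq (by ring))
    refine (integral_mono hA2i.integral_prod_right (integrable_const _) hθ).trans ?_
    simp
  -- draw the parameter of the moving vertex afresh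
  have hassoc := measurePreserving_prodAssoc (volume : Measure (E d)) (volume : Measure (Rot d))
    (volume : Measure (Fin N → unitInterval))
  have hFi' : Integrable (fun p : (E d × Rot d) × (Fin N → unitInterval) =>
      H (p.1.1, p.1.2, p.2) * h (p.1.1 + Rot.act p.1.2 (r • w p.2)))
      ((volume.prod volume).prod volume) := hassoc.integrable_comp_of_integrable hFi
  set H' : (E d × Rot d) × (Fin N → unitInterval) → ℝ := fun p => H (p.1.1, p.1.2, p.2) with hH'
  have hH'm : Measurable H' := hH.measurable.comp (by fun_prop)
  have hstep : ∫ p, H p * h (p.1 + Rot.act p.2.1 (r • w p.2.2)) =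
      ∫ p, H' p * A p ∂((volume.prod volume).prod volume) := by
    have hHA : Integrable (fun p => H' p * A p) ((volume.prod volume).prod volume) := by
      have hb : Integrable (fun p : (E d × Rot d) × (Fin N → unitInterval) =>
          (halfOpenCube d).indicator (fun _ => (1 : ℝ)) p.1.1)
          ((volume.prod volume).prod volume) :=
        (integrable_cube_indicator (d := d) (ν := (volume : Measure (Rot d)))).comp_fst _
      exact (hb.mono' hH'm.aestronglyMeasurable
        (Eventually.of_forall fun p => hH.abs_le _)).mul_bdd hAm.aestronglyMeasurable
        (Eventually.of_forall hA1)
    have e0 : ∫ p : (E d × Rot d) × (Fin N → unitInterval),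
        H (p.1.1, p.1.2, p.2) * h (p.1.1 + Rot.act p.1.2 (r • w p.2))
        ∂((volume.prod volume).prod volume) =
        ∫ p, H p * h (p.1 + Rot.act p.2.1 (r • w p.2.2)) ∂(volume.prod (volume.prod volume)) :=
      hassoc.integral_comp' (fun p => H p * h (p.1 + Rot.act p.2.1 (r • w p.2.2)))
    rw [Measure.volume_eq_prod, Measure.volume_eq_prod, ← e0, integral_prod _ hFi',
      integral_prod _ hHA]
    refine integral_congr_ae (Eventually.of_forall fun x => ?_)
    have hsec : Measurable fun θ => H (x.1, x.2, θ) * h (x.1 + Rot.act x.2 (r • w θ)) := by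
      have e1 : Measurable fun θ : Fin N → unitInterval => H (x.1, x.2, θ) :=
        hH.measurable.comp (by fun_prop)
      refine e1.mul (hm.comp ?_)
      have := hcY.measurable.comp
        (g := fun p : E d × (Rot d × (Fin N → unitInterval)) => p.1 + Rot.act p.2.1 (r • w p.2.2))
        (f := fun θ : Fin N → unitInterval => (x.1, x.2, θ)) (by fun_prop)
      exact this
    change ∫ θ, H (x.1, x.2, θ) * h (x.1 + Rot.act x.2 (r • w θ)) = ∫ θ, H' (x, θ) * A (x, θ)
    rw [integral_resample t (F := fun θ => H (x.1, x.2, θ) * h (x.1 + Rot.act x.2 (r • w θ)))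
      (Integrable.mono' (integrable_const (1 : ℝ)) hsec.aestronglyMeasurable
        (Eventually.of_forall fun θ => by
          rw [norm_mul]
          exact mul_le_one₀ (hH.abs_le_one _) (norm_nonneg _) (h1 _)))]
    simp only [hHt, integral_const_mul, hH', hA]
  rw [hstep]
  have i2 := ((integrable_cube_indicator (d := d) (ν := (volume : Measure (Rot d)))).comp_fst
    (volume : Measure (Fin N → unitInterval))).const_mul (η / 2)
  have i3 := i2.add (hA2i.const_mul (2 * η)⁻¹)
  refine (norm_integral_le_of_norm_le (f := fun p => H' p * A p) i3
    (Eventually.of_forall fun p => abs_mul_le_add_sq hη (hH.abs_le (p.1.1, p.1.2, p.2))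
      (Set.indicator_le_self' (fun _ _ => zero_le_one) _))).trans ?_
  rw [integral_add' i2 (hA2i.const_mul _), integral_const_mul, integral_const_mul,
    integral_fun_fst (fun p : E d × Rot d => (halfOpenCube d).indicator (fun _ => (1 : ℝ)) p.1),
    integral_cube_indicator]
  calc _ ≤ η / 2 * 1 + (2 * η)⁻¹ * η ^ 2 := by
        have := hA2.trans hce
        simp only [probReal_univ, one_smul]
        gcongr
    _ = η := by field_simp; ring

end HighFrequencyError

/-! ### Counting configurations -/

/-- A family of configurations of `N` points of `ℝᵈ`, parametrised by one number in `[0,1]` per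
point.  The first point is the origin; each other point depends only on its own parameter and the
earlier ones, and moves along an arc of a circle of radius at least `radius` as its own parameter
varies. -/
structure FlexibleConfig (d N : ℕ) where
  /-- the points of the configuration, as functions of the parameters -/
  point : Fin N → (Fin N → unitInterval) → E d
  /-- the angular speed of each point -/
  speed : Fin N → ℝ
  /-- a lower bound for the radii of the arcs -/
  radius : ℝ
  /-- a bound for the norms of the points -/
  bound : ℝ
  radius_pos : 0 < radius
  speed_pos : ∀ j, 0 < speed j
  speed_le_one : ∀ j, speed j ≤ 1
  continuous_point : ∀ j, Continuous (point j)
  norm_point_le : ∀ j θ, ‖point j θ‖ ≤ bound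
  point_zero : ∀ j : Fin N, (j : ℕ) = 0 → ∀ θ, point j θ = 0
  point_update : ∀ i j, j < i → ∀ θ s, point j (Function.update θ i s) = point j θ
  exists_isArc : ∀ j : Fin N, (j : ℕ) ≠ 0 → ∀ θ, ∃ ρ, radius ≤ ρ ∧
    IsArc (speed j) ρ fun s => point j (Function.update θ j s)

namespace FlexibleConfig

variable {d N : ℕ} (W : FlexibleConfig d N)

/-- The `j`-th point of the configuration, dilated by `r` and rotated. -/
noncomputable def moved (r : ℝ) (j : Fin N) (z : Rot d × (Fin N → unitInterval)) : E d :=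
  Rot.act z.1 (r • W.point j z.2)

theorem continuous_moved (r : ℝ) (j : Fin N) : Continuous (W.moved r j) := by
  have hw := W.continuous_point j
  have h0 : Continuous fun z : Rot d × (Fin N → unitInterval) => (z.1, r • W.point j z.2) := by
    fun_prop
  have := Rot.continuous_act.comp h0
  exact this

/-- The product of `f` over the first `k` points of the configuration, the other factors being
replaced by the coarse average of `f` at the base point. -/
noncomputable def partialCount (f g : E d → ℝ) (r : ℝ) (k : ℕ)
    (n : ℕ) (p : E d × (Rot d × (Fin N → unitInterval))) : ℝ :=
  (∏ j ∈ Finset.univ.filter fun j : Fin N => (j : ℕ) < k, f (p.1 + W.moved r j p.2)) * g p.1 ^ n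

theorem partialCount_isCubeWeight {f g : E d → ℝ} (hf : IsCubeDensity f) (hg : IsCubeDensity g)
    (r : ℝ) {k : ℕ} (hk : 0 < k) (hN : 0 < N) (n : ℕ) :
    IsCubeWeight (W.partialCount f g r k n) where
  measurable := by
    refine Measurable.mul ?_ ((hg.measurable.comp measurable_fst).pow_const n)
    refine Finset.measurable_prod _ fun j _ => hf.measurable.comp ?_
    exact measurable_fst.add ((W.continuous_moved r j).measurable.comp measurable_snd)
  abs_le p := by
    have h0 : (⟨0, hN⟩ : Fin N) ∈ Finset.univ.filter fun j : Fin N => (j : ℕ) < k := by simpa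
    have hz : W.moved r ⟨0, hN⟩ p.2 = 0 := by
      simp [moved, W.point_zero ⟨0, hN⟩ rfl]
    unfold partialCount
    rw [← Finset.mul_prod_erase _ _ h0, hz, add_zero, mul_assoc, abs_mul,
      abs_of_nonneg (hf.nonneg _)]
    refine (mul_le_of_le_one_right (hf.nonneg _) ?_).trans (hf.le_indicator _)
    rw [abs_mul, Finset.abs_prod, abs_pow]
    refine mul_le_one₀ (Finset.prod_le_one (fun _ _ => abs_nonneg _)
      fun _ _ => hf.abs_le_one _) (by positivity) (pow_le_one₀ (abs_nonneg _) (hg.abs_le_one _))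

theorem partialCount_succ (f g : E d → ℝ) (r : ℝ) (k : Fin N) (n : ℕ)
    (p : E d × (Rot d × (Fin N → unitInterval))) :
    W.partialCount f g r (k + 1) n p =
      W.partialCount f g r k n p * f (p.1 + W.moved r k p.2) := by
  have : (Finset.univ.filter fun j : Fin N => (j : ℕ) < k + 1) =
      insert k (Finset.univ.filter fun j : Fin N => (j : ℕ) < k) := by
    ext j
    simp only [Finset.mem_filter, Finset.mem_univ, true_and, Finset.mem_insert, Fin.ext_iff]
    omega
  unfold partialCount
  rw [this, Finset.prod_insert (by simp)]
  ring

theorem partialCount_pow_succ (f g : E d → ℝ) (r : ℝ) (k n : ℕ)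
    (p : E d × (Rot d × (Fin N → unitInterval))) :
    W.partialCount f g r k (n + 1) p = W.partialCount f g r k n p * g p.1 := by
  unfold partialCount
  ring

theorem partialCount_update (f g : E d → ℝ) (r : ℝ) (k : Fin N) (n : ℕ) (x : E d) (u : Rot d)
    (θ : Fin N → unitInterval) (s : unitInterval) :
    W.partialCount f g r k n (x, u, Function.update θ k s) =
      W.partialCount f g r k n (x, u, θ) := by
  unfold partialCount moved
  congr 1
  refine Finset.prod_congr rfl fun j hj => ?_
  rw [Finset.mem_filter] at hj
  simp only
  rw [W.point_update k j hj.2]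

variable {f : E d → ℝ} {a b : ℕ} {r q τ η : ℝ}

/-- Replacing the factor of one point by the coarse average costs little. -/
theorem integral_partialCount_step (hf : IsCubeDensity f) (hd : 0 < d) (hr : 0 < r) (hτ : 0 < τ)
    (hτ1 : τ ≤ 1) (hq0 : 0 ≤ q) (hq1 : q ≤ 1) (hbq : d * (2 ^ b : ℝ)⁻¹ ≤ q * (r * W.radius))
    (hη : 0 < η) (k : Fin N) (hk : 0 < (k : ℕ)) (hce : 4 * chordError d (W.speed k) τ q ≤ η ^ 2)
    (hmid : ∫ x, (cellAvg b f x - cellAvg a f x) ^ 2 ≤ η ^ 2) (n : ℕ) :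
    ∫ p, W.partialCount f (cellAvg a f) r k (n + 1) p ≤
      (∫ p, W.partialCount f (cellAvg a f) r (k + 1) n p) +
        (d * 2 ^ a * (r * W.bound) + 2 * η) := by
  have hN : 0 < N := hk.trans k.2
  set g := cellAvg a f with hg_def
  have hg : IsCubeDensity g := hf.average a
  set H := W.partialCount f g r k n with hH_def
  have hH : IsCubeWeight H := W.partialCount_isCubeWeight hf hg r hk hN n
  set c := W.moved r k with hc_def
  have hc : Measurable c := (W.continuous_moved r k).measurable
  have hadd : Measurable fun p : E d × (Rot d × (Fin N → unitInterval)) => p.1 + c p.2 :=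
    measurable_fst.add (hc.comp measurable_snd)
  have hcR : ∀ z, ‖c z‖ ≤ r * W.bound := by
    intro z
    rw [hc_def, moved, LinearIsometryEquiv.norm_map, norm_smul, Real.norm_of_nonneg hr.le]
    exact mul_le_mul_of_nonneg_left (W.norm_point_le k z.2) hr.le
  have low := hH.abs_integral_mul_translate_sub_le (ν := volume) hg
    (fun x x' h => cellAvg_congr h) hc hcR
  have hmm : Measurable fun x => cellAvg b f x - g x :=
    (hf.average b).measurable.sub hg.measurable
  have hm1 : ∀ x, |cellAvg b f x - g x| ≤ 1 := by
    intro x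
    have := hg.nonneg x
    have := hg.le_one x
    have := (hf.average b).nonneg x
    have := (hf.average b).le_one x
    rw [_root_.abs_le]
    constructor <;> linarith
  have hmi : Integrable fun x => cellAvg b f x - g x :=
    (hf.average b).integrable.sub hg.integrable
  have hm2i : Integrable fun x => (cellAvg b f x - g x) ^ 2 := by
    simp_rw [sq]
    exact hmi.mul_bdd hmm.aestronglyMeasurable (Eventually.of_forall hm1)
  have mid := hH.abs_integral_mul_le_of_sq (ν := volume) hmm hm2i hc hη hmid
  have high := hH.abs_integral_mul_highFrequency_le (t := k)
    (W.partialCount_update f g r k n) hf (W.continuous_point k) hd (W.speed_pos k)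
    (W.speed_le_one k) W.radius_pos hr hτ hτ1 hq0 hq1 hbq (W.exists_isArc k hk.ne') hη hce
  have i0 : Integrable (fun p => H p * g p.1) (volume.prod volume) :=
    hH.integrable_mul (hg.measurable.comp measurable_fst) fun p => hg.abs_le_one _
  have i1 : Integrable (fun p => H p * (g (p.1 + c p.2) - g p.1)) (volume.prod volume) :=
    hH.integrable_mul ((hg.measurable.comp hadd).sub (hg.measurable.comp measurable_fst))
      (C := 2) fun p => by
        have h1 := _root_.abs_le.mp (hg.abs_le_one (p.1 + c p.2))
        have h2 := _root_.abs_le.mp (hg.abs_le_one p.1)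
        rw [_root_.abs_le]
        constructor <;> linarith [h1.1, h1.2, h2.1, h2.2]
  have i2 : Integrable (fun p => H p * (cellAvg b f (p.1 + c p.2) - g (p.1 + c p.2)))
      (volume.prod volume) := hH.integrable_mul (hmm.comp hadd) fun p => hm1 _
  have i3 : Integrable (fun p => H p * (f (p.1 + c p.2) - cellAvg b f (p.1 + c p.2)))
      (volume.prod volume) :=
    hH.integrable_mul ((hf.measurable.sub (hf.average b).measurable).comp hadd)
      fun p => hf.abs_sub_cellAvg_le_one b _
  have hsplit : ∫ p, W.partialCount f g r (k + 1) n p =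
      (∫ p, H p * g p.1) + (∫ p, H p * (g (p.1 + c p.2) - g p.1)) +
      (∫ p, H p * (cellAvg b f (p.1 + c p.2) - g (p.1 + c p.2))) +
      ∫ p, H p * (f (p.1 + c p.2) - cellAvg b f (p.1 + c p.2)) := by
    have i01 : Integrable (fun p => H p * g p.1 + H p * (g (p.1 + c p.2) - g p.1))
      (volume.prod volume) := i0.add i1
    have i012 : Integrable (fun p => H p * g p.1 + H p * (g (p.1 + c p.2) - g p.1) +
      H p * (cellAvg b f (p.1 + c p.2) - g (p.1 + c p.2))) (volume.prod volume) := i01.add i2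
    rw [Measure.volume_eq_prod, ← integral_add i0 i1, ← integral_add i01 i2,
      ← integral_add i012 i3]
    refine integral_congr_ae (Eventually.of_forall fun p => ?_)
    simp only [W.partialCount_succ]
    ring
  have h1 := (_root_.abs_le.mp low).1
  have h2 := (_root_.abs_le.mp mid).1
  have h3 := (_root_.abs_le.mp high).1
  rw [hsplit]
  simp only [W.partialCount_pow_succ]
  simp only [Measure.volume_eq_prod] at h1 h2 h3 ⊢
  change -η ≤ ∫ p, H p * (f (p.1 + c p.2) - cellAvg b f (p.1 + c p.2)) ∂_ at h3
  linarith

/-- If `f` has mean at least `δ` and the scale `r` is good for `f`, some moved configuration lies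
in the support of `f`. -/
theorem exists_forall_ne_zero (hf : IsCubeDensity f) (hN : 0 < N) (hd : 0 < d) (hr : 0 < r)
    (hτ : 0 < τ) (hτ1 : τ ≤ 1) (hq0 : 0 ≤ q) (hq1 : q ≤ 1)
    (hbq : d * (2 ^ b : ℝ)⁻¹ ≤ q * (r * W.radius)) (hη : 0 < η)
    (hce : ∀ k, 4 * chordError d (W.speed k) τ q ≤ η ^ 2)
    (hmid : ∫ x, (cellAvg b f x - cellAvg a f x) ^ 2 ≤ η ^ 2)
    {δ : ℝ} (hδ : 0 ≤ δ) (hδf : δ ≤ ∫ x, f x)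
    (hlt : N * (d * 2 ^ a * (r * W.bound) + 2 * η) < δ ^ N) :
    ∃ x z, ∀ j, f (x + W.moved r j z) ≠ 0 := by
  set g := cellAvg a f with hg_def
  have hg : IsCubeDensity g := hf.average a
  set err := d * 2 ^ a * (r * W.bound) + 2 * η with herr
  have herr0 : 0 ≤ err := by
    have : 0 ≤ W.bound := (norm_nonneg _).trans (W.norm_point_le ⟨0, hN⟩ 0)
    positivity
  have key : ∀ m, m + 1 ≤ N → δ ^ N - m * err ≤
      ∫ p, W.partialCount f g r (m + 1) (N - 1 - m) p := by
    intro m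
    induction m with
    | zero =>
      intro _
      have h1 := hf.pow_integral_le (l := a) (N - 1)
      rw [Nat.sub_add_cancel hN] at h1
      have h2 : ∫ p, W.partialCount f g r (0 + 1) (N - 1 - 0) p =
          ∫ x, f x * cellAvg a f x ^ (N - 1) := by
        have : ∀ p, W.partialCount f g r (0 + 1) (N - 1 - 0) p =
            f p.1 * cellAvg a f p.1 ^ (N - 1) := by
          intro p
          have h3 : (0 : ℕ) + 1 = ((⟨0, hN⟩ : Fin N) : ℕ) + 1 := rfl
          rw [h3, W.partialCount_succ]
          simp [partialCount, moved, W.point_zero ⟨0, hN⟩ rfl, mul_comm, hg_def]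
        simp_rw [this]
        rw [Measure.volume_eq_prod, integral_fun_fst (fun x => f x * cellAvg a f x ^ (N - 1))]
        simp
      rw [h2]
      have : δ ^ N ≤ (∫ x, f x) ^ N := by gcongr
      simp only [Nat.cast_zero, zero_mul, sub_zero]
      linarith
    | succ m ih =>
      intro hm
      have h1 := ih (by omega)
      have h2 := W.integral_partialCount_step hf hd hr hτ hτ1 hq0 hq1 hbq hη ⟨m + 1, by omega⟩
        (Nat.succ_pos m) (hce _) hmid (N - 1 - (m + 1))
      rw [show N - 1 - (m + 1) + 1 = N - 1 - m by omega] at h2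
      push_cast
      simp only at h2
      linarith
  have hfin := key (N - 1) (by omega)
  rw [Nat.sub_add_cancel hN] at hfin
  have hpos : 0 < ∫ p, W.partialCount f g r N (N - 1 - (N - 1)) p := by
    refine lt_of_lt_of_le ?_ hfin
    have : ((N - 1 : ℕ) : ℝ) * err ≤ N * err := by
      gcongr
      exact Nat.sub_le N 1
    linarith
  obtain ⟨p, hp⟩ : ∃ p, W.partialCount f g r N (N - 1 - (N - 1)) p ≠ 0 := by
    by_contra! hcon
    simp_rw [hcon] at hpos
    simp at hpos
  refine ⟨p.1, p.2, fun j hj => hp ?_⟩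
  unfold partialCount
  rw [Finset.prod_eq_zero (i := j) (by simp) hj, zero_mul]

end FlexibleConfig

/-! ### Arcs of solutions of the distance constraints -/

section Arc

variable {d : ℕ} {ι : Type*} [Fintype ι] [DecidableEq ι]

open Topology RealInnerProductSpace

/-- The vector in the span of `e` whose inner products with the `e i` are the `y i`, by Cramer's
rule for the Gram matrix (the zero vector when `e` is linearly dependent). -/
noncomputable def gramSolve (e : ι → E d) (y : ι → ℝ) : E d :=
  ∑ i, ((Matrix.gram ℝ e).det⁻¹ * ((Matrix.gram ℝ e).adjugate.mulVec y) i) • e i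

theorem inner_gramSolve {e : ι → E d} (he : (Matrix.gram ℝ e).det ≠ 0) (y : ι → ℝ) (j : ι) :
    ⟪gramSolve e y, e j⟫ = y j := by
  have h : (Matrix.gram ℝ e).mulVec ((Matrix.gram ℝ e).adjugate.mulVec y) j =
      (Matrix.gram ℝ e).det * y j := by
    rw [Matrix.mulVec_mulVec, Matrix.mul_adjugate, Matrix.smul_mulVec, Matrix.one_mulVec]
    rfl
  rw [Matrix.mulVec, dotProduct] at h
  simp only [gramSolve, sum_inner, real_inner_smul_left]
  simp only [Matrix.gram_apply] at h
  calc ∑ i, (Matrix.gram ℝ e).det⁻¹ * (Matrix.gram ℝ e).adjugate.mulVec y i * ⟪e i, e j⟫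
      = (Matrix.gram ℝ e).det⁻¹ *
        ∑ i, ⟪e j, e i⟫ * (Matrix.gram ℝ e).adjugate.mulVec y i := by
        rw [Finset.mul_sum]
        refine Finset.sum_congr rfl fun i _ => ?_
        rw [real_inner_comm]
        ring
    _ = y j := by rw [h, inv_mul_cancel_left₀ he]

theorem gramSolve_mem_span (e : ι → E d) (y : ι → ℝ) :
    gramSolve e y ∈ Submodule.span ℝ (Set.range e) :=
  Submodule.sum_mem _ fun i _ => Submodule.smul_mem _ _ (Submodule.subset_span ⟨i, rfl⟩)

theorem gramSolve_zero (e : ι → E d) : gramSolve e 0 = 0 := by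
  simp [gramSolve]

theorem continuous_gram {κ : Type*} : Continuous fun e : κ → E d => Matrix.gram ℝ e := by
  refine continuous_matrix fun i j => ?_
  simp only [Matrix.gram_apply]
  fun_prop

theorem continuousAt_gramSolve {e : ι → E d} (he : (Matrix.gram ℝ e).det ≠ 0)
    {y : (ι → E d) → ι → ℝ} (hy : Continuous y) :
    ContinuousAt (fun e => gramSolve e (y e)) e := by
  unfold gramSolve
  refine tendsto_finsetSum _ fun i _ => ?_
  have h1 : ContinuousAt (fun e : ι → E d => (Matrix.gram ℝ e).det⁻¹) e :=
    (continuous_gram.matrix_det.continuousAt).inv₀ he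
  have h2 : Continuous fun e : ι → E d => (Matrix.gram ℝ e).adjugate.mulVec (y e) i :=
    (continuous_apply i).comp (continuous_gram.matrix_adjugate.matrix_mulVec hy)
  exact (h1.mul h2.continuousAt).smul (continuous_apply i).continuousAt

/-- The component of `v` orthogonal to the span of `e`. -/
noncomputable def orthPart (e : ι → E d) (v : E d) : E d :=
  v - gramSolve e fun i => ⟪v, e i⟫

theorem inner_orthPart {e : ι → E d} (he : (Matrix.gram ℝ e).det ≠ 0) (v : E d) (j : ι) :
    ⟪orthPart e v, e j⟫ = 0 := by
  rw [orthPart, inner_sub_left, inner_gramSolve he, sub_self]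

theorem inner_eq_zero_of_mem_span {κ : Type*} {e : κ → E d} {v x : E d} (hv : ∀ j, ⟪v, e j⟫ = 0)
    (hx : x ∈ Submodule.span ℝ (Set.range e)) : ⟪v, x⟫ = 0 := by
  induction hx using Submodule.span_induction with
  | mem x hx => obtain ⟨j, rfl⟩ := hx; exact hv j
  | zero => exact inner_zero_right _
  | add x y _ _ hx hy => rw [inner_add_right, hx, hy, add_zero]
  | smul a x _ hx => rw [real_inner_smul_right, hx, mul_zero]

theorem continuousAt_orthPart {e : ι → E d} (he : (Matrix.gram ℝ e).det ≠ 0) (v : E d) :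
    ContinuousAt (fun e => orthPart e v) e :=
  continuousAt_const.sub (continuousAt_gramSolve he (by fun_prop))

theorem orthPart_eq_self {e : ι → E d} {v : E d} (hv : ∀ j, ⟪v, e j⟫ = 0) : orthPart e v = v := by
  have : (fun i => ⟪v, e i⟫) = 0 := funext hv
  rw [orthPart, this, gramSolve_zero, sub_zero]

/-- The data of a circle: centre, an orthonormal frame of its plane, and radius. -/
structure CircleFrame (d : ℕ) where
  /-- the centre of the circle -/
  center : E d
  /-- the first axis of the plane of the circle -/
  axis₁ : E d
  /-- the second axis of the plane of the circle -/
  axis₂ : E d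
  /-- the radius of the circle -/
  radius : ℝ

/-- The point of the circle at angle `θ`. -/
noncomputable def CircleFrame.eval (C : CircleFrame d) (θ : ℝ) : E d :=
  C.center + C.radius • (Real.cos θ • C.axis₁ + Real.sin θ • C.axis₂)

/-- The axes are orthonormal, and orthogonal to the centre. -/
structure CircleFrame.IsFrame (C : CircleFrame d) : Prop where
  norm₁ : ‖C.axis₁‖ = 1
  norm₂ : ‖C.axis₂‖ = 1
  inner_axes : ⟪C.axis₁, C.axis₂⟫ = 0
  inner₁ : ⟪C.axis₁, C.center⟫ = 0
  inner₂ : ⟪C.axis₂, C.center⟫ = 0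

theorem norm_sq_cos_smul_add_sin_smul {F₁ F₂ : E d} (h1 : ‖F₁‖ = 1) (h2 : ‖F₂‖ = 1)
    (h12 : ⟪F₁, F₂⟫ = 0) (α β : ℝ) : ‖α • F₁ + β • F₂‖ ^ 2 = α ^ 2 + β ^ 2 := by
  rw [norm_add_sq_real, real_inner_smul_left, real_inner_smul_right, h12, norm_smul, norm_smul,
    h1, h2]
  simp

theorem CircleFrame.IsFrame.norm_sq_eval {C : CircleFrame d} (hC : C.IsFrame) (θ : ℝ) :
    ‖C.eval θ‖ ^ 2 = ‖C.center‖ ^ 2 + C.radius ^ 2 := by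
  rw [CircleFrame.eval, norm_add_sq_real, norm_smul, mul_pow,
    norm_sq_cos_smul_add_sin_smul hC.norm₁ hC.norm₂ hC.inner_axes, real_inner_smul_right,
    inner_add_right, real_inner_smul_right, real_inner_smul_right, real_inner_comm, hC.inner₁,
    real_inner_comm, hC.inner₂]
  simp

theorem CircleFrame.IsFrame.norm_eval_sub {C : CircleFrame d} (hC : C.IsFrame)
    (hρ : 0 ≤ C.radius) (θ θ' : ℝ) :
    ‖C.eval θ - C.eval θ'‖ = 2 * C.radius * |Real.sin ((θ - θ') / 2)| := by
  have h1 : C.eval θ - C.eval θ' = C.radius •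
      ((Real.cos θ - Real.cos θ') • C.axis₁ + (Real.sin θ - Real.sin θ') • C.axis₂) := by
    simp only [CircleFrame.eval, sub_smul, smul_add, smul_sub]
    abel
  have h2 : ‖(Real.cos θ - Real.cos θ') • C.axis₁ + (Real.sin θ - Real.sin θ') • C.axis₂‖ ^ 2 =
      (2 * |Real.sin ((θ - θ') / 2)|) ^ 2 := by
    rw [norm_sq_cos_smul_add_sin_smul hC.norm₁ hC.norm₂ hC.inner_axes, Real.cos_sub_cos,
      Real.sin_sub_sin, mul_pow 2, sq_abs]
    have := Real.sin_sq_add_cos_sq ((θ + θ') / 2)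
    linear_combination 4 * Real.sin ((θ - θ') / 2) ^ 2 * this
  have h3 := (sq_eq_sq₀ (norm_nonneg _) (by positivity)).mp h2
  rw [h1, norm_smul, Real.norm_of_nonneg hρ, h3]
  ring

/-- The solutions `u` of `‖u‖ = ‖u₀‖`, `‖u - e i‖ = ‖u₀ - e₀ i‖` contain a circle that depends
continuously on `e` near `e₀` and passes through `u₀` for `e = e₀`. -/
theorem exists_circleFrame {e₀ : ι → E d} (he₀ : LinearIndependent ℝ e₀) {u₀ : E d}
    (hu₀ : u₀ ∉ Submodule.span ℝ (Set.range e₀)) (hcard : Fintype.card ι + 2 ≤ d) :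
    ∃ (C : (ι → E d) → CircleFrame d) (ρ₀ : ℝ), 0 < ρ₀ ∧ (C e₀).eval 0 = u₀ ∧
      ∀ᶠ e in 𝓝 e₀, (C e).IsFrame ∧ ρ₀ ≤ (C e).radius ∧
        (∀ θ, ‖(C e).eval θ‖ = ‖u₀‖ ∧ ∀ i, ‖(C e).eval θ - e i‖ = ‖u₀ - e₀ i‖) ∧
        ∀ θ, ContinuousAt (fun p : (ι → E d) × ℝ => (C p.1).eval p.2) (e, θ) := by
  have hdet₀ : (Matrix.gram ℝ e₀).det ≠ 0 := Matrix.det_gram_ne_zero_iff_linearIndependent.mpr he₀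
  -- the inner products with the `e i` that the constraints prescribe
  set y : (ι → E d) → ι → ℝ := fun e i => (‖u₀‖ ^ 2 + ‖e i‖ ^ 2 - ‖u₀ - e₀ i‖ ^ 2) / 2 with hy
  have hyc : Continuous y := by rw [hy]; fun_prop
  have hy₀ : ∀ i, y e₀ i = ⟪u₀, e₀ i⟫ := by
    intro i
    simp only [hy, norm_sub_sq_real]
    ring
  set c : (ι → E d) → E d := fun e => gramSolve e (y e) with hc
  set q₁ : E d := u₀ - c e₀ with hq₁
  have hq₁orth : ∀ j, ⟪q₁, e₀ j⟫ = 0 := by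
    intro j
    rw [hq₁, inner_sub_left, hc, inner_gramSolve hdet₀, hy₀, sub_self]
  have hq₁0 : q₁ ≠ 0 := by
    intro h0
    refine hu₀ ?_
    rw [sub_eq_zero.mp h0]
    exact gramSolve_mem_span _ _
  obtain ⟨q₂, hq₂0, hq₂orth, hq₂q₁⟩ : ∃ q₂ : E d, q₂ ≠ 0 ∧ (∀ j, ⟪q₂, e₀ j⟫ = 0) ∧
      ⟪q₁, q₂⟫ = 0 := by
    set K : Submodule ℝ (E d) := Submodule.span ℝ (Set.range e₀) ⊔ Submodule.span ℝ {q₁} with hK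
    have hKd : Module.finrank ℝ K ≤ Fintype.card ι + 1 := by
      refine (Submodule.finrank_add_le_finrank_add_finrank _ _).trans ?_
      exact add_le_add (finrank_range_le_card e₀) (finrank_span_singleton hq₁0).le
    have hne : Kᗮ ≠ ⊥ := by
      intro hbot
      have h1 := Submodule.finrank_add_finrank_orthogonal K
      rw [hbot, finrank_bot, finrank_euclideanSpace_fin] at h1
      omega
    obtain ⟨q₂, hq₂, hq₂0⟩ := Submodule.exists_mem_ne_zero_of_ne_bot hne
    refine ⟨q₂, hq₂0, fun j => ?_, ?_⟩
    · exact (Submodule.mem_orthogonal' K q₂).mp hq₂ _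
        (Submodule.mem_sup_left (Submodule.subset_span ⟨j, rfl⟩))
    · exact (Submodule.mem_orthogonal K q₂).mp hq₂ _
        (Submodule.mem_sup_right (Submodule.mem_span_singleton_self q₁))
  set f₁ : (ι → E d) → E d := fun e => orthPart e q₁ with hf₁
  set f₂ : (ι → E d) → E d := fun e =>
    orthPart e q₂ - (⟪f₁ e, orthPart e q₂⟫ / ‖f₁ e‖ ^ 2) • f₁ e with hf₂
  set ρ : (ι → E d) → ℝ := fun e => Real.sqrt (‖u₀‖ ^ 2 - ‖c e‖ ^ 2) with hρ
  have hf₁₀ : f₁ e₀ = q₁ := orthPart_eq_self hq₁orth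
  have hf₂₀ : f₂ e₀ = q₂ := by
    simp only [hf₂]
    rw [hf₁₀, orthPart_eq_self hq₂orth, hq₂q₁]
    simp
  have hcont₁ : ∀ e, (Matrix.gram ℝ e).det ≠ 0 → ContinuousAt f₁ e := fun e he =>
    continuousAt_orthPart he q₁
  have hcont₂ : ∀ e, (Matrix.gram ℝ e).det ≠ 0 → f₁ e ≠ 0 → ContinuousAt f₂ e := by
    intro e he h1
    have h2 := continuousAt_orthPart he q₂
    have h3 := hcont₁ e he
    refine h2.sub (ContinuousAt.smul ((h3.inner h2).div (h3.norm.pow 2) ?_) h3)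
    exact pow_ne_zero 2 (norm_ne_zero_iff.mpr h1)
  have hcontc : ∀ e, (Matrix.gram ℝ e).det ≠ 0 → ContinuousAt c e := fun e he =>
    continuousAt_gramSolve he hyc
  have hcontρ : ∀ e, (Matrix.gram ℝ e).det ≠ 0 → ContinuousAt ρ e := fun e he =>
    (continuousAt_const.sub ((hcontc e he).norm.pow 2)).sqrt
  have hρ₀ : ρ e₀ = ‖q₁‖ := by
    have h1 : ‖u₀‖ ^ 2 = ‖q₁‖ ^ 2 + ‖c e₀‖ ^ 2 := by
      have h2 : u₀ = q₁ + c e₀ := by rw [hq₁, sub_add_cancel]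
      have h3 : ⟪q₁, c e₀⟫ = 0 := inner_eq_zero_of_mem_span hq₁orth (gramSolve_mem_span _ _)
      conv_lhs => rw [h2]
      rw [norm_add_sq_real, h3]
      ring
    simp only [hρ]
    rw [h1, add_sub_cancel_right, Real.sqrt_sq (norm_nonneg _)]
  have hq₁n : 0 < ‖q₁‖ := norm_pos_iff.mpr hq₁0
  refine ⟨fun e => ⟨c e, ‖f₁ e‖⁻¹ • f₁ e, ‖f₂ e‖⁻¹ • f₂ e, ρ e⟩, ‖q₁‖ / 2, by positivity, ?_, ?_⟩
  · simp only [CircleFrame.eval, Real.cos_zero, Real.sin_zero, one_smul, zero_smul, add_zero]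
    rw [hf₁₀, hρ₀, smul_smul, mul_inv_cancel₀ hq₁n.ne', one_smul, hq₁, add_sub_cancel]
  have ev1 : ∀ᶠ e in 𝓝 e₀, (Matrix.gram ℝ e).det ≠ 0 :=
    continuous_gram.matrix_det.continuousAt.eventually_ne hdet₀
  have ev2 : ∀ᶠ e in 𝓝 e₀, f₁ e ≠ 0 :=
    (hcont₁ e₀ hdet₀).eventually_ne (by rw [hf₁₀]; exact hq₁0)
  have ev3 : ∀ᶠ e in 𝓝 e₀, f₂ e ≠ 0 :=
    (hcont₂ e₀ hdet₀ (by rw [hf₁₀]; exact hq₁0)).eventually_ne (by rw [hf₂₀]; exact hq₂0)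
  have ev4 : ∀ᶠ e in 𝓝 e₀, ‖q₁‖ / 2 < ρ e :=
    (hcontρ e₀ hdet₀).eventually (lt_mem_nhds (by rw [hρ₀]; linarith))
  filter_upwards [ev1, ev2, ev3, ev4] with e h1 h2 h3 h4
  have hn1 : ‖f₁ e‖ ≠ 0 := norm_ne_zero_iff.mpr h2
  have hn2 : ‖f₂ e‖ ≠ 0 := norm_ne_zero_iff.mpr h3
  have o1 : ∀ j, ⟪f₁ e, e j⟫ = 0 := inner_orthPart h1 q₁
  have o2 : ∀ j, ⟪f₂ e, e j⟫ = 0 := by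
    intro j
    simp only [hf₂, inner_sub_left, real_inner_smul_left]
    rw [inner_orthPart h1, o1, mul_zero, sub_zero]
  have o12 : ⟪f₁ e, f₂ e⟫ = 0 := by
    simp only [hf₂, inner_sub_right, real_inner_smul_right]
    rw [real_inner_self_eq_norm_sq, div_mul_cancel₀ _ (pow_ne_zero 2 hn1), sub_self]
  have hρe : 0 < ρ e := lt_trans (by positivity) h4
  have hρsq : ρ e ^ 2 = ‖u₀‖ ^ 2 - ‖c e‖ ^ 2 := by
    refine Real.sq_sqrt ?_
    by_contra hneg
    rw [hρ] at hρe
    simp only at hρe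
    rw [Real.sqrt_eq_zero_of_nonpos (not_le.mp hneg).le] at hρe
    exact lt_irrefl _ hρe
  have hcspan : c e ∈ Submodule.span ℝ (Set.range e) := gramSolve_mem_span _ _
  have hframe : CircleFrame.IsFrame
      ⟨c e, ‖f₁ e‖⁻¹ • f₁ e, ‖f₂ e‖⁻¹ • f₂ e, ρ e⟩ := by
    refine ⟨?_, ?_, ?_, ?_, ?_⟩
    · simp only [norm_smul, norm_inv, norm_norm]; exact inv_mul_cancel₀ hn1
    · simp only [norm_smul, norm_inv, norm_norm]; exact inv_mul_cancel₀ hn2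
    · simp only [real_inner_smul_left, real_inner_smul_right, o12, mul_zero]
    · simp only [real_inner_smul_left, inner_eq_zero_of_mem_span o1 hcspan, mul_zero]
    · simp only [real_inner_smul_left, inner_eq_zero_of_mem_span o2 hcspan, mul_zero]
  have hnorm : ∀ θ, ‖CircleFrame.eval ⟨c e, ‖f₁ e‖⁻¹ • f₁ e, ‖f₂ e‖⁻¹ • f₂ e, ρ e⟩ θ‖ ^ 2 =
      ‖u₀‖ ^ 2 := by
    intro θ
    rw [hframe.norm_sq_eval]
    simp only [hρsq]
    ring
  refine ⟨hframe, h4.le, fun θ => ⟨?_, fun i => ?_⟩, fun θ => ?_⟩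
  · exact (sq_eq_sq₀ (norm_nonneg _) (norm_nonneg _)).mp (hnorm θ)
  · refine (sq_eq_sq₀ (norm_nonneg _) (norm_nonneg _)).mp ?_
    rw [norm_sub_sq_real, hnorm]
    have : ⟪CircleFrame.eval ⟨c e, ‖f₁ e‖⁻¹ • f₁ e, ‖f₂ e‖⁻¹ • f₂ e, ρ e⟩ θ, e i⟫ = y e i := by
      simp only [CircleFrame.eval, inner_add_left, real_inner_smul_left, o1, o2, mul_zero, add_zero]
      exact inner_gramSolve h1 _ i
    rw [this]
    simp only [hy]
    ring
  · have k1 : ContinuousAt (fun p : (ι → E d) × ℝ => c p.1) (e, θ) :=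
      ContinuousAt.comp (g := c) (f := Prod.fst) (x := (e, θ)) (hcontc e h1) continuousAt_fst
    have k2 : ContinuousAt (fun p : (ι → E d) × ℝ => f₁ p.1) (e, θ) :=
      ContinuousAt.comp (g := f₁) (f := Prod.fst) (x := (e, θ)) (hcont₁ e h1) continuousAt_fst
    have k3 : ContinuousAt (fun p : (ι → E d) × ℝ => f₂ p.1) (e, θ) :=
      ContinuousAt.comp (g := f₂) (f := Prod.fst) (x := (e, θ)) (hcont₂ e h1 h2) continuousAt_fst
    have k4 : ContinuousAt (fun p : (ι → E d) × ℝ => ρ p.1) (e, θ) :=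
      ContinuousAt.comp (g := ρ) (f := Prod.fst) (x := (e, θ)) (hcontρ e h1) continuousAt_fst
    have k5 : ContinuousAt (fun p : (ι → E d) × ℝ => Real.cos p.2) (e, θ) := by fun_prop
    have k6 : ContinuousAt (fun p : (ι → E d) × ℝ => Real.sin p.2) (e, θ) := by fun_prop
    exact k1.add (k4.smul ((k5.smul ((k2.norm.inv₀ hn1).smul k2)).add
      (k6.smul ((k3.norm.inv₀ hn2).smul k3))))

end Arc

section Existence

variable {d N : ℕ}

open Topology

/-- The vertices before stage `t` of a flexible configuration near the points `q`, with the
distances of the pairs in `adj` prescribed. -/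
structure PartialConfig (q : Fin N → E d) (adj : Fin N → Fin N → Prop) (t : ℕ) (η : ℝ) where
  /-- the points, as functions of the parameters -/
  point : Fin N → (Fin N → unitInterval) → E d
  /-- the angular speeds -/
  speed : Fin N → ℝ
  /-- a lower bound for the radii -/
  radius : ℝ
  radius_pos : 0 < radius
  speed_pos : ∀ j, 0 < speed j
  speed_le_one : ∀ j, speed j ≤ 1
  continuous_point : ∀ j, Continuous (point j)
  point_zero : ∀ j : Fin N, (j : ℕ) = 0 → ∀ θ, point j θ = 0
  point_update : ∀ i j, j < i → ∀ θ s, point j (Function.update θ i s) = point j θ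
  exists_isArc : ∀ j : Fin N, (j : ℕ) < t → (j : ℕ) ≠ 0 → ∀ θ, ∃ ρ, radius ≤ ρ ∧
    IsArc (speed j) ρ fun s => point j (Function.update θ j s)
  norm_sub_le : ∀ j : Fin N, (j : ℕ) < t → ∀ θ, ‖point j θ - q j‖ ≤ η
  norm_edge : ∀ i j : Fin N, (j : ℕ) < t → i < j → adj i j → ∀ θ,
    ‖point j θ - point i θ‖ = ‖q j - q i‖

/-- The general position data at the vertex `j`: an earlier vertex `i₀` and a set `s` of earlier
vertices that together contain the earlier neighbours of `j`, such that `q j`, `q i₀` and the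
`q i`, `i ∈ s`, are in general position. -/
def IsGeneralAt (q : Fin N → E d) (adj : Fin N → Fin N → Prop) (j : Fin N) : Prop :=
  ∃ (i₀ : Fin N) (s : Finset (Fin N)), i₀ < j ∧ (∀ i ∈ s, i < j) ∧
    (∀ i, i < j → adj i j → i = i₀ ∨ i ∈ s) ∧
    LinearIndependent ℝ (fun i : s => q i - q i₀) ∧
    q j - q i₀ ∉ Submodule.span ℝ (Set.range fun i : s => q i - q i₀) ∧ s.card + 2 ≤ d

/-- Vertices are added one at a time, each on the circle of solutions of its distance constraints;
the earlier ones are kept so close to the model that this circle exists and stays near it. -/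
theorem exists_partialConfig {q : Fin N → E d} {adj : Fin N → Fin N → Prop}
    (hq0 : ∀ j : Fin N, (j : ℕ) = 0 → q j = 0)
    (hgen : ∀ j : Fin N, (j : ℕ) ≠ 0 → IsGeneralAt q adj j) (t : ℕ) (ht : t ≤ N) :
    ∀ η > 0, Nonempty (PartialConfig q adj t η) := by
  induction t with
  | zero =>
    intro η hη
    exact ⟨{
      point := fun _ _ => 0
      speed := fun _ => 1
      radius := 1
      radius_pos := one_pos
      speed_pos := fun _ => one_pos
      speed_le_one := fun _ => le_rfl
      continuous_point := fun _ => continuous_const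
      point_zero := fun _ _ _ => rfl
      point_update := fun _ _ _ _ _ => rfl
      exists_isArc := fun j hj => absurd hj (Nat.not_lt_zero _)
      norm_sub_le := fun j hj => absurd hj (Nat.not_lt_zero _)
      norm_edge := fun i j hj => absurd hj (Nat.not_lt_zero _) }⟩
  | succ t ih =>
    intro η hη
    have htN : t < N := ht
    set k : Fin N := ⟨t, htN⟩ with hk
    have hlt : ∀ j : Fin N, (j : ℕ) < t + 1 → j ≠ k → (j : ℕ) < t := by
      intro j hj hjk
      have : (j : ℕ) ≠ t := fun h => hjk (Fin.ext h)
      omega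
    rcases Nat.eq_zero_or_pos t with ht0 | ht0
    · obtain ⟨Q⟩ := ih (by omega) η hη
      refine ⟨{ Q with
        exists_isArc := fun j hj hj0 => absurd hj0 (by omega)
        norm_sub_le := fun j hj θ => ?_
        norm_edge := fun i j hj hij => absurd (Fin.lt_def.mp hij) (by omega) }⟩
      rw [Q.point_zero j (by omega), hq0 j (by omega), sub_zero, norm_zero]
      exact hη.le
    obtain ⟨i₀, s, hi₀, hs, hadj, hli, hns, hcard⟩ := hgen k (by simp [hk]; omega)
    obtain ⟨C, ρ₁, hρ₁, hC0, hCev⟩ := exists_circleFrame hli hns (by simpa using hcard)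
    set e₀ : s → E d := fun i => q i - q i₀ with he₀
    set u₀ : E d := q k - q i₀ with hu₀
    -- a neighbourhood of the model configuration on which the circle stays close to the model
    obtain ⟨ε₁, hε₁, hball⟩ := Metric.eventually_nhds_iff.mp hCev
    have hcont0 : ContinuousAt (fun p : (s → E d) × ℝ => (C p.1).eval p.2) (e₀, 0) :=
      hCev.self_of_nhds.2.2.2 0
    obtain ⟨ε₂, hε₂, hclose⟩ := Metric.continuousAt_iff.mp hcont0 (η / 2) (by positivity)
    simp only [hC0] at hclose
    obtain ⟨Q⟩ := ih (by omega) (min (η / 2) (min ε₁ ε₂ / 4)) (by positivity)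
    set γ : ℝ := min 1 (ε₂ / 2) with hγ
    have hγ0 : 0 < γ := by positivity
    set e : (Fin N → unitInterval) → s → E d := fun θ i => Q.point i θ - Q.point i₀ θ with he
    have he_close : ∀ θ, dist (e θ) e₀ < min ε₁ ε₂ := by
      intro θ
      have hm : 0 < min ε₁ ε₂ := lt_min hε₁ hε₂
      refine (dist_pi_lt_iff hm).mpr fun i => ?_
      have h1 := (Q.norm_sub_le i (Fin.lt_def.mp (hs i i.2)) θ).trans (min_le_right _ _)
      have h2 := (Q.norm_sub_le i₀ (Fin.lt_def.mp hi₀) θ).trans (min_le_right _ _)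
      rw [dist_eq_norm]
      have h3 : e θ i - e₀ i = (Q.point i θ - q i) - (Q.point i₀ θ - q i₀) := by
        simp only [he, he₀]; abel
      rw [h3]
      refine (norm_sub_le _ _).trans_lt ?_
      linarith
    have hgood := fun θ => hball (lt_of_lt_of_le (he_close θ) (min_le_left _ _))
    set new : (Fin N → unitInterval) → E d := fun θ =>
      Q.point i₀ θ + (C (e θ)).eval (γ * θ k) with hnew
    have he_upd : ∀ i, k ≤ i → ∀ θ x, e (Function.update θ i x) = e θ := by
      intro i hi θ x
      funext l
      simp only [he]
      rw [Q.point_update i l ((hs l l.2).trans_le hi), Q.point_update i i₀ (hi₀.trans_le hi)]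
    have hnewcont : Continuous new := by
      refine (Q.continuous_point i₀).add (continuous_iff_continuousAt.mpr fun θ => ?_)
      have h1 : Continuous fun θ : Fin N → unitInterval => (e θ, γ * (θ k : ℝ)) := by
        refine Continuous.prodMk (continuous_pi fun i => ?_) (by fun_prop)
        exact (Q.continuous_point i).sub (Q.continuous_point i₀)
      exact ContinuousAt.comp (g := fun p : (s → E d) × ℝ => (C p.1).eval p.2)
        (f := fun θ : Fin N → unitInterval => (e θ, γ * (θ k : ℝ))) ((hgood θ).2.2.2 _)
        h1.continuousAt
    refine ⟨{
      point := Function.update Q.point k new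
      speed := Function.update Q.speed k γ
      radius := min Q.radius ρ₁
      radius_pos := lt_min Q.radius_pos hρ₁
      speed_pos := fun j => ?_
      speed_le_one := fun j => ?_
      continuous_point := fun j => ?_
      point_zero := fun j hj θ => ?_
      point_update := fun i j hij θ x => ?_
      exists_isArc := fun j hj hj0 θ => ?_
      norm_sub_le := fun j hj θ => ?_
      norm_edge := fun i j hj hij ha θ => ?_ }⟩
    · by_cases hjk : j = k
      · subst hjk; simpa using hγ0
      · simpa [Function.update_of_ne hjk] using Q.speed_pos j
    · by_cases hjk : j = k
      · subst hjk; simp [hγ]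
      · simpa [Function.update_of_ne hjk] using Q.speed_le_one j
    · by_cases hjk : j = k
      · subst hjk; simpa using hnewcont
      · simpa [Function.update_of_ne hjk] using Q.continuous_point j
    · have hjk : j ≠ k := by rintro rfl; simp [hk] at hj; omega
      rw [Function.update_of_ne hjk]
      exact Q.point_zero j hj θ
    · by_cases hjk : j = k
      · subst hjk
        simp only [Function.update_self, hnew]
        rw [he_upd i hij.le, Q.point_update i i₀ (hi₀.trans hij), Function.update_of_ne hij.ne]
      · rw [Function.update_of_ne hjk]
        exact Q.point_update i j hij θ x
    · by_cases hjk : j = k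
      · subst hjk
        refine ⟨(C (e θ)).radius, (min_le_right _ _).trans (hgood θ).2.1, fun x x' => ?_⟩
        simp only [Function.update_self, hnew]
        rw [he_upd k le_rfl, he_upd k le_rfl, Q.point_update k i₀ hi₀, Q.point_update k i₀ hi₀,
          add_sub_add_left_eq_sub,
          (hgood θ).1.norm_eval_sub (hρ₁.le.trans (hgood θ).2.1), mul_sub]
      · rw [Function.update_of_ne hjk, Function.update_of_ne hjk]
        obtain ⟨ρ, hρ, harc⟩ := Q.exists_isArc j (hlt j hj hjk) hj0 θ
        exact ⟨ρ, (min_le_left _ _).trans hρ, harc⟩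
    · by_cases hjk : j = k
      · subst hjk
        simp only [Function.update_self, hnew]
        have h1 := (Q.norm_sub_le i₀ (Fin.lt_def.mp hi₀) θ).trans (min_le_left _ _)
        have h2 : dist ((C (e θ)).eval (γ * θ k)) u₀ < η / 2 := by
          refine hclose (x := (e θ, γ * (θ k : ℝ))) ?_
          rw [Prod.dist_eq]
          refine max_lt ((he_close θ).trans_le (min_le_right _ _)) ?_
          have h01 := (θ k).2
          simp only [dist_zero_right]
          rw [Real.norm_of_nonneg (mul_nonneg hγ0.le h01.1)]
          have : γ * (θ k : ℝ) ≤ γ * 1 := by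
            have := h01.2
            gcongr
          have : γ ≤ ε₂ / 2 := min_le_right _ _
          linarith
        rw [dist_eq_norm] at h2
        have h3 : Q.point i₀ θ + (C (e θ)).eval (γ * θ k) - q k =
            (Q.point i₀ θ - q i₀) + ((C (e θ)).eval (γ * θ k) - u₀) := by
          rw [hu₀]; abel
        rw [h3]
        refine (norm_add_le _ _).trans ?_
        linarith
      · rw [Function.update_of_ne hjk]
        refine (Q.norm_sub_le j (hlt j hj hjk) θ).trans ((min_le_left _ _).trans ?_)
        linarith
    · by_cases hjk : j = k
      · subst hjk
        rw [Function.update_self, Function.update_of_ne hij.ne]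
        simp only [hnew]
        obtain ⟨hn, hni⟩ := (hgood θ).2.2.1 (γ * θ k)
        rcases hadj i hij ha with rfl | his
        · rw [add_sub_cancel_left, hn]
        · have h1 := hni ⟨i, his⟩
          simp only [he, hu₀, sub_sub_sub_cancel_right] at h1
          rw [← h1]
          congr 1
          abel
      · have hik : i ≠ k := by
          rintro rfl
          have := Fin.lt_def.mp hij
          simp only [hk] at this
          omega
        rw [Function.update_of_ne hjk, Function.update_of_ne hik]
        exact Q.norm_edge i j (hlt j hj hjk) hij ha θ

/-- Points in general position (in the sense of the earlier neighbours) belong to a flexible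
configuration that keeps the lengths of the edges and stays close to them. -/
theorem exists_flexibleConfig {q : Fin N → E d} {adj : Fin N → Fin N → Prop}
    (hq0 : ∀ j : Fin N, (j : ℕ) = 0 → q j = 0)
    (hgen : ∀ j : Fin N, (j : ℕ) ≠ 0 → IsGeneralAt q adj j) {η : ℝ} (hη : 0 < η) :
    ∃ W : FlexibleConfig d N, (∀ j θ, ‖W.point j θ - q j‖ ≤ η) ∧
      ∀ i j, i < j → adj i j → ∀ θ, ‖W.point j θ - W.point i θ‖ = ‖q j - q i‖ := by
  obtain ⟨Q⟩ := exists_partialConfig hq0 hgen N le_rfl η hη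
  refine ⟨{
    point := Q.point
    speed := Q.speed
    radius := Q.radius
    bound := η + ∑ j, ‖q j‖
    radius_pos := Q.radius_pos
    speed_pos := Q.speed_pos
    speed_le_one := Q.speed_le_one
    continuous_point := Q.continuous_point
    norm_point_le := fun j θ => ?_
    point_zero := Q.point_zero
    point_update := Q.point_update
    exists_isArc := fun j => Q.exists_isArc j j.2 }, fun j => Q.norm_sub_le j j.2,
    fun i j => Q.norm_edge i j j.2⟩
  have h1 := Q.norm_sub_le j j.2 θ
  have h2 : ‖q j‖ ≤ ∑ j, ‖q j‖ :=
    Finset.single_le_sum (f := fun j => ‖q j‖) (fun _ _ => norm_nonneg _) (Finset.mem_univ j)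
  have h3 : Q.point j θ = (Q.point j θ - q j) + q j := by abel
  rw [h3]
  exact (norm_add_le _ _).trans (add_le_add h1 h2)

end Existence

/-! ### Flexible configurations of a proper distance graph -/

section Graph

open Topology

theorem exists_linearIsometry {m d : ℕ} (hmd : m ≤ d) : Nonempty (E m →ₗᵢ[ℝ] E d) := by
  have hon : Orthonormal ℝ fun i : Fin m => EuclideanSpace.basisFun (Fin d) ℝ (Fin.castLE hmd i) :=
    (EuclideanSpace.basisFun (Fin d) ℝ).orthonormal.comp _ (Fin.castLE_injective hmd)
  set b := (EuclideanSpace.basisFun (Fin m) ℝ).toBasis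
  set F : E m →ₗ[ℝ] E d := b.constr ℝ fun i => EuclideanSpace.basisFun (Fin d) ℝ (Fin.castLE hmd i)
  refine ⟨F.isometryOfOrthonormal (v := b) ?_ ?_⟩
  · simp only [b, OrthonormalBasis.coe_toBasis]
    exact (EuclideanSpace.basisFun (Fin m) ℝ).orthonormal
  · convert! hon using 1
    ext i
    simp [F]

theorem exists_pos_two_mul_lt_norm_sub {N d : ℕ} {q : Fin N → E d} (hq : Function.Injective q) :
    ∃ η > 0, ∀ i j, i ≠ j → 2 * η < ‖q i - q j‖ := by
  have : ∀ᶠ η : ℝ in 𝓝[>] 0, ∀ i j, i ≠ j → 2 * η < ‖q i - q j‖ := by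
    refine eventually_all.mpr fun i => eventually_all.mpr fun j => ?_
    by_cases hij : i = j
    · simp [hij]
    have hpos : 0 < ‖q i - q j‖ := norm_pos_iff.mpr (sub_ne_zero.mpr (hq.ne hij))
    have hc : Tendsto (fun η : ℝ => 2 * η) (𝓝[>] 0) (𝓝 (2 * 0)) :=
      ((continuous_const.mul continuous_id).tendsto 0).mono_left nhdsWithin_le_nhds
    rw [mul_zero] at hc
    filter_upwards [hc.eventually (gt_mem_nhds hpos)] with η hη _ using hη
  obtain ⟨η, h1, h2⟩ := (this.and self_mem_nhdsWithin).exists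
  exact ⟨η, h2, h1⟩

namespace DistanceGraph

variable {m d : ℕ}

theorem card_verts_pos (Γ : DistanceGraph m) : 0 < Γ.verts.card := by
  obtain ⟨a⟩ := Γ.connected.nonempty
  exact Finset.card_pos.mpr ⟨a, a.2⟩

/-- Distinct points with the right distances along the edges form an isometric copy. -/
theorem hasCopyIn_of_points (Γ : DistanceGraph m) {r : ℝ} {A : Set (E d)} (P : Γ.verts → E d)
    (hinj : Function.Injective P) (hA : ∀ v, P v ∈ A)
    (hdist : ∀ v w, Γ.graph.Adj v w → ‖P v - P w‖ = r * ‖(v : E m) - w‖) :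
    Γ.HasCopyIn r A := by
  classical
  set V' : Finset (E d) := Finset.univ.image P with hV'
  set e : Γ.verts ≃ V' := Equiv.ofBijective
    (fun v => ⟨P v, Finset.mem_image_of_mem P (Finset.mem_univ v)⟩) (by
      constructor
      · intro v w hvw
        exact hinj (Subtype.ext_iff.mp hvw)
      · rintro ⟨y, hy⟩
        obtain ⟨v, -, rfl⟩ := Finset.mem_image.mp hy
        exact ⟨v, rfl⟩) with he
  refine ⟨⟨V', Γ.graph.map e.toEmbedding,
    (SimpleGraph.Iso.map e Γ.graph).connected_iff.mp Γ.connected⟩,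
    ⟨SimpleGraph.Iso.map e Γ.graph, fun v w hvw => hdist v w hvw⟩, ?_⟩
  intro y hy
  obtain ⟨v, -, rfl⟩ := Finset.mem_image.mp (Finset.mem_coe.mp hy)
  exact hA v

/-- A connected graph with an ordering in which every vertex has at most `k` predecessors and
which has at least two vertices has `1 ≤ k`. -/
theorem one_le_of_ncard_predecessors_le (Γ : DistanceGraph m) {k : ℕ}
    (v : Fin Γ.verts.card ≃ Γ.verts) (hv : ∀ j, (Γ.predecessors v j).ncard ≤ k)
    {a b : Γ.verts} (hab : a ≠ b) : 1 ≤ k := by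
  obtain ⟨p⟩ := Γ.connected.preconnected a b
  obtain ⟨c, hac⟩ : ∃ c, Γ.graph.Adj a c := by
    cases p with
    | nil => exact absurd rfl hab
    | cons h _ => exact ⟨_, h⟩
  have key : ∀ i j : Fin Γ.verts.card, i < j → Γ.graph.Adj (v i) (v j) → 1 ≤ k := by
    intro i j hij hadj
    refine le_trans ?_ (hv j)
    have hfin : (Γ.predecessors v j).Finite := by
      refine (Set.finite_range fun i => (v i : E m)).subset ?_
      rintro x ⟨i, -, -, rfl⟩
      exact ⟨i, rfl⟩
    exact (Set.ncard_pos hfin).mpr ⟨v i, i, hij, hadj, rfl⟩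
  have hne : v.symm a ≠ v.symm c := v.symm.injective.ne hac.ne
  rcases lt_or_gt_of_ne hne with h | h
  · exact key _ _ h (by simpa using hac)
  · exact key _ _ h (by simpa using hac.symm)

theorem isGeneralAt_of_affineIndependent (Γ : DistanceGraph m) {k : ℕ} (hkd : k + 1 ≤ d)
    (v : Fin Γ.verts.card ≃ Γ.verts) (hv : ∀ j, (Γ.predecessors v j).ncard ≤ k)
    (F : E m →ₗᵢ[ℝ] E d) (c : E d) (j : Fin Γ.verts.card) (hj : (j : ℕ) ≠ 0)
    (hai : AffineIndependent ℝ
      (fun x : (insert (v j : E m) (Γ.predecessors v j) : Set (E m)) => (x : E m))) :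
    IsGeneralAt (fun i => F (v i) - c) (fun i j => Γ.graph.Adj (v i) (v j)) j := by
  classical
  set q : Fin Γ.verts.card → E d := fun i => F (v i) - c with hq
  have hqinj : Function.Injective q := by
    intro a b hab
    have := F.injective (sub_left_injective hab)
    exact v.injective (Subtype.ext this)
  set S : Finset (Fin Γ.verts.card) :=
    Finset.univ.filter fun i => i < j ∧ Γ.graph.Adj (v i) (v j) with hS
  have hcard : S.card ≤ k := by
    have himg : Γ.predecessors v j = (fun i => (v i : E m)) '' (S : Set (Fin Γ.verts.card)) := by
      ext x
      simp only [predecessors, Set.mem_ofPred_eq, Set.mem_image, Finset.mem_coe, hS,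
        Finset.mem_filter, Finset.mem_univ, true_and]
      constructor
      · rintro ⟨i, h1, h2, rfl⟩; exact ⟨i, ⟨h1, h2⟩, rfl⟩
      · rintro ⟨i, ⟨h1, h2⟩, rfl⟩; exact ⟨i, h1, h2, rfl⟩
    have hvi : Function.Injective fun i => (v i : E m) := Subtype.val_injective.comp v.injective
    have := hv j
    rwa [himg, Set.ncard_image_of_injective _ hvi,
      Set.ncard_coe_finset] at this
  -- without earlier neighbours any earlier vertex serves as `i₀`, and `2 ≤ d`
  rcases S.eq_empty_or_nonempty with hSe | ⟨i₀, hi₀⟩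
  · have h0 : 0 < Γ.verts.card := lt_of_le_of_lt (Nat.zero_le _) j.2
    have hne : (⟨0, h0⟩ : Fin Γ.verts.card) ≠ j := fun h => hj (by rw [← h])
    have hk := Γ.one_le_of_ncard_predecessors_le v hv (v.injective.ne hne)
    refine ⟨⟨0, h0⟩, ∅, lt_of_le_of_ne (Fin.mk_le_of_le_val (Nat.zero_le _)) hne, by simp,
      fun i hi ha => ?_, ?_, ?_, by simpa using by omega⟩
    · have : i ∈ S := by simp [hS, hi, ha]
      rw [hSe] at this
      simp at this
    · exact linearIndependent_empty_type
    · have : Set.range (fun i : (∅ : Finset (Fin Γ.verts.card)) =>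
          q i - q ⟨0, h0⟩) = ∅ := Set.range_eq_empty _
      change q j - q ⟨0, h0⟩ ∉ _
      rw [this, Submodule.span_empty, Submodule.mem_bot, sub_eq_zero]
      exact fun h => hne (hqinj h).symm
  have hi₀' := Finset.mem_filter.mp hi₀
  -- general position, as linear independence of the differences with the vertex `i₀`
  have hmem : ∀ i : Fin Γ.verts.card, i ∈ insert j S →
      (v i : E m) ∈ (insert (v j : E m) (Γ.predecessors v j) : Set (E m)) := by
    intro i hi
    rcases Finset.mem_insert.mp hi with rfl | hi
    · exact Set.mem_insert _ _
    · have := Finset.mem_filter.mp hi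
      exact Set.mem_insert_of_mem _ ⟨i, this.2.1, this.2.2, rfl⟩
  set g : (insert j S : Finset _) ↪ (insert (v j : E m) (Γ.predecessors v j) : Set (E m)) :=
    ⟨fun i => ⟨v i, hmem i i.2⟩, fun a b hab =>
      Subtype.ext (v.injective (Subtype.ext (Subtype.mk.inj hab)))⟩ with hg
  have hai2 : AffineIndependent ℝ fun i : (insert j S : Finset _) => F (v i) :=
    (hai.comp_embedding g).map' F.toLinearMap.toAffineMap F.injective
  have hi₀T : i₀ ∈ insert j S := Finset.mem_insert_of_mem hi₀
  have hli := (affineIndependent_iff_linearIndependent_vsub ℝ _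
    (⟨i₀, hi₀T⟩ : (insert j S : Finset _))).mp hai2
  set φ : Option (S.erase i₀ : Finset _) →
      {x : (insert j S : Finset _) // x ≠ ⟨i₀, hi₀T⟩} := fun o =>
    o.casesOn' ⟨⟨j, Finset.mem_insert_self _ _⟩, fun h =>
        hi₀'.2.1.ne (Subtype.ext_iff.mp h).symm⟩
      fun i => ⟨⟨i, Finset.mem_insert_of_mem (Finset.mem_of_mem_erase i.2)⟩, fun h =>
        Finset.ne_of_mem_erase i.2 (Subtype.ext_iff.mp h)⟩ with hφ
  have hφinj : Function.Injective φ := by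
    have hne : ∀ i : (S.erase i₀ : Finset _), (i : Fin Γ.verts.card) ≠ j := by
      intro i
      exact (Finset.mem_filter.mp (Finset.mem_of_mem_erase i.2)).2.1.ne
    rintro (_ | a) (_ | b) hab
    · rfl
    · exact absurd (Subtype.ext_iff.mp (Subtype.ext_iff.mp hab)).symm (hne b)
    · exact absurd (Subtype.ext_iff.mp (Subtype.ext_iff.mp hab)) (hne a)
    · exact congrArg some (Subtype.ext (congrArg (fun y => (y.1 : Fin Γ.verts.card)) hab))
  have hopt := hli.comp φ hφinj
  have hfun : ((fun i : {x : (insert j S : Finset _) // x ≠ ⟨i₀, hi₀T⟩} =>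
      (F (v i) -ᵥ F (v i₀) : E d)) ∘ φ) = fun o => Option.casesOn' o (q j - q i₀)
        fun i : (S.erase i₀ : Finset _) => q i - q i₀ := by
    funext o
    cases o <;> simp [hφ, hq]
  have hopt2 : LinearIndependent ℝ (fun o => Option.casesOn' o (q j - q i₀)
      fun i : (S.erase i₀ : Finset _) => q i - q i₀) := by
    rw [← hfun]; exact hopt
  obtain ⟨h1, h2⟩ := linearIndependent_option'.mp hopt2
  refine ⟨i₀, S.erase i₀, hi₀'.2.1, fun i hi =>
    (Finset.mem_filter.mp (Finset.mem_of_mem_erase hi)).2.1, fun i hi ha => ?_, h1, h2, ?_⟩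
  · by_cases h : i = i₀
    · exact Or.inl h
    · exact Or.inr (Finset.mem_erase.mpr ⟨h, by simp [hS, hi, ha]⟩)
  · rw [Finset.card_erase_of_mem hi₀]
    have := Finset.card_pos.mpr ⟨i₀, hi₀⟩
    omega

/-- A proper `k`-degenerate distance graph has a flexible configuration in `ℝᵈ`, `k < d`, whose
dilates are isometric copies of the dilates of the graph. -/
theorem exists_flexibleConfig (Γ : DistanceGraph m) {k : ℕ} (hmd : m ≤ d) (hkd : k + 1 ≤ d)
    (hΓ : Γ.IsProper k) :
    ∃ W : FlexibleConfig d Γ.verts.card, ∀ r : ℝ, 0 < r → ∀ A : Set (E d), ∀ x z,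
      (∀ j, x + W.moved r j z ∈ A) → Γ.HasCopyIn r A := by
  obtain ⟨v, hv⟩ := hΓ
  obtain ⟨F⟩ := exists_linearIsometry hmd
  have hN := Γ.card_verts_pos
  set c : E d := F (v ⟨0, hN⟩) with hc
  set q : Fin Γ.verts.card → E d := fun i => F (v i) - c with hq
  have hqinj : Function.Injective q := by
    intro a b hab
    have := F.injective (sub_left_injective hab)
    exact v.injective (Subtype.ext this)
  have hq0 : ∀ j : Fin Γ.verts.card, (j : ℕ) = 0 → q j = 0 := by
    intro j hj
    have : j = ⟨0, hN⟩ := Fin.ext hj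
    rw [this, hq]
    simp [hc]
  obtain ⟨η, hη, hsep⟩ := exists_pos_two_mul_lt_norm_sub hqinj
  obtain ⟨W, hW1, hW2⟩ := _root_.exists_flexibleConfig hq0 (fun j hj =>
    Γ.isGeneralAt_of_affineIndependent hkd v (fun j => (hv j).1) F c j hj (hv j).2) hη
  refine ⟨W, fun r hr A x z hA => ?_⟩
  have hdiff : ∀ i j, ‖(x + W.moved r i z) - (x + W.moved r j z)‖ =
      r * ‖W.point i z.2 - W.point j z.2‖ := by
    intro i j
    rw [add_sub_add_left_eq_sub, FlexibleConfig.moved, FlexibleConfig.moved, ← map_sub,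
      LinearIsometryEquiv.norm_map, ← smul_sub, norm_smul, Real.norm_of_nonneg hr.le]
  have hedge : ∀ i j, Γ.graph.Adj (v i) (v j) →
      ‖W.point i z.2 - W.point j z.2‖ = ‖(v i : E m) - v j‖ := by
    have hqF : ∀ i j, ‖q i - q j‖ = ‖(v i : E m) - v j‖ := by
      intro i j
      rw [hq]
      simp only [sub_sub_sub_cancel_right]
      rw [← map_sub, F.norm_map]
    intro i j hadj
    have hne : i ≠ j := fun h => hadj.ne (congrArg v h)
    rcases lt_or_gt_of_ne hne with h | h
    · rw [norm_sub_rev, hW2 i j h hadj z.2, norm_sub_rev, hqF]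
    · rw [hW2 j i h hadj.symm z.2, hqF]
  refine Γ.hasCopyIn_of_points (fun a => x + W.moved r (v.symm a) z) ?_ (fun a => hA _) ?_
  · intro a b hab
    by_contra hne
    have hne' : v.symm a ≠ v.symm b := v.symm.injective.ne hne
    have h1 := hdiff (v.symm a) (v.symm b)
    simp only at hab
    rw [hab, sub_self, norm_zero, eq_comm, mul_eq_zero] at h1
    have h2 : W.point (v.symm a) z.2 = W.point (v.symm b) z.2 :=
      sub_eq_zero.mp (norm_eq_zero.mp (h1.resolve_left hr.ne'))
    have h3 := hsep _ _ hne'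
    have h4 := hW1 (v.symm a) z.2
    have h5 := hW1 (v.symm b) z.2
    have h6 : q (v.symm a) - q (v.symm b) = (W.point (v.symm b) z.2 - q (v.symm b)) -
        (W.point (v.symm a) z.2 - q (v.symm a)) := by
      rw [h2]; abel
    rw [h6] at h3
    have h7 := norm_sub_le (W.point (v.symm b) z.2 - q (v.symm b))
      (W.point (v.symm a) z.2 - q (v.symm a))
    linarith
  · intro a b hab
    rw [hdiff, hedge _ _ (by simpa using hab)]
    simp

end DistanceGraph

end Graph

/-! ### Good scales among widely separated ones -/

section Scales

variable {d N : ℕ}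

/-- The ratio `q = τ ^ (2 * d + 1) / B` makes the chord error comparable to `τ`. -/
theorem exists_four_mul_chordError_le {d : ℕ} (γ : Fin N → ℝ) (hγ : ∀ k, 0 < γ k) :
    ∃ B : ℝ, 1 ≤ B ∧ ∀ τ, 0 < τ → ∀ k, 4 * chordError d (γ k) τ (τ ^ (2 * d + 1) / B) ≤ 8 * τ := by
  set D : Fin N → ℝ := fun k => 2 * 3 ^ (d - 1) * ((d + 1) * 2 ^ d * 2 ^ (2 * d) / γ k ^ (2 * d))
    with hD
  have hD0 : ∀ k, 0 ≤ D k := fun k => by have := hγ k; simp only [hD]; positivity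
  refine ⟨1 + ∑ k, D k, by linarith [Finset.sum_nonneg fun k (_ : k ∈ Finset.univ) => hD0 k],
    fun τ hτ k => ?_⟩
  set B := 1 + ∑ k, D k with hB
  have hDB : D k ≤ B := by
    have := Finset.single_le_sum (fun k _ => hD0 k) (Finset.mem_univ k)
    linarith
  have hBpos : 0 < B := by
    linarith [Finset.sum_nonneg fun k (_ : k ∈ Finset.univ) => hD0 k]
  have hγk := hγ k
  have h1 : chordError d (γ k) τ (τ ^ (2 * d + 1) / B) = τ + τ * (D k / B) := by
    unfold chordError
    simp only [hD]
    rw [← pow_mul, mul_comm d 2, div_pow, mul_pow, pow_succ]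
    field_simp
  rw [h1]
  have h2 : D k / B ≤ 1 := (div_le_one hBpos).mpr hDB
  nlinarith

/-- Among sufficiently many, sufficiently separated scales `r j ≈ 2 ^ (-l j)` there is one at which
a moved copy of the configuration lies in the support of `f`. The required number of scales and
separation are polynomial in the density `δ`, and the number has exponent `2 * N`. -/
theorem FlexibleConfig.exists_scale_forall_ne_zero (W : FlexibleConfig d N) (hN : 0 < N)
    (hd : 0 < d) :
    ∃ C : ℝ, 1 ≤ C ∧ ∃ K : ℕ, ∀ δ : ℝ, 0 < δ → δ ≤ 1 → ∀ p J : ℕ, C / δ ^ K ≤ 2 ^ p →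
      C / δ ^ (2 * N) ≤ J → ∀ (l : ℕ → ℕ) (r : ℕ → ℝ), (∀ j < J, p ≤ l j) →
      (∀ j, j + 1 < J → l j + 2 * p ≤ l (j + 1)) →
      (∀ j < J, (2 ^ l j : ℝ)⁻¹ ≤ r j ∧ r j ≤ 2 * (2 ^ l j : ℝ)⁻¹) →
      ∀ f : E d → ℝ, IsCubeDensity f → δ ≤ ∫ x, f x →
        ∃ j < J, ∃ x z, ∀ i, f (x + W.moved (r j) i z) ≠ 0 := by
  obtain ⟨B, hB1, hB⟩ := exists_four_mul_chordError_le (d := d) W.speed W.speed_pos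
  have hB0 : 0 < B := by linarith
  have hN0 : (1 : ℝ) ≤ N := by exact_mod_cast hN
  have hd0 : (0 : ℝ) < d := by exact_mod_cast hd
  have hρ := W.radius_pos
  have hR : 0 ≤ W.bound := (norm_nonneg _).trans (W.norm_point_le ⟨0, hN⟩ 0)
  set C₁ : ℝ := 4 * N * d * W.bound with hC₁
  set C₂ : ℝ := d * B * (128 * N ^ 2) ^ (2 * d + 1) / W.radius with hC₂
  have hC₁0 : 0 ≤ C₁ := by positivity
  have hC₂0 : 0 ≤ C₂ := by positivity
  refine ⟨C₁ + C₂ + 16 * N ^ 2 + 1, by nlinarith, 2 * N * (2 * d + 1), ?_⟩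
  intro δ hδ hδ1 p J hp hJ l r hpl hsep hr f hf hδf
  set C := C₁ + C₂ + 16 * N ^ 2 + 1 with hC
  -- the `N` errors `2 * η` of the count use up half of the main term `δ ^ N`
  set η : ℝ := δ ^ N / (4 * N) with hη_def
  have hη : 0 < η := by positivity
  have hη2 : η ^ 2 = δ ^ (2 * N) / (16 * N ^ 2) := by
    rw [hη_def, div_pow, ← pow_mul, mul_comm N 2]; ring
  set τ : ℝ := η ^ 2 / 8 with hτ_def
  have hτ : 0 < τ := by positivity
  have hδN : δ ^ N ≤ 1 := pow_le_one₀ hδ.le hδ1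
  have hη1 : η ≤ 1 := by
    rw [hη_def, div_le_one (by positivity)]; linarith
  have hτ1 : τ ≤ 1 := by
    have : η ^ 2 ≤ 1 := pow_le_one₀ hη.le hη1
    linarith
  have hJ0 : 0 < J := by
    have : (0 : ℝ) < J := lt_of_lt_of_le (by positivity) hJ
    exact_mod_cast this
  obtain ⟨j, hj, hmid⟩ := hf.exists_integral_sq_cellAvg_sub_le hJ0 (fun j => l j - p)
    (fun j => l j + p) (fun j _ => by omega) (fun j hj => by
      have := hsep j hj
      have := hpl (j + 1) hj
      omega)
  have h2p : (0 : ℝ) < 2 ^ p := by positivity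
  have h2l : (0 : ℝ) < 2 ^ l j := by positivity
  have hrj : 0 < r j := lt_of_lt_of_le (by positivity) (hr j hj).1
  refine ⟨j, hj, W.exists_forall_ne_zero hf hN hd hrj hτ hτ1 (q := τ ^ (2 * d + 1) / B)
    (b := l j + p) (a := l j - p) (by positivity) ?_ ?_ hη (fun k => ?_) ?_ hδ.le hδf ?_⟩
  · rw [div_le_one hB0]
    exact (pow_le_one₀ hτ.le hτ1).trans hB1
  · have h1 : C₂ / δ ^ (2 * N * (2 * d + 1)) ≤ 2 ^ p := by
      refine le_trans ?_ hp
      gcongr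
      nlinarith
    have h3 : τ = δ ^ (2 * N) / (128 * N ^ 2) := by rw [hτ_def, hη2]; field_simp; norm_num
    have h4 : C₂ / δ ^ (2 * N * (2 * d + 1)) = d / (τ ^ (2 * d + 1) / B * W.radius) := by
      rw [h3, hC₂, div_pow, ← pow_mul]
      field_simp
    rw [h4, div_le_iff₀ (by positivity)] at h1
    rw [pow_add, mul_inv]
    calc (d : ℝ) * ((2 ^ l j)⁻¹ * (2 ^ p)⁻¹) = (2 ^ l j)⁻¹ * (d * (2 ^ p)⁻¹) := by ring
      _ ≤ r j * (τ ^ (2 * d + 1) / B * W.radius) := by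
          refine mul_le_mul (hr j hj).1 ?_ (by positivity) hrj.le
          rw [← div_eq_mul_inv, div_le_iff₀ h2p]
          linarith
      _ = _ := by ring
  · have := hB τ hτ k
    linarith
  · refine hmid.trans ?_
    rw [hη2, one_div, inv_le_comm₀ (by exact_mod_cast hJ0) (by positivity), inv_div]
    refine le_trans ?_ hJ
    gcongr
    linarith
  · have h1 : C / δ ^ N ≤ 2 ^ p := by
      refine le_trans ?_ hp
      have : δ ^ (2 * N * (2 * d + 1)) ≤ δ ^ N := by
        refine pow_le_pow_of_le_one hδ.le hδ1 ?_
        nlinarith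
      gcongr
    rw [div_le_iff₀ (by positivity)] at h1
    have h2 : C₁ < 2 ^ p * δ ^ N := lt_of_lt_of_le (by nlinarith) h1
    have h3 : (2 : ℝ) ^ (l j - p) = 2 ^ l j / 2 ^ p := by
      rw [eq_div_iff h2p.ne', ← pow_add, Nat.sub_add_cancel (hpl j hj)]
    have h4 : (2 : ℝ) ^ (l j - p) * r j ≤ 2 / 2 ^ p := by
      rw [h3, div_mul_eq_mul_div]
      have := (hr j hj).2
      gcongr
      calc (2 : ℝ) ^ l j * r j ≤ 2 ^ l j * (2 * (2 ^ l j)⁻¹) := by gcongr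
        _ = 2 := by field_simp
    have h5 : (N : ℝ) * (2 * η) = δ ^ N / 2 := by rw [hη_def]; field_simp; norm_num
    have h6 : (N : ℝ) * (d * 2 ^ (l j - p) * (r j * W.bound)) < δ ^ N / 2 := by
      calc (N : ℝ) * (d * 2 ^ (l j - p) * (r j * W.bound))
          = N * d * W.bound * (2 ^ (l j - p) * r j) := by ring
        _ ≤ N * d * W.bound * (2 / 2 ^ p) := by gcongr
        _ = C₁ / 2 ^ p / 2 := by rw [hC₁]; ring
        _ < δ ^ N / 2 := by
            gcongr
            rw [div_lt_iff₀ h2p]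
            linarith
    rw [mul_add]
    linarith

end Scales

/-! ### Cubes of large density -/

section Cubes

variable {d : ℕ}

theorem volume_unitCube : volume (unitCube d) = 1 := by
  have : unitCube d = WithLp.ofLp ⁻¹' (Set.univ.pi fun _ : Fin d => Set.Icc (0 : ℝ) 1) := by
    ext y
    simp only [unitCube, Set.mem_ofPred_eq, Set.mem_preimage, Set.mem_univ_pi, Set.mem_Icc]
  rw [this, (PiLp.volume_preserving_ofLp (Fin d)).measure_preimage
    (MeasurableSet.univ_pi fun i => measurableSet_Icc).nullMeasurableSet, volume_pi_pi]
  simp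

theorem halfOpenCube_ae_eq_unitCube : halfOpenCube d =ᵐ[volume] unitCube d :=
  ae_eq_of_subset_of_measure_ge (fun _ hx i => ⟨(hx i).1, (hx i).2.le⟩)
    (by rw [volume_unitCube, volume_halfOpenCube]) measurableSet_halfOpenCube.nullMeasurableSet
    (by simp [volume_unitCube])

/-- The similarity that maps the unit cube onto `cube t M`. -/
noncomputable def cubeMap (t : E d) (M : ℝ) (x : E d) : E d :=
  M • x + (t - WithLp.toLp 2 fun _ => M / 2)

theorem volume_preimage_cubeMap (t : E d) {M : ℝ} (hM : 0 < M) (S : Set (E d)) :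
    volume (cubeMap t M ⁻¹' S) = ENNReal.ofReal (M ^ d)⁻¹ * volume S := by
  have : cubeMap t M ⁻¹' S =
      (fun x => M • x) ⁻¹' ((fun x => x + (t - WithLp.toLp 2 fun _ => M / 2)) ⁻¹' S) := rfl
  rw [this, Measure.addHaar_preimage_smul _ hM.ne', measure_preimage_add_right,
    abs_of_pos (by positivity)]
  simp

theorem preimage_cubeMap_cube (t : E d) {M : ℝ} (hM : 0 < M) :
    cubeMap t M ⁻¹' cube t M = unitCube d := by
  ext x
  simp only [cubeMap, cube, unitCube, Set.mem_preimage, Set.mem_ofPred_eq, PiLp.add_apply,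
    PiLp.smul_apply, PiLp.sub_apply, smul_eq_mul]
  refine forall_congr' fun i => ?_
  rw [show M * x i + (t i - M / 2) - t i = M * x i - M / 2 by ring, abs_le]
  constructor
  · rintro ⟨h1, h2⟩
    constructor <;> nlinarith
  · rintro ⟨h1, h2⟩
    constructor <;> nlinarith

/-- The density of a set in a cube, as the measure of a rescaled set in the unit cube. -/
theorem volume_inter_cube_div (A : Set (E d)) (t : E d) {M : ℝ} (hM : 0 < M) :
    volume (A ∩ cube t M) / volume (cube (0 : E d) M) =
      volume (cubeMap t M ⁻¹' A ∩ unitCube d) := by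
  have h0 : ENNReal.ofReal (M ^ d)⁻¹ ≠ 0 := by
    rw [Ne, ENNReal.ofReal_eq_zero, not_le]; positivity
  have h1 := volume_preimage_cubeMap (0 : E d) hM (cube 0 M)
  rw [preimage_cubeMap_cube _ hM, volume_unitCube] at h1
  have h2 := volume_preimage_cubeMap t hM (A ∩ cube t M)
  rw [Set.preimage_inter, preimage_cubeMap_cube _ hM] at h2
  rw [h2, ENNReal.div_eq_inv_mul, ← ENNReal.eq_inv_of_mul_eq_one_left h1.symm]

end Cubes

/-! ### Copies in sets of positive density -/

section Copies

variable {d N : ℕ}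

/-- The set version of `exists_scale_forall_ne_zero`. -/
theorem FlexibleConfig.exists_scale_forall_mem (W : FlexibleConfig d N) (hN : 0 < N)
    (hd : 0 < d) :
    ∃ C : ℝ, 1 ≤ C ∧ ∃ K : ℕ, ∀ δ : ℝ, 0 < δ → δ ≤ 1 → ∀ p J : ℕ, C / δ ^ K ≤ 2 ^ p →
      C / δ ^ (2 * N) ≤ J → ∀ (l : ℕ → ℕ) (r : ℕ → ℝ), (∀ j < J, p ≤ l j) →
      (∀ j, j + 1 < J → l j + 2 * p ≤ l (j + 1)) →
      (∀ j < J, (2 ^ l j : ℝ)⁻¹ ≤ r j ∧ r j ≤ 2 * (2 ^ l j : ℝ)⁻¹) →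
      ∀ A : Set (E d), NullMeasurableSet A volume → ENNReal.ofReal δ ≤ volume (A ∩ unitCube d) →
        ∃ j < J, ∃ x z, ∀ i, x + W.moved (r j) i z ∈ A := by
  obtain ⟨C, hC, K, h⟩ := W.exists_scale_forall_ne_zero hN hd
  refine ⟨C, hC, K, fun δ hδ hδ1 p J hp hJ l r hl hsep hr A hA hδA => ?_⟩
  obtain ⟨B, hBA, hB, hBae⟩ := (hA.inter
    (measurableSet_halfOpenCube (d := d)).nullMeasurableSet).exists_measurable_subset_ae_eq
  have hvol : volume (A ∩ unitCube d) = volume B :=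
    (measure_congr (hBae.trans ((ae_eq_refl A).inter halfOpenCube_ae_eq_unitCube))).symm
  have hfin : volume B ≠ ⊤ := by
    refine ne_top_of_le_ne_top ?_ (measure_mono (hBA.trans Set.inter_subset_right))
    simp [volume_halfOpenCube]
  have hf : IsCubeDensity (B.indicator fun _ => (1 : ℝ)) :=
    { measurable := measurable_const.indicator hB
      nonneg := fun x => Set.indicator_nonneg (fun _ _ => zero_le_one) x
      le_one := fun x => Set.indicator_le_self' (fun _ _ => zero_le_one) x
      eq_zero := fun x hx => Set.indicator_of_notMem (fun h => hx (hBA h).2) _ }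
  obtain ⟨j, hj, x, z, hxz⟩ := h δ hδ hδ1 p J hp hJ l r hl hsep hr _ hf (by
    rw [integral_indicator_const _ hB, smul_eq_mul, mul_one]
    rw [hvol] at hδA
    exact (ENNReal.ofReal_le_iff_le_toReal hfin).mp hδA)
  exact ⟨j, hj, x, z, fun i => (hBA (Set.mem_of_indicator_ne_zero (hxz i))).1⟩

theorem exists_inv_two_pow_le {s : ℝ} (hs : 0 < s) (hs1 : s ≤ 1) :
    ∃ l : ℕ, (2 ^ l : ℝ)⁻¹ < s ∧ s ≤ 2 * (2 ^ l : ℝ)⁻¹ := by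
  obtain ⟨n, h1, h2⟩ := exists_nat_pow_near ((one_le_inv₀ hs).mpr hs1) one_lt_two
  refine ⟨n + 1, (inv_lt_comm₀ hs (by positivity)).mp h2, ?_⟩
  have := (le_inv_comm₀ (by positivity) hs).mp h1
  rw [pow_succ, mul_inv]
  linarith

/-- The scales may be any lacunary sequence: each lies in some dyadic interval. -/
theorem FlexibleConfig.exists_lacunary_forall_mem (W : FlexibleConfig d N) (hN : 0 < N)
    (hd : 0 < d) {δ : ℝ} (hδ : 0 < δ) (hδ1 : δ ≤ 1) :
    ∃ p J : ℕ, ∀ s : ℕ → ℝ, (∀ j < J, 0 < s j ∧ s j ≤ (2 ^ p : ℝ)⁻¹) →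
      (∀ j, j + 1 < J → 2 ^ (2 * p + 1) * s (j + 1) ≤ s j) →
      ∀ A : Set (E d), NullMeasurableSet A volume → ENNReal.ofReal δ ≤ volume (A ∩ unitCube d) →
        ∃ j < J, ∃ x z, ∀ i, x + W.moved (s j) i z ∈ A := by
  obtain ⟨C, hC, K, h⟩ := W.exists_scale_forall_mem hN hd
  obtain ⟨p, hp⟩ := pow_unbounded_of_one_lt (C / δ ^ K) one_lt_two
  obtain ⟨J, hJ⟩ := exists_nat_ge (C / δ ^ (2 * N))
  refine ⟨p, J, fun s hs hsep A hA hδA => ?_⟩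
  have hl : ∀ j, ∃ l : ℕ, j < J → (2 ^ l : ℝ)⁻¹ < s j ∧ s j ≤ 2 * (2 ^ l : ℝ)⁻¹ := by
    intro j
    by_cases hj : j < J
    · obtain ⟨l, hl⟩ := exists_inv_two_pow_le (hs j hj).1
        ((hs j hj).2.trans (inv_le_one_of_one_le₀ (one_le_pow₀ one_le_two)))
      exact ⟨l, fun _ => hl⟩
    · exact ⟨0, fun h => absurd h hj⟩
  choose l hl using hl
  have hlt : ∀ {a b : ℕ}, (2 ^ b : ℝ)⁻¹ < (2 ^ a : ℝ)⁻¹ → a < b := by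
    intro a b hab
    have := (inv_lt_inv₀ (by positivity) (by positivity)).mp hab
    exact (pow_lt_pow_iff_right₀ one_lt_two).mp this
  refine h δ hδ hδ1 p J hp.le hJ l s (fun j hj => ?_) (fun j hj => ?_)
    (fun j hj => ⟨(hl j hj).1.le, (hl j hj).2⟩) A hA hδA
  · exact (hlt ((hl j hj).1.trans_le (hs j hj).2)).le
  · refine (hlt (a := l j + 2 * p) ?_).le
    have h1 := hsep j hj
    have h2 := (hl (j + 1) hj).1
    have h3 := (hl j (by omega)).2
    rw [pow_succ] at h1
    rw [pow_add, mul_inv, ← div_eq_mul_inv, lt_div_iff₀ (by positivity)]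
    have h4 : (2 ^ l (j + 1) : ℝ)⁻¹ * 2 ^ (2 * p) < s (j + 1) * 2 ^ (2 * p) := by gcongr
    linarith

/-- In a set of positive upper Banach density all large dilates of the configuration occur. -/
theorem FlexibleConfig.exists_forall_ge_forall_mem (W : FlexibleConfig d N) (hN : 0 < N)
    (hd : 0 < d) {A : Set (E d)} (hA : NullMeasurableSet A volume)
    (hpos : 0 < upperBanachDensity A) :
    ∃ r₀ : ℝ, 0 < r₀ ∧ ∀ r, r₀ ≤ r → ∃ x z, ∀ i, x + W.moved r i z ∈ A := by
  obtain ⟨B, hBA, hB, hBae⟩ := hA.exists_measurable_subset_ae_eq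
  obtain ⟨c, hc0, hc⟩ := exists_between hpos
  have hc_top : c ≠ ⊤ := ne_top_of_lt hc
  obtain ⟨δ, hδ, hδ1, hδc⟩ : ∃ δ : ℝ, 0 < δ ∧ δ ≤ 1 ∧ ENNReal.ofReal δ ≤ c := by
    have h0 := ENNReal.toReal_pos hc0.ne' hc_top
    refine ⟨min c.toReal 1, lt_min h0 one_pos, min_le_right _ _, ?_⟩
    rw [ENNReal.ofReal_le_iff_le_toReal hc_top]
    exact min_le_left _ _
  obtain ⟨p, J, hpJ⟩ := W.exists_lacunary_forall_mem hN hd hδ hδ1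
  by_contra! hcon
  -- a lacunary sequence of scales at which no copy exists
  choose! b hb1 hb2 using hcon
  set R : ℕ → ℝ := fun n => Nat.rec (b 1) (fun _ y => b (2 ^ (2 * p + 1) * y)) n with hR
  have hRpos : ∀ n, 0 < R n := by
    intro n
    induction n with
    | zero => exact lt_of_lt_of_le one_pos (hb1 1 one_pos)
    | succ n ih =>
      have : 0 < 2 ^ (2 * p + 1) * R n := by positivity
      exact this.trans_le (hb1 _ this)
  have hRsucc : ∀ n, 2 ^ (2 * p + 1) * R n ≤ R (n + 1) := fun n =>
    hb1 _ (mul_pos (by positivity) (hRpos n))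
  have hRbad : ∀ n x z, ∃ i, x + W.moved (R n) i z ∉ A := by
    intro n
    cases n with
    | zero => exact hb2 1 one_pos
    | succ n => exact hb2 _ (mul_pos (by positivity) (hRpos n))
  obtain ⟨M, hM, hM0, hMR⟩ := ((frequently_lt_of_lt_limsup (h := hc)).and_eventually
    ((eventually_gt_atTop (0 : ℝ)).and ((Finset.range J).eventually_all.mpr fun n _ =>
      eventually_ge_atTop (2 ^ p * R n)))).exists
  obtain ⟨t, ht⟩ := lt_iSup_iff.mp hM
  rw [volume_inter_cube_div _ _ hM0] at ht
  have hBcube : ENNReal.ofReal δ ≤ volume (cubeMap t M ⁻¹' B ∩ unitCube d) := by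
    refine hδc.trans (ht.le.trans (le_of_eq ?_))
    rw [← volume_inter_cube_div _ _ hM0, ← volume_inter_cube_div _ _ hM0,
      measure_congr (hBae.symm.inter (ae_eq_refl (cube t M)))]
  have hmeas : Measurable (cubeMap t M) := by unfold cubeMap; fun_prop
  -- rescaled into the unit cube and listed in decreasing order, these scales are admissible
  obtain ⟨j, hj, x, z, hxz⟩ := hpJ (fun j => R (J - 1 - j) / M) (fun j hj => ⟨div_pos (hRpos _) hM0,
    by
      rw [← one_div, div_le_div_iff₀ hM0 (by positivity)]
      have := hMR (J - 1 - j) (Finset.mem_range.mpr (by omega))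
      linarith⟩) (fun j hj => by
      have := hRsucc (J - 1 - (j + 1))
      rw [show J - 1 - (j + 1) + 1 = J - 1 - j by omega] at this
      rw [← mul_div_assoc]
      gcongr) _ (hmeas hB).nullMeasurableSet hBcube
  obtain ⟨i, hi⟩ := hRbad (J - 1 - j) (cubeMap t M x) z
  refine hi (hBA ?_)
  have h1 := hxz i
  have h2 : cubeMap t M (x + W.moved (R (J - 1 - j) / M) i z) =
      cubeMap t M x + W.moved (R (J - 1 - j)) i z := by
    have : M • W.moved (R (J - 1 - j) / M) i z = W.moved (R (J - 1 - j)) i z := by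
      rw [moved, moved, ← map_smul, smul_smul, mul_div_cancel₀ _ hM0.ne']
    rw [cubeMap, cubeMap, smul_add, this]
    abel
  rw [← h2]
  exact h1

/-- In a subset of the unit cube the dilates of the configuration occur for an interval of
scales. With `J ≈ δ ^ (-2 * N)` windows of `p ≈ δ⁻¹` dyadic scales each, the interval has length at
least `2 ^ (-2 * p * J)`, whence the exponent `2 * N + 1 ≤ 3 * N`. -/
theorem FlexibleConfig.exists_Icc_forall_mem (W : FlexibleConfig d N) (hN : 0 < N) (hd : 0 < d) :
    ∃ C : ℝ, 0 < C ∧ ∀ A : Set (E d), NullMeasurableSet A volume → A ⊆ unitCube d →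
      0 < volume A → ∃ a b : ℝ, 0 < a ∧
        Real.exp (-(C * (volume.real A) ^ (-(3 * (N : ℝ))))) ≤ b - a ∧
        ∀ r ∈ Set.Icc a b, ∃ x z, ∀ i, x + W.moved r i z ∈ A := by
  obtain ⟨C, hC, K, h⟩ := W.exists_scale_forall_mem hN hd
  refine ⟨8 * (K + 1) * C ^ 2, by positivity, fun A hA hAc hApos => ?_⟩
  have hA1 : volume A ≤ 1 := (measure_mono hAc).trans volume_unitCube.le
  set δ := volume.real A with hδ_def
  have hδ : 0 < δ := ENNReal.toReal_pos hApos.ne' (ne_top_of_le_ne_top ENNReal.one_ne_top hA1)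
  have hδ1 : δ ≤ 1 := ENNReal.toReal_le_of_le_ofReal zero_le_one (by simpa using hA1)
  have hδA : ENNReal.ofReal δ ≤ volume (A ∩ unitCube d) := by
    rw [Set.inter_eq_left.mpr hAc]
    exact ENNReal.ofReal_toReal_le
  -- the crude bound `C / δ ≤ 2 ^ n` avoids a logarithm
  set n := ⌈C / δ⌉₊ with hn
  set p := (K + 1) * n with hp
  set J := ⌈C / δ ^ (2 * N)⌉₊ with hJ
  have hceil : ∀ y : ℝ, 1 ≤ y → (⌈y⌉₊ : ℝ) ≤ 2 * y := by
    intro y hy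
    have := Nat.ceil_lt_add_one (zero_le_one.trans hy)
    linarith
  have hone : ∀ k : ℕ, 1 ≤ C / δ ^ k := fun k => by
    rw [one_le_div (by positivity)]
    exact (pow_le_one₀ hδ.le hδ1).trans hC
  have hp2 : C / δ ^ K ≤ 2 ^ p := by
    calc C / δ ^ K ≤ C ^ (K + 1) / δ ^ (K + 1) := by
          refine div_le_div₀ (by positivity) (le_self_pow₀ hC (Nat.succ_ne_zero K)) (by positivity)
            (pow_le_pow_of_le_one hδ.le hδ1 (Nat.le_succ K))
      _ = (C / δ) ^ (K + 1) := (div_pow _ _ _).symm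
      _ ≤ ((2 : ℝ) ^ n) ^ (K + 1) := by
          have h1 : C / δ ≤ n := Nat.le_ceil _
          have h2 : (n : ℝ) < 2 ^ n := by exact_mod_cast Nat.lt_two_pow_self
          have h3 : C / δ ≤ 2 ^ n := h1.trans h2.le
          gcongr
      _ = 2 ^ p := by rw [← pow_mul, hp, mul_comm]
  have hpJ : ((p * (2 * J) : ℕ) : ℝ) ≤ 8 * (K + 1) * C ^ 2 * δ ^ (-(3 * (N : ℝ))) := by
    have h1 : (n : ℝ) ≤ 2 * (C / δ) := hceil _ (by simpa using hone 1)
    have h2 : (J : ℝ) ≤ 2 * (C / δ ^ (2 * N)) := hceil _ (hone _)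
    have h3 : δ ^ (-(3 * (N : ℝ))) = (δ ^ (3 * N))⁻¹ := by
      rw [Real.rpow_neg hδ.le, ← Real.rpow_natCast]
      push_cast
      rfl
    have h4 : (δ * δ ^ (2 * N))⁻¹ ≤ (δ ^ (3 * N))⁻¹ := by
      rw [← pow_succ']
      exact inv_anti₀ (by positivity) (pow_le_pow_of_le_one hδ.le hδ1 (by omega))
    rw [h3, hp]
    push_cast
    calc ((K : ℝ) + 1) * n * (2 * J) ≤ (K + 1) * (2 * (C / δ)) * (2 * (2 * (C / δ ^ (2 * N)))) := by
          gcongr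
      _ = 8 * (K + 1) * C ^ 2 * (δ * δ ^ (2 * N))⁻¹ := by field_simp; norm_num
      _ ≤ _ := by gcongr
  by_contra! hcon
  -- every dyadic interval of scales contains a scale at which there is no copy
  have hbad : ∀ j, ∃ r, j < J → ((2 ^ (p * (2 * j + 1)) : ℝ)⁻¹ ≤ r ∧
      r ≤ 2 * (2 ^ (p * (2 * j + 1)) : ℝ)⁻¹) ∧ ∀ x z, ∃ i, x + W.moved r i z ∉ A := by
    intro j
    by_cases hj : j < J
    · obtain ⟨r, hr, hrb⟩ := hcon (2 ^ (p * (2 * j + 1)) : ℝ)⁻¹ (2 * (2 ^ (p * (2 * j + 1)) : ℝ)⁻¹)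
        (by positivity) (by
          rw [two_mul, add_sub_cancel_right, Real.exp_neg]
          refine inv_anti₀ (by positivity) ?_
          have h2e : (2 : ℝ) ≤ Real.exp 1 := by linarith [Real.exp_one_gt_d9]
          calc (2 : ℝ) ^ (p * (2 * j + 1)) ≤ 2 ^ (p * (2 * J)) :=
                pow_le_pow_right₀ one_le_two (Nat.mul_le_mul_left p (by omega))
            _ ≤ Real.exp 1 ^ (p * (2 * J)) := by gcongr
            _ = Real.exp ((p * (2 * J) : ℕ) : ℝ) := by rw [← Real.exp_nat_mul, mul_one]
            _ ≤ _ := Real.exp_le_exp.mpr hpJ)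
      exact ⟨r, fun _ => ⟨hr, hrb⟩⟩
    · exact ⟨0, fun h => absurd h hj⟩
  choose r hr using hbad
  obtain ⟨j, hj, x, z, hxz⟩ := h δ hδ hδ1 p J hp2 (Nat.le_ceil _) (fun j => p * (2 * j + 1)) r
    (fun j _ => Nat.le_mul_of_pos_right p (by omega)) (fun j _ => by
      ring_nf
      exact le_refl _) (fun j hj => (hr j hj).1) A hA hδA
  obtain ⟨i, hi⟩ := (hr j hj).2 x z
  exact hi (hxz i)

end Copies

/-! ### The double simplex -/

section DoubleSimplex

open scoped RealInnerProductSpace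

namespace DistanceGraph

/-- A proper `k`-degenerate graph is `k`-degenerate: in a subgraph, the last vertex of the ordering
has only neighbours among its predecessors. -/
theorem IsProper.isDegenerate {m k : ℕ} {Γ : DistanceGraph m} (h : Γ.IsProper k) :
    Γ.IsDegenerate k := by
  obtain ⟨v, hv⟩ := h
  intro H hH
  obtain ⟨a, haH, hmax⟩ := Set.exists_max_image H.verts v.symm H.verts.toFinite hH
  refine ⟨a, haH, le_trans ?_ (hv (v.symm a)).1⟩
  have hfin : (Γ.predecessors v (v.symm a)).Finite := by
    refine (Set.finite_range fun i => (v i : E m)).subset ?_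
    rintro x ⟨i, -, -, rfl⟩
    exact ⟨i, rfl⟩
  refine Set.ncard_le_ncard_of_injOn (fun w => (w : E m)) (fun w hw => ?_)
    Subtype.val_injective.injOn hfin
  have hadj : H.Adj a w := hw
  refine ⟨v.symm w, lt_of_le_of_ne (hmax w hadj.snd_mem) fun h => ?_, ?_, ?_⟩
  · exact hadj.adj_sub.ne (v.symm.injective h).symm
  · simpa using hadj.adj_sub.symm
  · simp

end DistanceGraph

variable {k : ℕ}

/-- The multiple `t • (1, …, 1)` of the all-ones vector. -/
noncomputable def diagPoint (k : ℕ) (t : ℝ) : E k := WithLp.toLp 2 fun _ => t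

theorem norm_sq_diagPoint_sub_diagPoint (s t : ℝ) :
    ‖diagPoint k s - diagPoint k t‖ ^ 2 = k * (s - t) ^ 2 := by
  rw [EuclideanSpace.norm_sq_eq]
  simp [diagPoint]

theorem norm_sq_single_sub_diagPoint (i : Fin k) (t : ℝ) :
    ‖EuclideanSpace.single i (1 : ℝ) - diagPoint k t‖ ^ 2 = k * t ^ 2 - 2 * t + 1 := by
  have h1 : ‖diagPoint k t‖ ^ 2 = k * t ^ 2 := by
    rw [EuclideanSpace.norm_sq_eq]
    simp [diagPoint]
  have h2 : ⟪EuclideanSpace.single i (1 : ℝ), diagPoint k t⟫ = t := by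
    rw [EuclideanSpace.inner_single_left]
    simp [diagPoint]
  rw [norm_sub_sq_real, h1, h2]
  simp
  ring

theorem norm_sq_single_sub_single {i j : Fin k} (hij : i ≠ j) :
    ‖EuclideanSpace.single i (1 : ℝ) - EuclideanSpace.single j (1 : ℝ)‖ ^ 2 = 2 := by
  rw [norm_sub_sq_real, EuclideanSpace.inner_single_left]
  simp [hij]
  norm_num

/-- The standard simplex together with a point off its hyperplane is affinely independent. -/
theorem affineIndependent_insert_diagPoint {t : ℝ} (ht : k * t ≠ 1) :
    AffineIndependent ℝ (Subtype.val : (insert (diagPoint k t)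
      (Set.range fun i : Fin k => EuclideanSpace.single i (1 : ℝ)) : Set (E k)) → E k) := by
  have h : AffineIndependent ℝ fun o : Option (Fin k) =>
      o.elim (diagPoint k t) fun i => EuclideanSpace.single i (1 : ℝ) := by
    rw [affineIndependent_iff_of_fintype]
    intro w hw hw0
    rw [Finset.univ.weightedVSub_eq_linear_combination hw, Fintype.sum_option] at hw0
    rw [Fintype.sum_option] at hw
    have hcoord : ∀ i, w none * t + w (some i) = 0 := by
      intro i
      have := congrArg (fun y : E k => y i) hw0
      simpa [diagPoint, Pi.single_apply] using this
    have hsum : ∑ i : Fin k, w (some i) = -(k * t * w none) := by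
      have : ∀ i, w (some i) = -(w none * t) := fun i => by linarith [hcoord i]
      simp only [this]
      simp
      ring
    have h0 : w none = 0 := by
      rw [hsum] at hw
      have : w none * (1 - k * t) = 0 := by linarith
      exact (mul_eq_zero.mp this).resolve_right (sub_ne_zero.mpr ht.symm)
    rintro (_ | i)
    · exact h0
    · have := hcoord i
      rwa [h0, zero_mul, zero_add] at this
  have hrange : Set.range (fun o : Option (Fin k) =>
      o.elim (diagPoint k t) fun i => EuclideanSpace.single i (1 : ℝ)) =
      insert (diagPoint k t) (Set.range fun i : Fin k => EuclideanSpace.single i (1 : ℝ)) := by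
    ext x
    simp only [Set.mem_range, Option.exists, Option.elim_none, Option.elim_some,
      Set.mem_insert_iff, eq_comm]
  rw [← hrange]
  exact h.range

/-- The vertices of the double simplex: the standard basis vectors, and the two points at distance
`√2` from all of them. -/
noncomputable def doubleSimplexPoint (k : ℕ) (i : Fin (k + 2)) : E k :=
  if h : (i : ℕ) < k then EuclideanSpace.single ⟨i, h⟩ 1
  else if (i : ℕ) = k then diagPoint k ((1 + √(1 + k)) / k) else diagPoint k ((1 - √(1 + k)) / k)

theorem norm_sq_doubleSimplexPoint_sub (hk : 1 ≤ k) {i j : Fin (k + 2)} (hij : i < j) :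
    ‖doubleSimplexPoint k i - doubleSimplexPoint k j‖ ^ 2 =
      if (i : ℕ) < k then 2 else 4 * ((k : ℝ) + 1) / k := by
  have hk0 : (k : ℝ) ≠ 0 := by positivity
  have hs : √(1 + k : ℝ) ^ 2 = 1 + k := Real.sq_sqrt (by positivity)
  by_cases hi : (i : ℕ) < k
  · rw [if_pos hi, doubleSimplexPoint, dif_pos hi]
    unfold doubleSimplexPoint
    split_ifs with h1 h2
    · exact norm_sq_single_sub_single fun h => hij.ne (Fin.ext (Fin.mk.inj h))
    all_goals
      rw [norm_sq_single_sub_diagPoint]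
      field_simp
      linear_combination hs
  · have hik : (i : ℕ) = k := by have := j.2; omega
    have hjk : ¬ (j : ℕ) < k := by omega
    have hjk' : (j : ℕ) ≠ k := by omega
    rw [if_neg hi, doubleSimplexPoint, dif_neg hi, if_pos hik, doubleSimplexPoint, dif_neg hjk,
      if_neg hjk', norm_sq_diagPoint_sub_diagPoint]
    field_simp
    linear_combination 4 * hs

theorem doubleSimplexPoint_injective (hk : 1 ≤ k) :
    Function.Injective (doubleSimplexPoint k) := by
  have key : ∀ i j : Fin (k + 2), i < j → doubleSimplexPoint k i ≠ doubleSimplexPoint k j := by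
    intro i j hij h
    have := norm_sq_doubleSimplexPoint_sub hk hij
    rw [h, sub_self, norm_zero, zero_pow two_ne_zero] at this
    split_ifs at this
    · norm_num at this
    · have h2 : 0 < 4 * ((k : ℝ) + 1) / k := by positivity
      linarith
  intro i j h
  by_contra hne
  rcases lt_or_gt_of_ne hne with h1 | h1
  · exact key i j h1 h
  · exact key j i h1 h.symm

/-- Two regular simplices in `ℝᵏ` with a common facet: all pairs of points at distance `√2` are
joined, that is, all pairs except the two apexes. -/
noncomputable def doubleSimplex (k : ℕ) (hk : 1 ≤ k) : DistanceGraph k where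
  verts := Finset.univ.map ⟨doubleSimplexPoint k, doubleSimplexPoint_injective hk⟩
  graph :=
    { Adj v w := ‖(v : E k) - w‖ ^ 2 = 2
      symm := ⟨fun v w h => by rw [norm_sub_rev]; exact h⟩
      loopless := ⟨fun v h => by simp at h⟩ }
  connected := by
    have hmem : ∀ i, doubleSimplexPoint k i ∈
        Finset.univ.map ⟨doubleSimplexPoint k, doubleSimplexPoint_injective hk⟩ :=
      fun i => Finset.mem_map_of_mem _ (Finset.mem_univ i)
    rw [SimpleGraph.connected_iff_exists_forall_reachable]
    refine ⟨⟨_, hmem 0⟩, ?_⟩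
    rintro ⟨x, hx⟩
    obtain ⟨i, -, rfl⟩ := Finset.mem_map.mp hx
    rcases (Fin.zero_le i).eq_or_lt with rfl | hi
    · exact SimpleGraph.Reachable.refl _
    · refine SimpleGraph.Adj.reachable ?_
      have := norm_sq_doubleSimplexPoint_sub hk hi
      rw [if_pos (show ((0 : Fin (k + 2)) : ℕ) < k from hk)] at this
      exact this

theorem isProper_doubleSimplex (hk : 1 ≤ k) : (doubleSimplex k hk).IsProper k := by
  have hk0 : (k : ℝ) ≠ 0 := by positivity
  have hcard : (doubleSimplex k hk).verts.card = k + 2 := by simp [doubleSimplex]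
  set P := doubleSimplexPoint k with hP
  set e : Fin (k + 2) ≃ (doubleSimplex k hk).verts := Equiv.ofBijective
    (fun i => ⟨P i, Finset.mem_map_of_mem _ (Finset.mem_univ i)⟩) (by
      constructor
      · intro i j hij
        exact doubleSimplexPoint_injective hk (Subtype.mk.inj hij)
      · rintro ⟨x, hx⟩
        obtain ⟨i, -, rfl⟩ := Finset.mem_map.mp hx
        exact ⟨i, rfl⟩) with he
  set v := (finCongr hcard).trans e with hv
  refine ⟨v, fun j => ?_⟩
  set S : Set (E k) := Set.range fun i : Fin k => EuclideanSpace.single i (1 : ℝ) with hS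
  have hsub : (doubleSimplex k hk).predecessors v j ⊆ S := by
    rintro x ⟨i, hij, hadj, rfl⟩
    have h1 : ‖P (finCongr hcard i) - P (finCongr hcard j)‖ ^ 2 = 2 := hadj
    have h2 : finCongr hcard i < finCongr hcard j := hij
    rw [norm_sq_doubleSimplexPoint_sub hk h2] at h1
    split_ifs at h1 with h3
    · refine ⟨⟨_, h3⟩, ?_⟩
      change _ = P (finCongr hcard i)
      rw [hP, doubleSimplexPoint, dif_pos h3]
    · rw [div_eq_iff hk0] at h1
      have : (0 : ℝ) < k := by positivity
      linarith
  have hsqrt : √(1 + k : ℝ) ≠ 0 := by positivity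
  have hins : ∃ t : ℝ, k * t ≠ 1 ∧ (v j : E k) ∈ insert (diagPoint k t) S := by
    change ∃ t : ℝ, k * t ≠ 1 ∧ P (finCongr hcard j) ∈ insert (diagPoint k t) S
    rw [hP, doubleSimplexPoint]
    have hplus : k * ((1 + √(1 + k : ℝ)) / k) ≠ 1 := by
      rw [mul_div_cancel₀ _ hk0]
      simpa using hsqrt
    have hminus : k * ((1 - √(1 + k : ℝ)) / k) ≠ 1 := by
      rw [mul_div_cancel₀ _ hk0]
      simpa using hsqrt
    split_ifs with h1 h2
    · exact ⟨_, hplus, Set.mem_insert_of_mem _ ⟨_, rfl⟩⟩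
    · exact ⟨_, hplus, Set.mem_insert _ _⟩
    · exact ⟨_, hminus, Set.mem_insert _ _⟩
  constructor
  · refine (Set.ncard_le_ncard hsub (Set.finite_range _)).trans ?_
    rw [hS, ← Set.image_univ]
    refine (Set.ncard_image_le).trans ?_
    simp [Set.ncard_univ]
  · obtain ⟨t, ht, hmem⟩ := hins
    exact (affineIndependent_insert_diagPoint ht).mono
      (Set.insert_subset hmem (hsub.trans (Set.subset_insert _ _)))

/-- In `ℝᵏ` the second apex of a double simplex is the reflection of the first, which determines
the quadratic form on the left. -/
theorem sum_norm_sq_eq_of_norm_sq_sub_eq {r : ℝ} (hk : 1 ≤ k) (hr : r ≠ 0) {y : Fin k → E k}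
    {p q : E k} (hpq : p ≠ q) (hy : ∀ i j, i ≠ j → ‖y i - y j‖ ^ 2 = 2 * r ^ 2)
    (hp : ∀ i, ‖y i - p‖ ^ 2 = 2 * r ^ 2) (hq : ∀ i, ‖y i - q‖ ^ 2 = 2 * r ^ 2) :
    k * ‖p‖ ^ 2 + k * ‖q‖ ^ 2 - 2 * ∑ i, ‖y i‖ ^ 2 = 4 * r ^ 2 := by
  have hk0 : (k : ℝ) ≠ 0 := by positivity
  have hk1 : (k : ℝ) + 1 ≠ 0 := by positivity
  set z : Fin k → E k := fun i => y i - p with hz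
  set w : E k := q - p with hw
  have hw0 : w ≠ 0 := sub_ne_zero.mpr hpq.symm
  have hzz : ∀ i j, ⟪z i, z j⟫ = r ^ 2 + if i = j then r ^ 2 else 0 := by
    intro i j
    split_ifs with h
    · rw [h, real_inner_self_eq_norm_sq, hp]; ring
    · have h1 := norm_sub_sq_real (z i) (z j)
      have h2 : z i - z j = y i - y j := by simp [hz]
      rw [h2, hy i j h, hp, hp] at h1
      linarith
  have hzw : ∀ i, ⟪z i, w⟫ = ‖w‖ ^ 2 / 2 := by
    intro i
    have h1 := norm_sub_sq_real (z i) w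
    have h2 : z i - w = y i - q := by simp [hz, hw]
    rw [h2, hq, hp] at h1
    linarith
  have hzs : ∀ i, ⟪z i, ∑ j, z j⟫ = (k + 1) * r ^ 2 := by
    intro i
    rw [inner_sum]
    simp only [hzz, Finset.sum_add_distrib, Finset.sum_ite_eq, Finset.mem_univ, if_true]
    simp
    ring
  -- the Gram matrix of the `z i` is `r ^ 2` times the identity plus the all-ones matrix
  have hli : LinearIndependent ℝ z := by
    rw [Fintype.linearIndependent_iff]
    intro c hc
    have h1 : ∀ j, ∑ i, c i + c j = 0 := by
      intro j
      have h2 : ⟪∑ i, c i • z i, z j⟫ = 0 := by rw [hc, inner_zero_left]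
      rw [sum_inner] at h2
      simp only [inner_smul_left, hzz, mul_add, Finset.sum_add_distrib, mul_ite, mul_zero,
        Finset.sum_ite_eq', Finset.mem_univ, if_true, conj_trivial, ← Finset.sum_mul] at h2
      rw [← add_mul] at h2
      exact (mul_eq_zero.mp h2).resolve_right (pow_ne_zero 2 hr)
    have h3 : ∑ j, (∑ i, c i + c j) = 0 := Finset.sum_eq_zero fun j _ => h1 j
    rw [Finset.sum_add_distrib] at h3
    simp only [Finset.sum_const, Finset.card_univ, Fintype.card_fin, nsmul_eq_mul] at h3
    have h4 : (k + 1) * ∑ i, c i = 0 := by linarith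
    intro j
    have := h1 j
    rwa [(mul_eq_zero.mp h4).resolve_left hk1, zero_add] at this
  have : Nonempty (Fin k) := ⟨⟨0, hk⟩⟩
  have hspan := hli.span_eq_top_of_card_eq_finrank (by simp)
  set β := ‖w‖ ^ 2 / 2 / ((k + 1) * r ^ 2) with hβ
  -- `w` has the same inner product with all `z i`, so it is a multiple of their sum
  have hdet : w = β • ∑ j, z j := by
    rw [← sub_eq_zero]
    refine (inner_self_eq_zero (𝕜 := ℝ)).mp (inner_eq_zero_of_mem_span (e := z) (fun j => ?_)
      (hspan ▸ Submodule.mem_top))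
    rw [real_inner_comm, inner_sub_right, inner_smul_right, hzw, hzs, hβ]
    field_simp
    ring
  have hww : ‖w‖ ^ 2 = β * (k * (‖w‖ ^ 2 / 2)) := by
    have : ⟪∑ j, z j, w⟫ = k * (‖w‖ ^ 2 / 2) := by
      rw [sum_inner]
      simp [hzw]
    rw [← this, ← real_inner_smul_left, ← hdet, real_inner_self_eq_norm_sq]
  have hβk : β * k = 2 := by
    have h1 : ‖w‖ ^ 2 ≠ 0 := pow_ne_zero 2 (norm_ne_zero_iff.mpr hw0)
    refine mul_right_cancel₀ h1 ?_
    linarith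
  have hw2 : k * ‖w‖ ^ 2 = 4 * ((k + 1) * r ^ 2) := by
    have h1 : ‖w‖ ^ 2 = 2 * (β * ((k + 1) * r ^ 2)) := by
      rw [hβ]
      field_simp
    rw [h1]
    linear_combination 2 * ((k + 1) * r ^ 2) * hβk
  have hsum : ∑ i, ‖y i‖ ^ 2 = k * ‖p‖ ^ 2 + 2 * ⟪p, ∑ j, z j⟫ + k * (2 * r ^ 2) := by
    have h1 : ∀ i, ‖y i‖ ^ 2 = ‖p‖ ^ 2 + 2 * ⟪p, z i⟫ + 2 * r ^ 2 := by
      intro i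
      rw [← hp i, ← norm_add_sq_real, add_sub_cancel]
    simp only [h1, Finset.sum_add_distrib, ← Finset.mul_sum, inner_sum]
    simp
    ring
  have hq2 : ‖q‖ ^ 2 = ‖p‖ ^ 2 + 2 * (β * ⟪p, ∑ j, z j⟫) + ‖w‖ ^ 2 := by
    rw [← real_inner_smul_right, ← hdet, ← norm_add_sq_real, hw, add_sub_cancel]
  rw [hsum, hq2]
  linear_combination hw2 + 2 * ⟪p, ∑ j, z j⟫ * hβk

end DoubleSimplex

/-! ### A set that misses arbitrarily large dilates of the double simplex -/

section Sharpness

variable {k : ℕ}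

/-- One of finitely many sets that cover the space has positive upper Banach density. -/
theorem exists_upperBanachDensity_pos {d : ℕ} {ι : Type*} [Fintype ι] (A : ι → Set (E d))
    (hA : ⋃ i, A i = Set.univ) : ∃ i, 0 < upperBanachDensity (A i) := by
  by_contra! hcon
  set c : ENNReal := ((Fintype.card ι : ENNReal) + 1)⁻¹ with hc
  have hc0 : 0 < c := by simp [hc]
  have h1 : ∀ i, ∀ᶠ M : ℝ in atTop,
      ⨆ t : E d, volume (A i ∩ cube t M) / volume (cube (0 : E d) M) < c := fun i =>
    eventually_lt_of_limsup_lt ((hcon i).trans_lt hc0)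
  obtain ⟨M, hM, hM0⟩ := ((eventually_all.mpr h1).and (eventually_gt_atTop (0 : ℝ))).exists
  have h2 : ∀ i, volume (cubeMap 0 M ⁻¹' A i ∩ unitCube d) ≤ c := by
    intro i
    rw [← volume_inter_cube_div _ _ hM0]
    exact (le_iSup (fun t : E d => volume (A i ∩ cube t M) / volume (cube (0 : E d) M)) 0).trans
      (hM i).le
  have h3 : (1 : ENNReal) ≤ Fintype.card ι * c := by
    calc (1 : ENNReal) = volume (⋃ i, cubeMap 0 M ⁻¹' A i ∩ unitCube d) := by
          rw [← Set.iUnion_inter, ← Set.preimage_iUnion, hA, Set.preimage_univ, Set.univ_inter,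
            volume_unitCube]
      _ ≤ ∑ i, volume (cubeMap 0 M ⁻¹' A i ∩ unitCube d) := measure_iUnion_fintype_le _ _
      _ ≤ ∑ _i : ι, c := Finset.sum_le_sum fun i _ => h2 i
      _ = Fintype.card ι * c := by simp
  rw [hc, ← div_eq_mul_inv, ENNReal.le_div_iff_mul_le (by simp) (by simp), one_mul] at h3
  have h4 : (Fintype.card ι + 1 : ℕ) ≤ Fintype.card ι := by exact_mod_cast h3
  omega

/-- The points whose squared norm has its fractional part in `[i / n, (i + 1) / n)`. -/
def normSqShell (k n i : ℕ) : Set (E k) :=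
  {x | (i : ℝ) / n ≤ Int.fract (‖x‖ ^ 2) ∧ Int.fract (‖x‖ ^ 2) < ((i : ℝ) + 1) / n}

theorem measurableSet_normSqShell (k n i : ℕ) : MeasurableSet (normSqShell k n i) := by
  have h : Measurable fun x : E k => Int.fract (‖x‖ ^ 2) := by fun_prop
  exact h measurableSet_Ico

theorem iUnion_normSqShell {n : ℕ} (hn : 0 < n) :
    ⋃ i : Fin n, normSqShell k n i = Set.univ := by
  refine Set.eq_univ_of_forall fun x => Set.mem_iUnion.mpr ?_
  have hn' : (0 : ℝ) < n := by exact_mod_cast hn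
  have h0 := Int.fract_nonneg (‖x‖ ^ 2)
  have h1 := Int.fract_lt_one (‖x‖ ^ 2)
  refine ⟨⟨⌊Int.fract (‖x‖ ^ 2) * n⌋₊, ?_⟩, ?_, ?_⟩
  · rw [Nat.floor_lt (by positivity)]
    exact mul_lt_of_lt_one_left hn' h1
  · rw [div_le_iff₀ hn']
    exact Nat.floor_le (by positivity)
  · rw [lt_div_iff₀ hn']
    exact Nat.lt_floor_add_one _

theorem exists_int_of_mem_normSqShell {n i : ℕ} {x : E k}
    (hx : x ∈ normSqShell k n i) :
    ∃ (a : ℤ) (θ : ℝ), 0 ≤ θ ∧ θ ≤ 1 / n ∧ ‖x‖ ^ 2 = i / n + a + θ := by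
  obtain ⟨h1, h2⟩ := hx
  refine ⟨⌊‖x‖ ^ 2⌋, Int.fract (‖x‖ ^ 2) - i / n, by linarith, ?_, ?_⟩
  · rw [add_div] at h2
    linarith
  · have := Int.floor_add_fract (‖x‖ ^ 2)
    linarith

/-- The quadratic form of `sum_norm_sq_eq_of_norm_sq_sub_eq` is within less than `1/2` of an
integer on points of a thin shell, so it avoids half-integers. -/
theorem not_hasCopyIn_doubleSimplex (hk : 1 ≤ k) (i : ℕ) {r : ℝ} (hr : 0 < r) {a : ℤ}
    (ha : 4 * r ^ 2 = a + 1 / 2) :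
    ¬ (doubleSimplex k hk).HasCopyIn r (normSqShell k (8 * k) i) := by
  rintro ⟨Γ', ⟨φ, hφ⟩, hsub⟩
  have hmem : ∀ j, doubleSimplexPoint k j ∈ (doubleSimplex k hk).verts :=
    fun j => Finset.mem_map_of_mem _ (Finset.mem_univ j)
  set Y : Fin (k + 2) → E k := fun j => φ ⟨_, hmem j⟩ with hY
  have hYmem : ∀ j, Y j ∈ normSqShell k (8 * k) i := fun j => hsub (φ ⟨_, hmem j⟩).2
  have hYinj : Function.Injective Y := fun j l h =>
    doubleSimplexPoint_injective hk (Subtype.mk.inj (φ.injective (Subtype.ext h)))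
  have hYdist : ∀ j l : Fin (k + 2), j < l → (j : ℕ) < k → ‖Y j - Y l‖ ^ 2 = 2 * r ^ 2 := by
    intro j l hjl hj
    have h1 := norm_sq_doubleSimplexPoint_sub hk hjl
    rw [if_pos hj] at h1
    rw [hY]
    simp only
    rw [hφ ⟨_, hmem j⟩ ⟨_, hmem l⟩ h1, mul_pow, h1, mul_comm]
  set y : Fin k → E k := fun j => Y (Fin.castLE (by omega) j) with hy
  set p := Y ⟨k, by omega⟩ with hp
  set q := Y ⟨k + 1, by omega⟩ with hq
  have key := sum_norm_sq_eq_of_norm_sq_sub_eq hk hr.ne' (y := y) (p := p) (q := q)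
    (hYinj.ne (by simp)) (fun j l hjl => by
      rcases lt_or_gt_of_ne hjl with h | h
      · exact hYdist _ _ h j.2
      · rw [norm_sub_rev]; exact hYdist _ _ h l.2)
    (fun j => hYdist _ _ (Fin.mk_lt_mk.mpr j.2) j.2)
    (fun j => hYdist _ _ (Fin.mk_lt_mk.mpr (j.2.trans (Nat.lt_succ_self k))) j.2)
  have hk0 : (0 : ℝ) < k := by exact_mod_cast hk
  obtain ⟨b, β, hβ0, hβ1, hb⟩ := exists_int_of_mem_normSqShell (hYmem ⟨k, by omega⟩)
  obtain ⟨c, γ, hγ0, hγ1, hc⟩ := exists_int_of_mem_normSqShell (hYmem ⟨k + 1, by omega⟩)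
  have h : ∀ j : Fin k, ∃ (a : ℤ) (θ : ℝ), 0 ≤ θ ∧ θ ≤ 1 / (8 * k : ℕ) ∧
      ‖y j‖ ^ 2 = i / (8 * k : ℕ) + a + θ := fun j => exists_int_of_mem_normSqShell (hYmem _)
  choose e ε hε0 hε1 he using h
  have hsum : ∑ j, ‖y j‖ ^ 2 = k * (i / (8 * k : ℕ)) + (∑ j, e j : ℤ) + ∑ j, ε j := by
    simp only [he, Finset.sum_add_distrib]
    simp
  have hε0' : 0 ≤ ∑ j, ε j := Finset.sum_nonneg fun j _ => hε0 j
  have hε1' : ∑ j, ε j ≤ 1 / 8 := by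
    calc ∑ j, ε j ≤ ∑ _j : Fin k, (1 : ℝ) / (8 * k : ℕ) := Finset.sum_le_sum fun j _ => hε1 j
      _ = 1 / 8 := by simp; field_simp
  have hβ1' : k * β ≤ 1 / 8 := by
    calc k * β ≤ k * (1 / (8 * k : ℕ)) := by gcongr
      _ = 1 / 8 := by push_cast; field_simp
  have hγ1' : k * γ ≤ 1 / 8 := by
    calc k * γ ≤ k * (1 / (8 * k : ℕ)) := by gcongr
      _ = 1 / 8 := by push_cast; field_simp
  have hβ0' : 0 ≤ k * β := by positivity
  have hγ0' : 0 ≤ k * γ := by positivity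
  change ‖p‖ ^ 2 = _ at hb
  change ‖q‖ ^ 2 = _ at hc
  rw [hsum, hb, hc, ha] at key
  set D : ℤ := k * b + k * c - 2 * (∑ j, e j) - a with hD
  have hDr : (D : ℝ) = k * b + k * c - 2 * ((∑ j, e j : ℤ) : ℝ) - a := by
    rw [hD]; push_cast; rfl
  have hD1 : (D : ℝ) = 1 / 2 - k * β - k * γ + 2 * ∑ j, ε j := by
    rw [hDr]
    linear_combination key
  have hpos : (0 : ℝ) < D := by rw [hD1]; linarith
  have hlt : (D : ℝ) < 1 := by rw [hD1]; linarith
  have h1 : 0 < D := by exact_mod_cast hpos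
  have h2 : D < 1 := by exact_mod_cast hlt
  omega

theorem exists_doubleSimplex_counterexample (hk : 1 ≤ k) :
    ∃ A : Set (E k), NullMeasurableSet A volume ∧ 0 < upperBanachDensity A ∧
      ∀ r₀ : ℝ, ∃ r : ℝ, r₀ ≤ r ∧ ¬ (doubleSimplex k hk).HasCopyIn r A := by
  obtain ⟨i, hi⟩ := exists_upperBanachDensity_pos (fun i : Fin (8 * k) => normSqShell k (8 * k) i)
    (iUnion_normSqShell (by omega))
  refine ⟨_, (measurableSet_normSqShell k (8 * k) i).nullMeasurableSet, hi, fun r₀ => ?_⟩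
  obtain ⟨n, hn⟩ := exists_nat_ge (4 * r₀ ^ 2)
  refine ⟨√((n + 1 / 2) / 4), (le_abs_self r₀).trans (Real.abs_le_sqrt (by linarith)),
    not_hasCopyIn_doubleSimplex hk i (Real.sqrt_pos.mpr (by positivity)) (a := n) ?_⟩
  rw [Real.sq_sqrt (by positivity)]
  push_cast
  ring

end Sharpness

/-- `NullMeasurableSet A volume` says that `A` is Lebesgue measurable. -/
theorem theorem1 :
    -- sets of positive upper Banach density contain all large dilates
    (∀ (k m d : ℕ) (Γ : DistanceGraph m), m ≤ d → k + 1 ≤ d →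
      Γ.IsDegenerate k → Γ.IsProper k →
      ∀ A : Set (E d), NullMeasurableSet A volume → 0 < upperBanachDensity A →
        ∃ r₀ : ℝ, 0 < r₀ ∧ ∀ r : ℝ, r₀ ≤ r → Γ.HasCopyIn r A) ∧
    -- sets in the unit cube contain an interval of dilates, with an absolute constant `C` and a constant `CΓ` that does not depend on `A`
    (∃ C : ℝ, 0 < C ∧
      ∀ (k m d : ℕ) (Γ : DistanceGraph m), m ≤ d → k + 1 ≤ d →
      Γ.IsDegenerate k → Γ.IsProper k →
      ∃ CΓ : ℝ, 0 < CΓ ∧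
        ∀ A : Set (E d), NullMeasurableSet A volume → A ⊆ unitCube d → 0 < volume A →
          ∃ a b : ℝ, 0 < a ∧
            Real.exp (-(CΓ * (volume.real A) ^ (-(C * (Γ.verts.card : ℝ))))) ≤ b - a ∧
            ∀ r ∈ Set.Icc a b, Γ.HasCopyIn r A) ∧
    -- sharpness: the first assertion fails for `d = k`
    (∀ k : ℕ, 1 ≤ k →
      ∃ Γ : DistanceGraph k, Γ.IsDegenerate k ∧ Γ.IsProper k ∧
        ∃ A : Set (E k), NullMeasurableSet A volume ∧ 0 < upperBanachDensity A ∧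
          ∀ r₀ : ℝ, ∃ r : ℝ, r₀ ≤ r ∧ ¬ Γ.HasCopyIn r A) := by
  refine ⟨fun k m d Γ hmd hkd _ hΓ A hA hpos => ?_,
    ⟨3, by norm_num, fun k m d Γ hmd hkd _ hΓ => ?_⟩, fun k hk =>
      ⟨doubleSimplex k hk, (isProper_doubleSimplex hk).isDegenerate, isProper_doubleSimplex hk,
        exists_doubleSimplex_counterexample hk⟩⟩
  · obtain ⟨W, hW⟩ := Γ.exists_flexibleConfig hmd hkd hΓ
    obtain ⟨r₀, hr₀, h⟩ := W.exists_forall_ge_forall_mem Γ.card_verts_pos (by omega) hA hpos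
    refine ⟨r₀, hr₀, fun r hr => ?_⟩
    obtain ⟨x, z, hxz⟩ := h r hr
    exact hW r (hr₀.trans_le hr) A x z hxz
  · obtain ⟨W, hW⟩ := Γ.exists_flexibleConfig hmd hkd hΓ
    obtain ⟨C, hC, h⟩ := W.exists_Icc_forall_mem Γ.card_verts_pos (by omega)
    refine ⟨C, hC, fun A hA hAc hApos => ?_⟩
    obtain ⟨a, b, ha, hab, hr⟩ := h A hA hAc hApos
    refine ⟨a, b, ha, hab, fun r hrI => ?_⟩
    obtain ⟨x, z, hxz⟩ := hr r hrI
    exact hW r (ha.trans_le hrI.1) A x z hxz
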